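/- Let $\eta_0(x)=\sqrt{1-x^2}\,\mathbf 1_{\{|x|<1\}}$ and, for $\mu>0$, $\mathcal I_\mu=(-1/\mu,1/\mu)$. For $\Theta=(\theta_1,\theta_2)\in H^1_{\rm loc}(\mathcal I_\mu;\mathbb R^2)$ (identified with its continuous representative) let $$I_{\mu,1}(\Theta)=\frac12\int_{\mathcal I_\mu}\Big[\eta_0(\mu y)^2(\theta_1')^2+\eta_0(\mu y)^2(\theta_2')^2+\eta_0(\mu y)^4\theta_1^2\theta_2^2\Big]dy\quad\text{if }\theta_1^2+\theta_2^2=1\text{ on }\mathcal I_\mu,$$ and $I_{\mu,1}(\Theta)=+\infty$ otherwise. Let $\mathcal E_s$ be the set of $\Theta\in H^1_{\rm loc}(\mathcal I_\mu;\mathbb R^2)$ with $I_{\mu,1}(\Theta)<\infty$ and $\theta_1(y)=\theta_2(-y)$ for $y\in\mathcal I_\mu$. A critical point of $I_{\mu,1}$ in $\mathcal E_s$ is a $\Theta\in\mathcal E_s$ such that $\frac{d}{dt}\big|_{t=0}I_{\mu,1}(\Theta_t)=0$, where $$\Theta_t=\big(\theta_1\cos(t\varphi)+\theta_2\sin(t\varphi),\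 \theta_2\cos(t\varphi)-\theta_1\sin(t\varphi)\big),$$ for every odd $\varphi\in C_c^\infty(\mathcal I_\mu)$ (writing $\Theta=(\sin u,\cos u)$, this is the weak form of $-\frac{d}{dy}\big[\eta_0(\mu y)^2u'\big]+\frac14\eta_0(\mu y)^4\sin(4u)=0$ on $\mathcal I_\mu$). A saddle point is a critical point such that, for every $\delta>0$, there are $\Xi_-,\Xi_+\in\mathcal E_s$ with $I_{\mu,1}(\Xi_-)<I_{\mu,1}(\Theta)<I_{\mu,1}(\Xi_+)$ and, for $\Xi=\Xi_\pm$, with the components of $\Xi-\Theta$ bounded by $\delta$ in absolute value on $\mathcal I_\mu$ and $\int_{\mathcal I_\mu}\eta_0(\mu y)^2|\Xi'-\Theta'|^2dy\le\delta^2$. The symmetric state is $\theta_1=\theta_2=\frac1{\sqrt2}$. A domain wall state is a critical point in $\mathcal E_s$ with $\theta_1\not\equiv\theta_2$ on $\mathcal I_\mu$. **Theorem.** There exists $\mu_0\in(0,\infty)$ such that: * if $\mu\in[\mu_0,\infty)$, the symmetric state is a global minimizer of $I_{\mu,1}$ in $\mathcal E_s$, and there are no domain wall states; * if $\mu\in(0,\mu_0)$,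 the symmetric state is a saddle point of $I_{\mu,1}$ in $\mathcal E_s$; there exists a domain wall state with $\theta_1(y)>\theta_2(y)>0$ for $0<y<1/\mu$; and a state $\Theta$ is a global minimizer of $I_{\mu,1}$ in $\mathcal E_s$ if and only if $\Theta$ is a domain wall state with $\theta_1(y)\neq\theta_2(y)$ for all $0<y<1/\mu$. -/

import Mathlib

open MeasureTheory Set
open scoped ENNReal ContDiff

noncomputable section

namespace DomainWall

/-- The Thomas–Fermi cloud `η₀(x) = √(1 - x²) 𝟏_{|x| < 1}`. -/
def eta0 (x : ℝ) : ℝ := if |x| < 1 then √(1 - x ^ 2) else 0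

/-- The interval `𝓘_μ = (-1/μ, 1/μ)`. -/
def interv (μ : ℝ) : Set ℝ := Ioo (-(1 / μ)) (1 / μ)

/-- A two-component state `Θ = (θ₁, θ₂)`. Only the values on `𝓘_μ` matter below. -/
abbrev State : Type := (ℝ → ℝ) × (ℝ → ℝ)

/-- `f ∈ H¹_loc(𝓘_μ)`, `f` being the continuous representative: on each compact subinterval `[a, b]`
of `𝓘_μ`, the function is absolutely continuous and its derivative, which then exists almost
everywhere and is the weak derivative, is square integrable. -/
def H1loc (μ : ℝ) (f : ℝ → ℝ) : Prop :=
  ∀ a ∈ interv μ, ∀ b ∈ interv μ, a ≤ b →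
    AbsolutelyContinuousOnInterval f a b ∧ MemLp (deriv f) 2 (volume.restrict (Icc a b))

open Classical in
/-- The reduced limit energy `I_{μ,1}(Θ) ∈ [0, ∞]`: the weighted Dirichlet-plus-interaction integral
if `θ₁² + θ₂² = 1` on `𝓘_μ`, and `+∞` otherwise. -/
def energy (μ : ℝ) (Θ : State) : ℝ≥0∞ :=
  if ∀ y ∈ interv μ, Θ.1 y ^ 2 + Θ.2 y ^ 2 = 1 then
    (1 / 2) * ∫⁻ y in interv μ, ENNReal.ofReal
      (eta0 (μ * y) ^ 2 * deriv Θ.1 y ^ 2 + eta0 (μ * y) ^ 2 * deriv Θ.2 y ^ 2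
        + eta0 (μ * y) ^ 4 * (Θ.1 y ^ 2 * Θ.2 y ^ 2))
  else ⊤

/-- The energy space with symmetry `𝓔_s`: states in `H¹_loc(𝓘_μ; ℝ²)` of finite energy (so they take
values in the unit circle) with `θ₁(y) = θ₂(-y)`. -/
def symmSpace (μ : ℝ) : Set State :=
  {Θ | H1loc μ Θ.1 ∧ H1loc μ Θ.2 ∧ (∀ y ∈ interv μ, Θ.1 y = Θ.2 (-y)) ∧ energy μ Θ < ⊤}

/-- `Θ` is a global minimizer of `I_{μ,1}` in `𝓔_s`. -/
def IsGlobalMinimizer (μ : ℝ) (Θ : State) : Prop :=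
  Θ ∈ symmSpace μ ∧ ∀ Ξ ∈ symmSpace μ, energy μ Θ ≤ energy μ Ξ

/-- Variation of `Θ` along the unit circle by the angle `φ(y)`:
`(sin u, cos u)` becomes `(sin (u + φ), cos (u + φ))`. -/
def rotate (φ : ℝ → ℝ) (Θ : State) : State :=
  (fun y => Θ.1 y * Real.cos (φ y) + Θ.2 y * Real.sin (φ y),
   fun y => Θ.2 y * Real.cos (φ y) - Θ.1 y * Real.sin (φ y))

/-- Test angles: smooth, compactly supported in `𝓘_μ`, and odd, so that `rotate φ` preserves the
symmetry `θ₁(y) = θ₂(-y)`. -/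
def IsTestAngle (μ : ℝ) (φ : ℝ → ℝ) : Prop :=
  ContDiff ℝ ∞ φ ∧ HasCompactSupport φ ∧ tsupport φ ⊆ interv μ ∧ ∀ y, φ (-y) = -φ y

/-- `Θ` is a critical point of `I_{μ,1}` in `𝓔_s`: the first variation vanishes along every
`t ↦ (sin (u + tφ), cos (u + tφ))`. In terms of `u` this is the weak form of
`-(η₀(μy)² u')' + (1/4) η₀(μy)⁴ sin (4u) = 0` on `𝓘_μ`. -/
def IsCriticalPoint (μ : ℝ) (Θ : State) : Prop :=
  Θ ∈ symmSpace μ ∧ ∀ φ, IsTestAngle μ φ →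
    HasDerivAt (fun t : ℝ => (energy μ (rotate (fun y => t * φ y) Θ)).toReal) 0 0

/-- `Ξ` is `δ`-close to `Θ`: uniformly on `𝓘_μ`, and in the weighted `L²` norm of the derivatives.
On circle-valued states this is at least as strong as closeness in the energy norm
`(∫ η₀(μy)² |Θ'|² + η₀(μy)⁴ |Θ|²)^{1/2}` (up to a constant depending on `μ`). -/
def IsClose (μ δ : ℝ) (Θ Ξ : State) : Prop :=
  (∀ y ∈ interv μ, |Ξ.1 y - Θ.1 y| ≤ δ ∧ |Ξ.2 y - Θ.2 y| ≤ δ) ∧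
  ∫⁻ y in interv μ, ENNReal.ofReal
    (eta0 (μ * y) ^ 2 * ((deriv Ξ.1 y - deriv Θ.1 y) ^ 2 + (deriv Ξ.2 y - deriv Θ.2 y) ^ 2))
      ≤ ENNReal.ofReal (δ ^ 2)

/-- `Θ` is a saddle point of `I_{μ,1}` in `𝓔_s`: a critical point such that every neighbourhood in
`𝓔_s` contains states of strictly smaller and states of strictly larger energy. -/
def IsSaddlePoint (μ : ℝ) (Θ : State) : Prop :=
  IsCriticalPoint μ Θ ∧ ∀ δ > 0,
    (∃ Ξ ∈ symmSpace μ, IsClose μ δ Θ Ξ ∧ energy μ Ξ < energy μ Θ) ∧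
    (∃ Ξ ∈ symmSpace μ, IsClose μ δ Θ Ξ ∧ energy μ Θ < energy μ Ξ)

/-- The symmetric state `θ₁ = θ₂ = 1/√2`. -/
def symmetricState : State := (fun _ => 1 / √2, fun _ => 1 / √2)

/-- Domain wall states: critical points `Θ` in `𝓔_s` with `θ₁ ≢ θ₂`. -/
def IsDomainWallState (μ : ℝ) (Θ : State) : Prop :=
  IsCriticalPoint μ Θ ∧ ∃ y ∈ interv μ, Θ.1 y ≠ Θ.2 y

end DomainWall

end

/-! The circle constraint and the symmetry allow every state of the energy space to be written as κ
(cos w + sin w, cos w - sin w) with κ = ±1/√2 and w odd (`exists_phase`). Writing η² for `wt μ`, the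
energy becomes ∫ η² w'² + (1/4) η⁴ cos² 2w over (0, 1/μ), with w(0) = 0. The symmetric state has
phase 0. Phases of critical points solve (η² v')' = -(1/4) η⁴ sin 4v; finite energy forces the flux
η² v' to vanish at the singular end point 1/μ, since otherwise η² v'² would behave like 1/η²
(`exists_isProfile`).

Minimality rests on a convexity hidden in the variable ρ = w². If 0 < v < π/4, the potential cos²
2√ρ lies above its tangent at ρ = v², strictly for ρ ≠ v² (`convexityGap_pos`). Picone's inequality
bounds ∫ (1/4) η⁴ (sin 4v / v) w² by ∫ η² w'² when v is a positive regular solution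
(`IsProfile.picone`). Adding the two shows that a regular solution with v(0) = 0 and values in (0,
π/4) minimizes, and that any other minimizing phase has the same square, hence is v or -v. A
comparison with the constant solution π/4 confines every regular solution with v(0) = 0 to |v| <
π/4, so a critical point whose components never agree on (0, 1/μ) is automatically a minimizer.

Existence comes from shooting from the singular end point with v(1/μ) = s
(`exists_shooting_family`). The minimum of v over [0, 1/μ] depends continuously on s and equals π/4
at s = π/4. Either it is positive for every s in (0, π/4), or by the intermediate value theorem it
is zero for some such s, and then the zero sits exactly at the origin: a domain wall
(`shooting_dichotomy`).

In the first case Picone's inequality with v ≤ s and s → 0 gives ∫ η⁴ w² ≤ ∫ η² w'²; the symmetric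
state minimizes and there are no walls. In the second case testing the equation with the wall itself
violates this inequality. The two cases therefore exclude each other and are told apart by the sign
of the second variation at the symmetric state (`IsUnstable`). After rescaling to the unit interval,
μ enters only as a factor μ² in front of the Dirichlet term, so instability holds exactly below a
threshold (`exists_threshold`). -/

open Filter Topology

/-! ### The weight and the qualitative theory of regular solutions. -/

namespace DomainWall

/-- The squared cloud profile `1 - (μ y)²`. -/
def wt (μ y : ℝ) : ℝ := 1 - (μ * y) ^ 2

lemma continuous_wt (μ : ℝ) : Continuous (wt μ) := by
  unfold wt; fun_prop

lemma hasDerivAt_wt (μ y : ℝ) : HasDerivAt (wt μ) (-(2 * μ ^ 2 * y)) y := by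
  have h : HasDerivAt (fun y : ℝ => 1 - (μ * y) ^ 2) (-(2 * (μ * y) ^ 1 * (μ * 1))) y := by
    simpa using (((hasDerivAt_id y).const_mul μ).pow 2).const_sub 1
  exact h.congr_deriv (by ring)

lemma mul_lt_one_of_lt {μ y : ℝ} (hμ : 0 < μ) (hy : y < 1 / μ) : μ * y < 1 := by
  rw [lt_div_iff₀ hμ] at hy; linarith

lemma wt_pos {μ y : ℝ} (hμ : 0 < μ) (hy : y ∈ Ioo (-(1 / μ)) (1 / μ)) : 0 < wt μ y := by
  have h1 := mul_lt_one_of_lt hμ hy.2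
  have h2 := mul_lt_one_of_lt (y := -y) hμ (by linarith [hy.1])
  unfold wt; nlinarith

lemma wt_le_one (μ y : ℝ) : wt μ y ≤ 1 := by
  unfold wt; nlinarith [sq_nonneg (μ * y)]

lemma wt_neg (μ y : ℝ) : wt μ (-y) = wt μ y := by
  unfold wt; ring

lemma wt_radius {μ : ℝ} (hμ : 0 < μ) : wt μ (1 / μ) = 0 := by
  unfold wt; field_simp; norm_num

lemma wt_antitone {μ a b : ℝ} (ha : 0 ≤ a) (hab : a ≤ b) : wt μ b ≤ wt μ a := by
  unfold wt
  have : a ^ 2 ≤ b ^ 2 := by gcongr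
  nlinarith [mul_le_mul_of_nonneg_left this (sq_nonneg μ)]

lemma Ico_subset_interv {μ : ℝ} (hμ : 0 < μ) : Ico 0 (1 / μ) ⊆ Ioo (-(1 / μ)) (1 / μ) := by
  intro y hy
  have : 0 < 1 / μ := by positivity
  exact ⟨by linarith [hy.1], hy.2⟩

/-- A solution `v` on `[0, 1/μ)`, with derivative `m`, of `(η₀² v')' = -(1/4) η₀⁴ sin (4 v)` which
is regular at the singular end point. -/
structure IsProfile (μ : ℝ) (v m : ℝ → ℝ) : Prop where
  hasDerivAt : ∀ y ∈ Ioo 0 (1 / μ), HasDerivAt v (m y) y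
  hasDerivAt_flux : ∀ y ∈ Ioo 0 (1 / μ),
    HasDerivAt (fun t => wt μ t * m t) (-(1 / 4 * wt μ y ^ 2 * Real.sin (4 * v y))) y
  continuousOn : ContinuousOn v (Ico 0 (1 / μ))
  continuousOn_slope : ContinuousOn m (Ico 0 (1 / μ))
  abs_slope_le : ∀ y ∈ Ico 0 (1 / μ), |m y| ≤ 1 / 4 * wt μ y * (1 / μ - y)

/-- Gronwall's argument in both directions: since |(f²)'| ≤ 2 f², the product f² e^{2y} is
nondecreasing and f² e^{-2y} is nonincreasing, so a zero propagates to the left by the first and to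
the right by the second. -/
lemma eq_zero_of_abs_deriv_le {R : ℝ} {f f' : ℝ → ℝ} (hc : ContinuousOn f (Ico 0 R))
    (hd : ∀ y ∈ Ioo 0 R, HasDerivAt f (f' y) y) (hle : ∀ y ∈ Ioo 0 R, |f' y| ≤ |f y|)
    {y₀ : ℝ} (hy₀ : y₀ ∈ Ico 0 R) (h0 : f y₀ = 0) : ∀ y ∈ Ico 0 R, f y = 0 := by
  have hprod : ∀ y ∈ Ioo 0 R, |f y * f' y| ≤ f y ^ 2 := by
    intro y hy
    rw [abs_mul, ← sq_abs, sq]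
    exact mul_le_mul_of_nonneg_left (hle y hy) (abs_nonneg _)
  have hmono : MonotoneOn (fun y => f y ^ 2 * Real.exp (2 * y)) (Ico 0 R) := by
    have hD : ∀ y ∈ Ioo 0 R, HasDerivAt (fun y => f y ^ 2 * Real.exp (2 * y))
        ((2 * (f y * f' y) + 2 * f y ^ 2) * Real.exp (2 * y)) y := by
      intro y hy
      have h1 := (hd y hy).pow 2
      have h2 := (((hasDerivAt_id y).const_mul 2)).exp
      exact (h1.mul h2).congr_deriv (by simp; ring)
    apply monotoneOn_of_deriv_nonneg (convex_Ico _ _)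
    · exact (hc.pow 2).mul (by fun_prop)
    · rw [interior_Ico]; exact fun y hy => (hD y hy).differentiableAt.differentiableWithinAt
    · rw [interior_Ico]; intro y hy
      rw [(hD y hy).deriv]
      have := abs_le.1 (hprod y hy)
      exact mul_nonneg (by linarith) (Real.exp_pos _).le
  have hanti : AntitoneOn (fun y => f y ^ 2 * Real.exp (-2 * y)) (Ico 0 R) := by
    have hD : ∀ y ∈ Ioo 0 R, HasDerivAt (fun y => f y ^ 2 * Real.exp (-2 * y))
        ((2 * (f y * f' y) - 2 * f y ^ 2) * Real.exp (-2 * y)) y := by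
      intro y hy
      have h1 := (hd y hy).pow 2
      have h2 := (((hasDerivAt_id y).const_mul (-2))).exp
      exact (h1.mul h2).congr_deriv (by simp; ring)
    apply antitoneOn_of_deriv_nonpos (convex_Ico _ _)
    · exact (hc.pow 2).mul (by fun_prop)
    · rw [interior_Ico]; exact fun y hy => (hD y hy).differentiableAt.differentiableWithinAt
    · rw [interior_Ico]; intro y hy
      rw [(hD y hy).deriv]
      have := abs_le.1 (hprod y hy)
      exact mul_nonpos_of_nonpos_of_nonneg (by linarith) (Real.exp_pos _).le
  intro y hy
  have key : ∀ c : ℝ, f y ^ 2 * Real.exp c ≤ 0 → f y = 0 := by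
    intro c h
    have h1 : f y ^ 2 ≤ 0 := by
      by_contra hcon
      exact absurd h (not_le.2 (mul_pos (not_le.1 hcon) (Real.exp_pos _)))
    exact pow_eq_zero_iff (two_ne_zero) |>.1 (le_antisymm h1 (sq_nonneg _))
  rcases le_total y y₀ with h | h
  · have := hmono hy hy₀ h
    simp only [h0] at this
    exact key _ (this.trans (by simp))
  · have := hanti hy₀ hy h
    simp only [h0] at this
    exact key _ (this.trans (by simp))

namespace IsProfile

variable {μ : ℝ} {v m : ℝ → ℝ}

lemma neg (h : IsProfile μ v m) : IsProfile μ (fun y => -v y) (fun y => -m y) where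
  hasDerivAt y hy := (h.hasDerivAt y hy).neg
  hasDerivAt_flux y hy := by
    have := (h.hasDerivAt_flux y hy).neg
    refine (this.congr_deriv ?_).congr_of_eventuallyEq (Eventually.of_forall fun t => ?_)
    · rw [mul_neg, Real.sin_neg]; ring
    · simp
  continuousOn := h.continuousOn.neg
  continuousOn_slope := h.continuousOn_slope.neg
  abs_slope_le y hy := by rw [abs_neg]; exact h.abs_slope_le y hy

/-- This is the natural boundary condition at the singular end point; it supplies the limits in all
monotonicity arguments run backwards from 1/μ. -/
lemma tendsto_flux (hμ : 0 < μ) (h : IsProfile μ v m) :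
    Tendsto (fun t => wt μ t * m t) (𝓝[<] (1 / μ)) (𝓝 0) := by
  have hR : 0 < 1 / μ := by positivity
  have hev : ∀ᶠ t in 𝓝[<] (1 / μ), t ∈ Ico 0 (1 / μ) := Ico_mem_nhdsLT hR
  have hlim : Tendsto (fun t => 1 / 4 * (1 / μ - t)) (𝓝[<] (1 / μ)) (𝓝 0) := by
    have : Tendsto (fun t : ℝ => 1 / 4 * (1 / μ - t)) (𝓝 (1 / μ)) (𝓝 (1 / 4 * (1 / μ - 1 / μ))) :=
      Continuous.tendsto (by fun_prop) _
    simp only [sub_self, mul_zero] at this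
    exact this.mono_left nhdsWithin_le_nhds
  apply squeeze_zero_norm' _ hlim
  filter_upwards [hev] with t ht
  have hp := wt_pos hμ (Ico_subset_interv hμ ht)
  rw [Real.norm_eq_abs, abs_mul, abs_of_pos hp]
  have h1 := h.abs_slope_le t ht
  have h2 := wt_le_one μ t
  have h3 : 0 ≤ 1 / μ - t := by linarith [ht.2]
  calc wt μ t * |m t| ≤ wt μ t * (1 / 4 * wt μ t * (1 / μ - t)) := by gcongr
    _ ≤ 1 * (1 / 4 * 1 * (1 / μ - t)) := by gcongr
    _ = _ := by ring

lemma tendsto_wt {μ : ℝ} (hμ : 0 < μ) : Tendsto (wt μ) (𝓝[<] (1 / μ)) (𝓝 0) := by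
  have := (continuous_wt μ).tendsto (1 / μ)
  rw [wt_radius hμ] at this
  exact this.mono_left nhdsWithin_le_nhds

lemma continuousOn_flux (h : IsProfile μ v m) :
    ContinuousOn (fun t => wt μ t * m t) (Ico 0 (1 / μ)) :=
  (continuous_wt μ).continuousOn.mul h.continuousOn_slope

/-- Comparison with the constant solution `π/4`. -/
lemma abs_slope_le_abs_sub (hμ : 0 < μ) (h : IsProfile μ v m) {y : ℝ} (hy : y ∈ Ico 0 (1 / μ)) :
    |m y| ≤ |v y - Real.pi / 4| := by
  -- A first integral of the equation, frozen-coefficient energy times the weight, normalized so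
  -- that it vanishes along the constant solution π/4. All terms with sin 4v cancel in its
  -- derivative; only the derivative of the weight cubed survives, and it has a sign.
  set K : ℝ → ℝ := fun t => 8 * (wt μ t * m t) ^ 2 - wt μ t ^ 3 * (1 + Real.cos (4 * v t)) with hK
  have hD : ∀ t ∈ Ioo 0 (1 / μ), HasDerivAt K
      (6 * μ ^ 2 * t * wt μ t ^ 2 * (1 + Real.cos (4 * v t))) t := by
    intro t ht
    have h1 := ((h.hasDerivAt_flux t ht).pow 2).const_mul 8
    have h2 := (hasDerivAt_wt μ t).pow 3
    have h3 := (((h.hasDerivAt t ht).const_mul 4).cos).const_add 1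
    exact (h1.sub (h2.mul h3)).congr_deriv (by simp; ring)
  have hmono : MonotoneOn K (Ico 0 (1 / μ)) := by
    apply monotoneOn_of_deriv_nonneg (convex_Ico _ _)
    · refine ((h.continuousOn_flux.pow 2).const_smul (8 : ℝ)).sub
        (((continuous_wt μ).continuousOn.pow 3).mul (continuousOn_const.add ?_))
      exact Real.continuous_cos.comp_continuousOn (continuousOn_const.mul h.continuousOn)
    · rw [interior_Ico]; exact fun y hy => (hD y hy).differentiableAt.differentiableWithinAt
    · rw [interior_Ico]; intro t ht
      rw [(hD t ht).deriv]
      have := Real.neg_one_le_cos (4 * v t)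
      have := ht.1
      have : 0 ≤ 1 + Real.cos (4 * v t) := by linarith
      positivity
  have hlim : Tendsto K (𝓝[<] (1 / μ)) (𝓝 0) := by
    have h1 : Tendsto (fun t => 8 * (wt μ t * m t) ^ 2) (𝓝[<] (1 / μ)) (𝓝 0) := by
      simpa using ((h.tendsto_flux hμ).pow 2).const_mul 8
    have h2 : Tendsto (fun t => wt μ t ^ 3 * (1 + Real.cos (4 * v t))) (𝓝[<] (1 / μ)) (𝓝 0) := by
      have h3 : Tendsto (fun t => wt μ t ^ 3) (𝓝[<] (1 / μ)) (𝓝 0) := by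
        simpa using (tendsto_wt hμ).pow 3
      refine h3.zero_mul_isBoundedUnder_le ?_
      refine isBoundedUnder_of ⟨2, fun t => ?_⟩
      simp only [Function.comp, Real.norm_eq_abs]
      rw [abs_le]
      constructor <;> linarith [Real.neg_one_le_cos (4 * v t), Real.cos_le_one (4 * v t)]
    simpa using h1.sub h2
  -- K is nondecreasing and tends to 0 at 1/μ, hence is nonpositive throughout.
  have hK0 : K y ≤ 0 := by
    refine ge_of_tendsto hlim ?_
    filter_upwards [Ioo_mem_nhdsLT hy.2] with t ht
    exact hmono hy ⟨hy.1.trans ht.1.le, ht.2⟩ ht.1.le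
  have hp := wt_pos hμ (Ico_subset_interv hμ hy)
  have hp1 := wt_le_one μ y
  have hcos : 1 + Real.cos (4 * v y) = 2 * Real.cos (2 * v y) ^ 2 := by
    rw [Real.cos_sq]; ring_nf
  -- K ≤ 0 reads 4 m² ≤ wt · cos² 2v, and the weight is at most 1. Since cos 2v vanishes to first
  -- order at π/4, this is the differential inequality needed for Gronwall's argument.
  have h2 : (2 * m y) ^ 2 ≤ Real.cos (2 * v y) ^ 2 := by
    simp only [hK, hcos] at hK0
    have h4 : wt μ y ^ 2 * (4 * m y ^ 2) ≤ wt μ y ^ 2 * (wt μ y * Real.cos (2 * v y) ^ 2) := by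
      nlinarith
    have h5 := le_of_mul_le_mul_left h4 (by positivity)
    nlinarith [sq_nonneg (Real.cos (2 * v y))]
  have h3 : |2 * m y| ≤ |Real.cos (2 * v y)| := sq_le_sq.1 h2
  have h4 : Real.cos (2 * v y) = -Real.sin (2 * (v y - Real.pi / 4)) := by
    rw [show 2 * (v y - Real.pi / 4) = 2 * v y - Real.pi / 2 by ring, Real.sin_sub_pi_div_two]
    ring
  rw [h4, abs_neg, abs_mul, abs_two] at h3
  have h5 := Real.abs_sin_le_abs (x := 2 * (v y - Real.pi / 4))
  rw [abs_mul, abs_two] at h5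
  linarith

/-- Replaces uniqueness for the initial value problem: only values, not slopes, need to agree,
because regularity at 1/μ already bounds the slope by the distance to π/4. -/
lemma eq_pi_div_four_of_eq (hμ : 0 < μ) (h : IsProfile μ v m) {y₀ : ℝ} (hy₀ : y₀ ∈ Ico 0 (1 / μ))
    (h0 : v y₀ = Real.pi / 4) : ∀ y ∈ Ico 0 (1 / μ), v y = Real.pi / 4 := by
  intro y hy
  have := eq_zero_of_abs_deriv_le (f := fun y => v y - Real.pi / 4) (f' := m)
    (h.continuousOn.sub continuousOn_const) (fun y hy => (h.hasDerivAt y hy).sub_const _)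
    (fun y hy => h.abs_slope_le_abs_sub hμ ⟨hy.1.le, hy.2⟩) hy₀ (by simp [h0]) y hy
  linarith

lemma lt_pi_div_four_of_lt (hμ : 0 < μ) (h : IsProfile μ v m) {y₀ : ℝ} (hy₀ : y₀ ∈ Ico 0 (1 / μ))
    (h0 : v y₀ < Real.pi / 4) : ∀ y ∈ Ico 0 (1 / μ), v y < Real.pi / 4 := by
  intro y hy
  by_contra hcon
  have hsub : uIcc y₀ y ⊆ Ico 0 (1 / μ) := (ordConnected_Ico).uIcc_subset hy₀ hy
  obtain ⟨t, ht, hvt⟩ := intermediate_value_uIcc (h.continuousOn.mono hsub)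
    (show Real.pi / 4 ∈ uIcc (v y₀) (v y) from mem_uIcc.2 (Or.inl ⟨h0.le, not_lt.1 hcon⟩))
  exact h0.ne (h.eq_pi_div_four_of_eq hμ (hsub ht) hvt y₀ hy₀)

lemma abs_lt_pi_div_four_of_abs_lt (hμ : 0 < μ) (h : IsProfile μ v m) {y₀ : ℝ}
    (hy₀ : y₀ ∈ Ico 0 (1 / μ)) (h0 : |v y₀| < Real.pi / 4) :
    ∀ y ∈ Ico 0 (1 / μ), |v y| < Real.pi / 4 := by
  intro y hy
  rw [abs_lt] at h0 ⊢
  have h1 := h.lt_pi_div_four_of_lt hμ hy₀ h0.2 y hy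
  have h2 := h.neg.lt_pi_div_four_of_lt hμ hy₀ (by linarith [h0.1]) y hy
  exact ⟨by linarith, h1⟩

lemma abs_lt_pi_div_four (hμ : 0 < μ) (h : IsProfile μ v m) (h0 : v 0 = 0) :
    ∀ y ∈ Ico 0 (1 / μ), |v y| < Real.pi / 4 :=
  h.abs_lt_pi_div_four_of_abs_lt hμ (y₀ := 0) ⟨le_rfl, by positivity⟩
    (by rw [h0, abs_zero]; positivity)

/-- While 0 < v < π/4 the source sin 4v is positive, so the flux strictly decreases; as it tends to
0 at 1/μ, it is positive before. -/
lemma slope_pos (hμ : 0 < μ) (h : IsProfile μ v m)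
    (hv : ∀ y ∈ Ioo 0 (1 / μ), v y ∈ Ioo 0 (Real.pi / 4)) : ∀ y ∈ Ico 0 (1 / μ), 0 < m y := by
  have hanti : StrictAntiOn (fun t => wt μ t * m t) (Ico 0 (1 / μ)) := by
    apply strictAntiOn_of_deriv_neg (convex_Ico _ _) h.continuousOn_flux
    rw [interior_Ico]; intro t ht
    rw [(h.hasDerivAt_flux t ht).deriv]
    have hp := wt_pos hμ (Ico_subset_interv hμ ⟨ht.1.le, ht.2⟩)
    have := Real.sin_pos_of_pos_of_lt_pi (x := 4 * v t) (by linarith [(hv t ht).1])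
      (by linarith [(hv t ht).2])
    simp only [Left.neg_neg_iff]
    positivity
  intro y hy
  have hp := wt_pos hμ (Ico_subset_interv hμ hy)
  obtain ⟨z, hz⟩ := exists_between hy.2
  have hz' : z ∈ Ico 0 (1 / μ) := ⟨hy.1.trans hz.1.le, hz.2⟩
  have h1 : wt μ z * m z < wt μ y * m y := hanti hy hz' hz.1
  have h2 : 0 ≤ wt μ z * m z := by
    refine le_of_tendsto (h.tendsto_flux hμ) ?_
    filter_upwards [Ioo_mem_nhdsLT hz.2] with t ht
    exact (hanti hz' ⟨hz'.1.trans ht.1.le, ht.2⟩ ht.1).le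
  exact pos_of_mul_pos_right (h2.trans_lt h1) hp.le

/-- A Lyapunov function: G is a sum of nonnegative terms, is nonincreasing because the weight
decreases on the half interval, and vanishes at y₀. The bound |v| < π/4 turns cos 4v = 1 into v = 0.
Only propagation towards 1/μ is needed. -/
lemma eq_zero_of_le (hμ : 0 < μ) (h : IsProfile μ v m)
    (hv : ∀ y ∈ Ico 0 (1 / μ), |v y| < Real.pi / 4) {y₀ : ℝ} (hy₀ : y₀ ∈ Ico 0 (1 / μ))
    (hv0 : v y₀ = 0) (hm0 : m y₀ = 0) : ∀ y ∈ Ico y₀ (1 / μ), v y = 0 := by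
  set G : ℝ → ℝ := fun t => 8 * (wt μ t * m t) ^ 2 + wt μ t ^ 3 * (1 - Real.cos (4 * v t)) with hG
  have hD : ∀ t ∈ Ioo 0 (1 / μ), HasDerivAt G
      (-(6 * μ ^ 2 * t * wt μ t ^ 2 * (1 - Real.cos (4 * v t)))) t := by
    intro t ht
    have h1 := ((h.hasDerivAt_flux t ht).pow 2).const_mul 8
    have h2 := (hasDerivAt_wt μ t).pow 3
    have h3 := (((h.hasDerivAt t ht).const_mul 4).cos).const_sub 1
    exact (h1.add (h2.mul h3)).congr_deriv (by simp; ring)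
  have hanti : AntitoneOn G (Ico 0 (1 / μ)) := by
    apply antitoneOn_of_deriv_nonpos (convex_Ico _ _)
    · refine ((h.continuousOn_flux.pow 2).const_smul (8 : ℝ)).add
        (((continuous_wt μ).continuousOn.pow 3).mul (continuousOn_const.sub ?_))
      exact Real.continuous_cos.comp_continuousOn (continuousOn_const.mul h.continuousOn)
    · rw [interior_Ico]; exact fun y hy => (hD y hy).differentiableAt.differentiableWithinAt
    · rw [interior_Ico]; intro t ht
      rw [(hD t ht).deriv]
      have := ht.1
      have : 0 ≤ 1 - Real.cos (4 * v t) := by linarith [Real.cos_le_one (4 * v t)]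
      simp only [Left.neg_nonpos_iff]
      positivity
  intro y hy
  have hy' : y ∈ Ico 0 (1 / μ) := ⟨hy₀.1.trans hy.1, hy.2⟩
  have h1 : G y ≤ G y₀ := hanti hy₀ hy' hy.1
  have h2 : G y₀ = 0 := by simp [hG, hv0, hm0]
  have hp := wt_pos hμ (Ico_subset_interv hμ hy')
  have h3 : 0 ≤ 1 - Real.cos (4 * v y) := by linarith [Real.cos_le_one (4 * v y)]
  have h4 : wt μ y ^ 3 * (1 - Real.cos (4 * v y)) ≤ 0 := by
    have : G y = 8 * (wt μ y * m y) ^ 2 + wt μ y ^ 3 * (1 - Real.cos (4 * v y)) := rfl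
    nlinarith [sq_nonneg (wt μ y * m y)]
  have h5 : Real.cos (4 * v y) = 1 := by
    have : 1 - Real.cos (4 * v y) ≤ 0 := by
      by_contra hcon
      exact absurd h4 (not_le.2 (mul_pos (by positivity) (not_le.1 hcon)))
    linarith
  have h6 := abs_lt.1 (hv y hy')
  have h7 := (Real.cos_eq_one_iff_of_lt_of_lt (x := 4 * v y)
    (by linarith [Real.pi_pos]) (by linarith [Real.pi_pos])).1 h5
  linarith

/-- The energy identity obtained by testing the equation with the solution itself. -/
lemma integral_wt_mul_slope_sq (h : IsProfile μ v m) (h0 : v 0 = 0) {b : ℝ}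
    (hb : b ∈ Ioo 0 (1 / μ)) :
    ∫ t in (0 : ℝ)..b, wt μ t * m t ^ 2
      = wt μ b * m b * v b + ∫ t in (0 : ℝ)..b, 1 / 4 * wt μ t ^ 2 * Real.sin (4 * v t) * v t := by
  have hsub : Icc 0 b ⊆ Ico 0 (1 / μ) := Icc_subset_Ico_right hb.2
  have hcv := h.continuousOn.mono hsub
  have hcm := h.continuousOn_slope.mono hsub
  have hcw : ContinuousOn (wt μ) (Icc 0 b) := (continuous_wt μ).continuousOn
  have hcs : ContinuousOn (fun t => 1 / 4 * wt μ t ^ 2 * Real.sin (4 * v t) * v t) (Icc 0 b) :=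
    ((continuousOn_const.mul (hcw.pow 2)).mul
      (Real.continuous_sin.comp_continuousOn (continuousOn_const.mul hcv))).mul hcv
  have hi1 : IntervalIntegrable (fun t => wt μ t * m t ^ 2) volume 0 b :=
    ContinuousOn.intervalIntegrable_of_Icc hb.1.le (hcw.mul (hcm.pow 2))
  have hi2 : IntervalIntegrable (fun t => 1 / 4 * wt μ t ^ 2 * Real.sin (4 * v t) * v t) volume 0 b :=
    ContinuousOn.intervalIntegrable_of_Icc hb.1.le hcs
  have key := intervalIntegral.integral_eq_sub_of_hasDerivAt_of_le hb.1.le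
    (f := fun t => wt μ t * m t * v t)
    (f' := fun t => wt μ t * m t ^ 2 - 1 / 4 * wt μ t ^ 2 * Real.sin (4 * v t) * v t)
    ((hcw.mul hcm).mul hcv)
    (fun t ht => ((h.hasDerivAt_flux t ⟨ht.1, ht.2.trans hb.2⟩).mul
      (h.hasDerivAt t ⟨ht.1, ht.2.trans hb.2⟩)).congr_deriv (by ring)) (hi1.sub hi2)
  rw [intervalIntegral.integral_sub hi1 hi2, h0] at key
  linarith

end IsProfile

end DomainWall

/-! ### The tangent-line inequality for the potential, and Picone's inequality. -/

namespace DomainWall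

/-- Strict concavity of the sine on [0, π]: its chords from the origin have decreasing slope. -/
lemma mul_sin_lt_mul_sin {x y : ℝ} (hx : 0 < x) (hxy : x < y) (hy : y ≤ Real.pi) :
    x * Real.sin y < y * Real.sin x := by
  have hy0 : 0 < y := hx.trans hxy
  have hlt : 0 < 1 - x / y := by rw [sub_pos, div_lt_one hy0]; exact hxy
  have h := strictConcaveOn_sin_Icc.2 (left_mem_Icc.2 Real.pi_pos.le) (⟨hy0.le, hy⟩ : y ∈ Icc 0 Real.pi) hy0.ne
    hlt (div_pos hx hy0) (by ring)
  simp only [smul_eq_mul, mul_zero, Real.sin_zero, zero_add] at h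
  rw [div_mul_cancel₀ _ hy0.ne', div_mul_eq_mul_div, div_lt_iff₀ hy0] at h
  linarith

/-- The function `cos z + κ z²/2` with `κ = sin x / x` has its strict minimum over `z ≥ 0` at `x`. -/
lemma cos_add_sq_lt {x z : ℝ} (hx : 0 < x) (hxπ : x < Real.pi) (hz : 0 ≤ z) (hne : z ≠ x) :
    Real.cos x + Real.sin x / x * x ^ 2 / 2 < Real.cos z + Real.sin x / x * z ^ 2 / 2 := by
  set κ := Real.sin x / x with hκ
  have hκ0 : 0 < κ := div_pos (Real.sin_pos_of_pos_of_lt_pi hx hxπ) hx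
  have hD : ∀ t, HasDerivAt (fun t => Real.cos t + κ * t ^ 2 / 2) (κ * t - Real.sin t) t := by
    intro t
    have h1 := (((hasDerivAt_id t).pow 2).const_mul κ).div_const 2
    exact ((Real.hasDerivAt_cos t).add h1).congr_deriv (by simp; ring)
  have hcont : Continuous (fun t => Real.cos t + κ * t ^ 2 / 2) := by fun_prop
  have hanti : StrictAntiOn (fun t => Real.cos t + κ * t ^ 2 / 2) (Icc 0 x) := by
    apply strictAntiOn_of_deriv_neg (convex_Icc _ _) hcont.continuousOn
    rw [interior_Icc]; intro t ht
    rw [(hD t).deriv]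
    have := mul_sin_lt_mul_sin ht.1 ht.2 hxπ.le
    rw [sub_neg, hκ, div_mul_eq_mul_div, div_lt_iff₀ hx]
    linarith
  have hmono : StrictMonoOn (fun t => Real.cos t + κ * t ^ 2 / 2) (Icc x Real.pi) := by
    apply strictMonoOn_of_deriv_pos (convex_Icc _ _) hcont.continuousOn
    rw [interior_Icc]; intro t ht
    rw [(hD t).deriv]
    have := mul_sin_lt_mul_sin hx ht.1 ht.2.le
    rw [sub_pos, hκ, div_mul_eq_mul_div, lt_div_iff₀ hx]
    linarith
  rcases lt_or_gt_of_ne hne with h | h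
  · exact hanti ⟨hz, h.le⟩ ⟨hx.le, le_rfl⟩ h
  · rcases le_or_gt z Real.pi with h' | h'
    · exact hmono ⟨le_rfl, hxπ.le⟩ ⟨h.le, h'⟩ h
    -- Beyond π the derivative has no evident sign, but none is needed: cos z ≥ -1 = cos π and the
    -- quadratic term keeps growing, so the value at z exceeds the value at π.
    · have h1 := hmono ⟨le_rfl, hxπ.le⟩ ⟨hxπ.le, le_rfl⟩ hxπ
      simp only [Real.cos_pi] at h1
      have h2 := Real.neg_one_le_cos z
      have h3 : Real.pi ^ 2 < z ^ 2 := by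
        have := Real.pi_pos
        gcongr
      nlinarith

/-- The convexity gap of the potential `cos² 2√ρ`, as a function of `ρ = w²`, at `v²`. -/
noncomputable def convexityGap (v w : ℝ) : ℝ :=
  Real.sin (4 * v) / v * (w ^ 2 - v ^ 2) + Real.cos (2 * w) ^ 2 - Real.cos (2 * v) ^ 2

/-- With z = 4|w| and cos² 2w = (1 + cos 4w)/2, the gap is half the excess of cos z + κ z²/2 over
its minimum, attained at z = 4v. The range v < π/4 is what puts 4v below π. -/
lemma convexityGap_eq {v : ℝ} (hv : 0 < v) (w : ℝ) : convexityGap v w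
    = ((Real.cos (4 * |w|) + Real.sin (4 * v) / (4 * v) * (4 * |w|) ^ 2 / 2)
      - (Real.cos (4 * v) + Real.sin (4 * v) / (4 * v) * (4 * v) ^ 2 / 2)) / 2 := by
  have h1 : Real.cos (4 * |w|) = 2 * Real.cos (2 * w) ^ 2 - 1 := by
    rw [Real.cos_sq, ← Real.cos_abs (2 * (2 * w)), abs_mul, abs_mul, abs_two]; ring_nf
  have h2 : Real.cos (4 * v) = 2 * Real.cos (2 * v) ^ 2 - 1 := by
    rw [Real.cos_sq]; ring_nf
  rw [h1, h2, mul_pow, sq_abs, convexityGap]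
  field_simp
  ring

lemma convexityGap_pos {v w : ℝ} (hv : v ∈ Ioo 0 (Real.pi / 4)) (hne : w ^ 2 ≠ v ^ 2) :
    0 < convexityGap v w := by
  rw [convexityGap_eq hv.1]
  have hne' : 4 * |w| ≠ 4 * v := by
    intro h
    apply hne
    rw [← sq_abs, show |w| = v by linarith]
  have := cos_add_sq_lt (x := 4 * v) (z := 4 * |w|) (by linarith [hv.1]) (by linarith [hv.2])
    (by positivity) hne'
  linarith

lemma convexityGap_nonneg {v w : ℝ} (hv : v ∈ Ioo 0 (Real.pi / 4)) : 0 ≤ convexityGap v w := by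
  by_cases h : w ^ 2 = v ^ 2
  · have h2 : Real.cos (2 * w) ^ 2 = Real.cos (2 * v) ^ 2 := by
      rcases sq_eq_sq_iff_eq_or_eq_neg.1 h with rfl | rfl
      · rfl
      · rw [mul_neg, Real.cos_neg]
    rw [convexityGap, h, h2]; simp
  · exact (convexityGap_pos hv h).le

lemma sin_four_mul_mul_self_lt {v : ℝ} (hv : v ≠ 0) : Real.sin (4 * v) * v < 4 * v ^ 2 := by
  rcases lt_or_gt_of_ne hv with h | h
  · have := Real.lt_sin (x := 4 * v) (by linarith)
    nlinarith
  · have := Real.sin_lt (x := 4 * v) (by linarith)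
    nlinarith

lemma sin_four_mul_mul_self_le (v : ℝ) : Real.sin (4 * v) * v ≤ 4 * v ^ 2 := by
  by_cases h : v = 0
  · simp [h]
  · exact (sin_four_mul_mul_self_lt h).le

lemma abs_sin_four_mul_div_le (v : ℝ) : |Real.sin (4 * v) / v| ≤ 4 := by
  by_cases h : v = 0
  · simp [h]
  · rw [abs_div, div_le_iff₀ (abs_pos.2 h)]
    have := Real.abs_sin_le_abs (x := 4 * v)
    rwa [abs_mul, show |(4 : ℝ)| = 4 by norm_num] at this

/-- Cauchy–Schwarz for the increment of an absolutely continuous function. -/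
lemma sq_le_mul_integral_deriv_sq {w : ℝ → ℝ} {a : ℝ} (ha : 0 < a)
    (hw : AbsolutelyContinuousOnInterval w 0 a)
    (hw2 : IntervalIntegrable (fun t => deriv w t ^ 2) volume 0 a) (h0 : w 0 = 0) :
    w a ^ 2 ≤ a * ∫ t in (0 : ℝ)..a, deriv w t ^ 2 := by
  have h1 := hw.integral_deriv_eq_sub
  rw [h0, sub_zero] at h1
  have hi := hw.intervalIntegrable_deriv
  have h2 : 0 ≤ ∫ t in (0 : ℝ)..a, (deriv w t - w a / a) ^ 2 :=
    intervalIntegral.integral_nonneg ha.le fun _ _ => sq_nonneg _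
  have h3 : ∫ t in (0 : ℝ)..a, (deriv w t - w a / a) ^ 2
      = (∫ t in (0 : ℝ)..a, deriv w t ^ 2) - 2 * (w a / a) * w a + (w a / a) ^ 2 * a := by
    have : ∀ t, (deriv w t - w a / a) ^ 2
        = deriv w t ^ 2 - 2 * (w a / a) * deriv w t + (w a / a) ^ 2 := fun t => by ring
    simp_rw [this]
    rw [intervalIntegral.integral_add (hw2.sub (hi.const_mul _)) (by simp),
      intervalIntegral.integral_sub hw2 (hi.const_mul _), intervalIntegral.integral_const_mul, h1]
    simp; ring
  have h4 : 0 ≤ (∫ t in (0 : ℝ)..a, deriv w t ^ 2) - w a ^ 2 / a := by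
    rw [h3] at h2
    convert h2 using 1
    field_simp; ring
  rw [sub_nonneg, div_le_iff₀ ha] at h4
  linarith

lemma intervalIntegrable_deriv_sq {w : ℝ → ℝ} {a b : ℝ} (hab : a ≤ b)
    (hw2 : MemLp (deriv w) 2 (volume.restrict (Icc a b))) :
    IntervalIntegrable (fun t => deriv w t ^ 2) volume a b := by
  rw [intervalIntegrable_iff_integrableOn_Icc_of_le hab]
  exact hw2.integrable_sq

namespace IsProfile

variable {μ : ℝ} {v m : ℝ → ℝ}

/-- Prepares the integration by parts in Picone's inequality: the logarithmic flux η² v'/v is C¹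
wherever v > 0, which excludes a neighbourhood of the origin when v(0) = 0. -/
lemma absolutelyContinuous_quotient (h : IsProfile μ v m)
    (hv : ∀ y ∈ Ioo 0 (1 / μ), v y ∈ Ioo 0 (Real.pi / 4)) {a b : ℝ} (ha : 0 < a) (hab : a ≤ b)
    (hb : b < 1 / μ) : AbsolutelyContinuousOnInterval (fun t => wt μ t * m t / v t) a b := by
  have hD : ∀ t ∈ Ioo 0 (1 / μ), HasDerivAt (fun t => wt μ t * m t / v t)
      ((-(1 / 4 * wt μ t ^ 2 * Real.sin (4 * v t)) * v t - wt μ t * m t * m t) / v t ^ 2) t :=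
    fun t ht => (h.hasDerivAt_flux t ht).div (h.hasDerivAt t ht) (hv t ht).1.ne'
  have hsub : Icc a b ⊆ Ioo 0 (1 / μ) := fun t ht => ⟨ha.trans_le ht.1, ht.2.trans_lt hb⟩
  have hcd : ContDiffOn ℝ 1 (fun t => wt μ t * m t / v t) (Ioo 0 (1 / μ)) := by
    rw [show (1 : WithTop ℕ∞) = 0 + 1 by simp, contDiffOn_succ_iff_deriv_of_isOpen isOpen_Ioo]
    refine ⟨fun t ht => (hD t ht).differentiableAt.differentiableWithinAt, by simp, ?_⟩
    rw [contDiffOn_zero]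
    have hv' := h.continuousOn.mono (Ioo_subset_Ico_self)
    have hm' := h.continuousOn_slope.mono (Ioo_subset_Ico_self)
    have hw' : ContinuousOn (wt μ) (Ioo 0 (1 / μ)) := (continuous_wt μ).continuousOn
    have : ContinuousOn (fun t => (-(1 / 4 * wt μ t ^ 2 * Real.sin (4 * v t)) * v t
        - wt μ t * m t * m t) / v t ^ 2) (Ioo 0 (1 / μ)) := by
      refine ContinuousOn.div (((((continuousOn_const.mul (hw'.pow 2)).mul
        (Real.continuous_sin.comp_continuousOn (continuousOn_const.mul hv'))).neg).mul hv').sub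
        ((hw'.mul hm').mul hm')) (hv'.pow 2) (fun t ht => pow_ne_zero 2 (hv t ht).1.ne')
    exact this.congr fun t ht => (hD t ht).deriv
  refine (hcd.mono ?_).absolutelyContinuousOnInterval
  rwa [uIcc_of_le hab]

/-- Picone's inequality away from the origin. -/
lemma picone_of_pos (hμ : 0 < μ) (h : IsProfile μ v m)
    (hv : ∀ y ∈ Ioo 0 (1 / μ), v y ∈ Ioo 0 (Real.pi / 4)) {a b : ℝ} (ha : 0 < a) (hab : a ≤ b)
    (hb : b < 1 / μ) {w : ℝ → ℝ} (hw : AbsolutelyContinuousOnInterval w a b)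
    (hw2 : IntervalIntegrable (fun t => deriv w t ^ 2) volume a b) :
    ∫ t in a..b, 1 / 4 * wt μ t ^ 2 * (Real.sin (4 * v t) / v t) * w t ^ 2
      ≤ (∫ t in a..b, wt μ t * deriv w t ^ 2) + wt μ a * m a / v a * w a ^ 2 := by
  have hsub : Icc a b ⊆ Ioo 0 (1 / μ) := fun t ht => ⟨ha.trans_le ht.1, ht.2.trans_lt hb⟩
  have hwc : ContinuousOn w (Icc a b) := by simpa [uIcc_of_le hab] using hw.continuousOn
  have hv' := h.continuousOn.mono (hsub.trans Ioo_subset_Ico_self)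
  have hw' : ContinuousOn (wt μ) (Icc a b) := (continuous_wt μ).continuousOn
  have hq := h.absolutelyContinuous_quotient hv ha hab hb
  have hg : AbsolutelyContinuousOnInterval (fun t => wt μ t * m t / v t * (w t * w t)) a b :=
    hq.fun_mul (hw.fun_mul hw)
  have hI1 : IntervalIntegrable
      (fun t => 1 / 4 * wt μ t ^ 2 * (Real.sin (4 * v t) / v t) * w t ^ 2) volume a b := by
    refine ContinuousOn.intervalIntegrable_of_Icc hab ?_
    refine ((continuousOn_const.mul (hw'.pow 2)).mul (ContinuousOn.div
      (Real.continuous_sin.comp_continuousOn (continuousOn_const.mul hv')) hv' ?_)).mul (hwc.pow 2)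
    exact fun t ht => (hv t (hsub ht)).1.ne'
  have hI2 : IntervalIntegrable (fun t => wt μ t * deriv w t ^ 2) volume a b :=
    hw2.continuousOn_mul (continuous_wt μ).continuousOn
  have hI3 := hg.intervalIntegrable_deriv
  have hle : ∫ t in a..b, (1 / 4 * wt μ t ^ 2 * (Real.sin (4 * v t) / v t) * w t ^ 2
      + deriv (fun t => wt μ t * m t / v t * (w t * w t)) t)
      ≤ ∫ t in a..b, wt μ t * deriv w t ^ 2 := by
    refine intervalIntegral.integral_mono_ae_restrict hab (hI1.add hI3) hI2 ?_
    rw [Filter.EventuallyLE, ae_restrict_iff' measurableSet_Icc]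
    filter_upwards [hw.ae_differentiableAt] with t ht htI
    have hdw := (ht (by rwa [uIcc_of_le hab])).hasDerivAt
    have htR := hsub htI
    have hq' := (h.hasDerivAt_flux t htR).div (h.hasDerivAt t htR) (hv t htR).1.ne'
    have hg' := hq'.mul (hdw.mul hdw)
    have hder : deriv (fun t => wt μ t * m t / v t * (w t * w t)) t = _ := hg'.deriv
    rw [hder]
    have hvt := (hv t htR).1
    have hp := wt_pos hμ (Ico_subset_interv hμ (Ioo_subset_Ico_self htR))
    -- Picone's identity: the Dirichlet density minus this square equals the potential term plus the
    -- derivative of (η² v'/v) w².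
    have hsq : 0 ≤ wt μ t * (deriv w t - m t / v t * w t) ^ 2 := by positivity
    have hid : wt μ t * deriv w t ^ 2 - wt μ t * (deriv w t - m t / v t * w t) ^ 2
      = 1 / 4 * wt μ t ^ 2 * (Real.sin (4 * v t) / v t) * w t ^ 2
        + ((-(1 / 4 * wt μ t ^ 2 * Real.sin (4 * v t)) * v t - wt μ t * m t * m t) / v t ^ 2
          * (w t * w t) + wt μ t * m t / v t * (deriv w t * w t + w t * deriv w t)) := by
      field_simp
      ring
    simp only [Pi.mul_apply, Pi.div_apply]
    linarith
  rw [intervalIntegral.integral_add hI1 hI3, hg.integral_deriv_eq_sub] at hle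
  have hb' : b ∈ Icc a b := ⟨hab, le_rfl⟩
  have hbR := hsub hb'
  -- The boundary term at the right end has a favourable sign, because v is increasing, and is
  -- dropped; the one at the left end stays in the statement.
  have hgb : 0 ≤ wt μ b * m b / v b * (w b * w b) := by
    have h1 := wt_pos hμ (Ico_subset_interv hμ (Ioo_subset_Ico_self hbR))
    have h2 := h.slope_pos hμ hv b (Ioo_subset_Ico_self hbR)
    have h3 := (hv b hbR).1
    have h4 := mul_self_nonneg (w b)
    positivity
  rw [sq (w a)]
  linarith

/-- The slope at the origin is positive, so v grows at least linearly there even if v(0) = 0. This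
tames the quotient w²/v in the boundary term of Picone's inequality. -/
lemma exists_linear_lower_bound (hμ : 0 < μ) (h : IsProfile μ v m)
    (hv : ∀ y ∈ Ioo 0 (1 / μ), v y ∈ Ioo 0 (Real.pi / 4)) :
    ∃ c > 0, ∀ᶠ a in 𝓝[>] (0 : ℝ), c * a ≤ v a := by
  have hR : 0 < 1 / μ := by positivity
  have h0 : (0 : ℝ) ∈ Ico 0 (1 / μ) := ⟨le_rfl, hR⟩
  have hm0 := h.slope_pos hμ hv 0 h0
  have hv0 : 0 ≤ v 0 := by
    have := (h.continuousOn 0 h0).tendsto.mono_left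
      (nhdsWithin_mono 0 (Ioo_subset_Ico_self : Ioo 0 (1 / μ) ⊆ _))
    rw [nhdsWithin_Ioo_eq_nhdsGT hR] at this
    refine ge_of_tendsto this ?_
    filter_upwards [Ioo_mem_nhdsGT hR] with t ht using (hv t ht).1.le
  have hev : ∀ᶠ t in 𝓝[Ico 0 (1 / μ)] (0 : ℝ), m 0 / 2 < m t :=
    (h.continuousOn_slope 0 h0).tendsto.eventually (lt_mem_nhds (by linarith))
  rw [nhdsWithin_Ico_eq_nhdsGE hR] at hev
  obtain ⟨d, hd, hdm⟩ := mem_nhdsGE_iff_exists_Ico_subset.1 hev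
  have hd0 : (0 : ℝ) < d := hd
  refine ⟨m 0 / 2, by linarith, ?_⟩
  have hmin : 0 < min d (1 / μ) := lt_min hd0 hR
  filter_upwards [Ioo_mem_nhdsGT hmin] with a ha
  have had : a < d := ha.2.trans_le (min_le_left _ _)
  have haR : a < 1 / μ := ha.2.trans_le (min_le_right _ _)
  obtain ⟨c, hc, hceq⟩ := exists_hasDerivAt_eq_slope v m ha.1
    (h.continuousOn.mono (Icc_subset_Ico_right haR))
    (fun t ht => h.hasDerivAt t ⟨ht.1, ht.2.trans haR⟩)
  have h1 : m 0 / 2 < m c := hdm ⟨hc.1.le, hc.2.trans had⟩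
  rw [hceq, sub_zero, lt_div_iff₀ ha.1] at h1
  linarith

/-- Picone's inequality for functions vanishing at the origin. -/
theorem picone (hμ : 0 < μ) (h : IsProfile μ v m)
    (hv : ∀ y ∈ Ioo 0 (1 / μ), v y ∈ Ioo 0 (Real.pi / 4)) {b : ℝ} (hb0 : 0 < b)
    (hb : b < 1 / μ) {w : ℝ → ℝ} (hw : AbsolutelyContinuousOnInterval w 0 b)
    (hw2 : IntervalIntegrable (fun t => deriv w t ^ 2) volume 0 b) (h0 : w 0 = 0) :
    IntervalIntegrable
      (fun t => 1 / 4 * wt μ t ^ 2 * (Real.sin (4 * v t) / v t) * w t ^ 2) volume 0 b ∧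
    ∫ t in (0 : ℝ)..b, 1 / 4 * wt μ t ^ 2 * (Real.sin (4 * v t) / v t) * w t ^ 2
      ≤ ∫ t in (0 : ℝ)..b, wt μ t * deriv w t ^ 2 := by
  have hwc : ContinuousOn w (Icc 0 b) := by simpa [uIcc_of_le hb0.le] using hw.continuousOn
  have hsub : Ioc 0 b ⊆ Ioo 0 (1 / μ) := fun t ht => ⟨ht.1, ht.2.trans_lt hb⟩
  have hv' := h.continuousOn.mono (hsub.trans Ioo_subset_Ico_self)
  have hw' : ContinuousOn (wt μ) (Ioc 0 b) := (continuous_wt μ).continuousOn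
  have hI : IntervalIntegrable
      (fun t => 1 / 4 * wt μ t ^ 2 * (Real.sin (4 * v t) / v t) * w t ^ 2) volume 0 b := by
    have hsq : IntervalIntegrable (fun t => w t ^ 2) volume 0 b :=
      ContinuousOn.intervalIntegrable_of_Icc hb0.le (hwc.pow 2)
    refine hsq.mono_fun ?_ ?_
    · rw [uIoc_of_le hb0.le]
      refine ContinuousOn.aestronglyMeasurable ?_ measurableSet_Ioc
      refine ((continuousOn_const.mul (hw'.pow 2)).mul (ContinuousOn.div
        (Real.continuous_sin.comp_continuousOn (continuousOn_const.mul hv')) hv' ?_)).mul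
        ((hwc.mono Ioc_subset_Icc_self).pow 2)
      exact fun t ht => (hv t (hsub ht)).1.ne'
    · rw [uIoc_of_le hb0.le, Filter.EventuallyLE, ae_restrict_iff' measurableSet_Ioc]
      refine Eventually.of_forall fun t ht => ?_
      have hp := wt_pos hμ (Ico_subset_interv hμ (Ioo_subset_Ico_self (hsub ht)))
      have hp1 := wt_le_one μ t
      rw [norm_mul, norm_mul, Real.norm_eq_abs, Real.norm_eq_abs, Real.norm_eq_abs,
        abs_of_nonneg (by positivity : 0 ≤ 1 / 4 * wt μ t ^ 2)]
      have h4 := abs_sin_four_mul_div_le (v t)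
      have hp2 : wt μ t ^ 2 ≤ 1 := by nlinarith
      calc 1 / 4 * wt μ t ^ 2 * |Real.sin (4 * v t) / v t| * |w t ^ 2|
          ≤ 1 / 4 * 1 * 4 * |w t ^ 2| := by gcongr
        _ = |w t ^ 2| := by ring
  refine ⟨hI, ?_⟩
  set f := fun t => 1 / 4 * wt μ t ^ 2 * (Real.sin (4 * v t) / v t) * w t ^ 2 with hf
  obtain ⟨c, hc, hcv⟩ := h.exists_linear_lower_bound hμ hv
  have hR : 0 < 1 / μ := by positivity
  have hI2 : IntervalIntegrable (fun t => wt μ t * deriv w t ^ 2) volume 0 b :=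
    hw2.continuousOn_mul (continuous_wt μ).continuousOn
  have hprim : ∀ g : ℝ → ℝ, IntervalIntegrable g volume 0 b →
      Tendsto (fun a => ∫ t in (0 : ℝ)..a, g t) (𝓝[>] 0) (𝓝 0) := by
    intro g hg
    have hg' := (intervalIntegral.continuousOn_primitive_interval (a := 0) (b := b) (f := g)
      (by rw [uIcc_of_le hb0.le]; exact (intervalIntegrable_iff_integrableOn_Icc_of_le hb0.le).1 hg))
    rw [uIcc_of_le hb0.le] at hg'
    have h1 := (hg' 0 ⟨le_rfl, hb0.le⟩).tendsto.mono_left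
      (nhdsWithin_mono 0 (Ioo_subset_Icc_self : Ioo 0 b ⊆ _))
    rwa [nhdsWithin_Ioo_eq_nhdsGT hb0, intervalIntegral.integral_same] at h1
  -- The boundary term at a is at most (1/(4μ)) w(a)²/(c a), and w(a)² ≤ a ∫₀ᵃ w'² by
  -- Cauchy–Schwarz. The factor a cancels, leaving a multiple of ∫₀ᵃ w'², which tends to 0 with a.
  have hlim : Tendsto (fun a => (∫ t in (0 : ℝ)..b, wt μ t * deriv w t ^ 2)
      + (1 / μ / 4) / c * (∫ t in (0 : ℝ)..a, deriv w t ^ 2) + ∫ t in (0 : ℝ)..a, f t) (𝓝[>] 0)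
      (𝓝 (∫ t in (0 : ℝ)..b, wt μ t * deriv w t ^ 2)) := by
    simpa using (((hprim _ hw2).const_mul ((1 / μ / 4) / c)).const_add
      (∫ t in (0 : ℝ)..b, wt μ t * deriv w t ^ 2)).add (hprim f hI)
  refine ge_of_tendsto hlim ?_
  filter_upwards [hcv, Ioo_mem_nhdsGT hb0] with a hca ha
  have haR : a ∈ Ioo 0 (1 / μ) := ⟨ha.1, ha.2.trans hb⟩
  have hsa : uIcc a b ⊆ uIcc 0 b := by
    rw [uIcc_of_le ha.2.le, uIcc_of_le hb0.le]; exact Icc_subset_Icc_left ha.1.le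
  have hsa' : uIcc 0 a ⊆ uIcc 0 b := by
    rw [uIcc_of_le ha.1.le, uIcc_of_le hb0.le]; exact Icc_subset_Icc_right ha.2.le
  have h1 := h.picone_of_pos hμ hv ha.1 ha.2.le hb (hw.mono hsa) (hw2.mono_set hsa)
  have h2 := sq_le_mul_integral_deriv_sq ha.1 (hw.mono hsa') (hw2.mono_set hsa') h0
  have h3 : ∫ t in a..b, wt μ t * deriv w t ^ 2 ≤ ∫ t in (0 : ℝ)..b, wt μ t * deriv w t ^ 2 := by
    rw [← intervalIntegral.integral_add_adjacent_intervals (hI2.mono_set hsa') (hI2.mono_set hsa)]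
    have : 0 ≤ ∫ t in (0 : ℝ)..a, wt μ t * deriv w t ^ 2 := by
      refine intervalIntegral.integral_nonneg ha.1.le fun t ht => ?_
      exact mul_nonneg (wt_pos hμ (Ico_subset_interv hμ ⟨ht.1, ht.2.trans_lt haR.2⟩)).le
        (sq_nonneg _)
    linarith
  have h4 : wt μ a * m a / v a * w a ^ 2 ≤ (1 / μ / 4) / c * ∫ t in (0 : ℝ)..a, deriv w t ^ 2 := by
    have hp := wt_pos hμ (Ico_subset_interv hμ (Ioo_subset_Ico_self haR))
    have hp1 := wt_le_one μ a
    have hma := (h.slope_pos hμ hv a (Ioo_subset_Ico_self haR))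
    have hma' := (le_abs_self _).trans (h.abs_slope_le a (Ioo_subset_Ico_self haR))
    have hflux : wt μ a * m a ≤ 1 / μ / 4 := by
      calc wt μ a * m a ≤ 1 * (1 / 4 * 1 * (1 / μ - 0)) := by
            refine mul_le_mul hp1 (hma'.trans ?_) hma.le zero_le_one
            have : 0 ≤ 1 / μ - a := by linarith [haR.2]
            gcongr
            exact ha.1.le
        _ = _ := by ring
    have hca' : 0 < c * a := mul_pos hc ha.1
    calc wt μ a * m a / v a * w a ^ 2
        ≤ (1 / μ / 4) / (c * a) * (a * ∫ t in (0 : ℝ)..a, deriv w t ^ 2) := by gcongr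
      _ = _ := by have := ha.1.ne'; field_simp
  have h5 := intervalIntegral.integral_add_adjacent_intervals (hI.mono_set hsa') (hI.mono_set hsa)
  linarith

end IsProfile

end DomainWall

/-! ### Shooting from the singular end point 1/μ. -/

namespace DomainWall

/-- The flux `∫_t^{1/μ} (1/4) η₀⁴ sin (4 u)`. -/
noncomputable def flux (μ : ℝ) (u : ℝ → ℝ) (t : ℝ) : ℝ :=
  ∫ r in t..(1 / μ), 1 / 4 * wt μ r ^ 2 * Real.sin (4 * u r)

/-- Clamping to `[0, 1/μ]` after even reflection. -/
noncomputable def clamp (μ t : ℝ) : ℝ := min |t| (1 / μ)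

/-- The slope determined by the flux, as an even function on the line. -/
noncomputable def fluxSlope (μ : ℝ) (u : ℝ → ℝ) (t : ℝ) : ℝ :=
  flux μ u (clamp μ t) / wt μ (clamp μ t)

section Flux

variable {μ : ℝ} {u u' : ℝ → ℝ}

lemma clamp_mem (hμ : 0 < μ) (t : ℝ) : clamp μ t ∈ Icc 0 (1 / μ) :=
  ⟨le_min (abs_nonneg _) (by positivity), min_le_right _ _⟩

lemma clamp_of_mem {t : ℝ} (ht : t ∈ Icc 0 (1 / μ)) : clamp μ t = t := by
  rw [clamp, abs_of_nonneg ht.1, min_eq_left ht.2]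

lemma continuous_clamp (μ : ℝ) : Continuous (clamp μ) := by
  unfold clamp; fun_prop

lemma continuous_fluxIntegrand (hu : Continuous u) :
    Continuous (fun r => 1 / 4 * wt μ r ^ 2 * Real.sin (4 * u r)) := by
  have := continuous_wt μ
  fun_prop

lemma wt_nonneg_of_mem (hμ : 0 < μ) {t : ℝ} (ht : t ∈ Icc 0 (1 / μ)) : 0 ≤ wt μ t := by
  rw [← wt_radius hμ]; exact wt_antitone ht.1 ht.2

/-- The weight decreases on [0, 1/μ], so its square can be taken out of the integral at the lower
limit t. One of the two factors then pays for the division by the weight in `fluxSlope`. -/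
lemma abs_flux_sub_le (hμ : 0 < μ) (hu : Continuous u) (hu' : Continuous u') {t B : ℝ}
    (ht : t ∈ Icc 0 (1 / μ)) (hB : ∀ r ∈ Icc t (1 / μ), |u r - u' r| ≤ B) :
    |flux μ u t - flux μ u' t| ≤ wt μ t ^ 2 * (1 / μ - t) * B := by
  have hB0 : 0 ≤ B := (abs_nonneg _).trans (hB t ⟨le_rfl, ht.2⟩)
  rw [flux, flux, ← intervalIntegral.integral_sub
    ((continuous_fluxIntegrand hu).intervalIntegrable _ _)
    ((continuous_fluxIntegrand hu').intervalIntegrable _ _)]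
  have := intervalIntegral.norm_integral_le_of_norm_le_const (a := t) (b := 1 / μ)
    (f := fun r => 1 / 4 * wt μ r ^ 2 * Real.sin (4 * u r)
      - 1 / 4 * wt μ r ^ 2 * Real.sin (4 * u' r)) (C := wt μ t ^ 2 * B) ?_
  · rw [abs_of_nonneg (by linarith [ht.2] : 0 ≤ 1 / μ - t), Real.norm_eq_abs] at this
    linarith
  · intro r hr
    rw [uIoc_of_le ht.2] at hr
    have hr0 : r ∈ Icc 0 (1 / μ) := ⟨ht.1.trans hr.1.le, hr.2⟩
    have h1 := wt_nonneg_of_mem hμ hr0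
    have h2 := wt_antitone (μ := μ) ht.1 hr.1.le
    have h3 : |Real.sin (4 * u r) - Real.sin (4 * u' r)| ≤ 4 * B := by
      have h4 := Real.lipschitzWith_sin.dist_le_mul (4 * u r) (4 * u' r)
      rw [Real.dist_eq, Real.dist_eq, ← mul_sub, abs_mul] at h4
      have h5 := hB r ⟨hr.1.le, hr.2⟩
      simp only [NNReal.coe_one, one_mul, show |(4 : ℝ)| = 4 by norm_num] at h4
      linarith
    rw [← mul_sub, norm_mul, Real.norm_eq_abs, Real.norm_eq_abs,
      abs_of_nonneg (by positivity : 0 ≤ 1 / 4 * wt μ r ^ 2)]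
    calc 1 / 4 * wt μ r ^ 2 * |Real.sin (4 * u r) - Real.sin (4 * u' r)|
        ≤ 1 / 4 * wt μ t ^ 2 * (4 * B) := by gcongr
      _ = wt μ t ^ 2 * B := by ring

lemma abs_flux_le (hμ : 0 < μ) {t : ℝ} (ht : t ∈ Icc 0 (1 / μ)) :
    |flux μ u t| ≤ 1 / 4 * wt μ t ^ 2 * (1 / μ - t) := by
  have := intervalIntegral.norm_integral_le_of_norm_le_const (a := t) (b := 1 / μ)
    (f := fun r => 1 / 4 * wt μ r ^ 2 * Real.sin (4 * u r)) (C := 1 / 4 * wt μ t ^ 2) ?_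
  · rwa [abs_of_nonneg (by linarith [ht.2] : 0 ≤ 1 / μ - t), Real.norm_eq_abs] at this
  · intro r hr
    rw [uIoc_of_le ht.2] at hr
    have h1 := wt_nonneg_of_mem hμ ⟨ht.1.trans hr.1.le, hr.2⟩
    have h2 := wt_antitone (μ := μ) ht.1 hr.1.le
    rw [norm_mul, Real.norm_eq_abs, Real.norm_eq_abs,
      abs_of_nonneg (by positivity : 0 ≤ 1 / 4 * wt μ r ^ 2)]
    calc 1 / 4 * wt μ r ^ 2 * |Real.sin (4 * u r)| ≤ 1 / 4 * wt μ t ^ 2 * 1 := by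
          gcongr
          exact Real.abs_sin_le_one _
      _ = _ := by ring

lemma abs_fluxSlope_le (hμ : 0 < μ) (t : ℝ) :
    |fluxSlope μ u t| ≤ 1 / 4 * wt μ (clamp μ t) * (1 / μ - clamp μ t) := by
  have hc := clamp_mem hμ t
  have h0 := wt_nonneg_of_mem hμ hc
  have hR : 0 ≤ 1 / μ - clamp μ t := by linarith [hc.2]
  rw [fluxSlope, abs_div, abs_of_nonneg h0]
  refine div_le_of_le_mul₀ h0 (by positivity) ((abs_flux_le hμ hc).trans (le_of_eq (by ring)))

lemma abs_fluxSlope_sub_le (hμ : 0 < μ) (hu : Continuous u) (hu' : Continuous u') {t B : ℝ}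
    (ht : t ∈ Icc 0 (1 / μ)) (hB : ∀ r ∈ Icc t (1 / μ), |u r - u' r| ≤ B) :
    |fluxSlope μ u t - fluxSlope μ u' t| ≤ 1 / μ * B := by
  have hB0 : 0 ≤ B := (abs_nonneg _).trans (hB t ⟨le_rfl, ht.2⟩)
  have h0 := wt_nonneg_of_mem hμ ht
  have hR : 0 ≤ 1 / μ - t := by linarith [ht.2]
  have h1 : |fluxSlope μ u t - fluxSlope μ u' t| ≤ wt μ t * (1 / μ - t) * B := by
    rw [fluxSlope, fluxSlope, clamp_of_mem ht, ← sub_div, abs_div, abs_of_nonneg h0]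
    exact div_le_of_le_mul₀ h0 (by positivity)
      ((abs_flux_sub_le hμ hu hu' ht hB).trans (le_of_eq (by ring)))
  refine h1.trans ?_
  have := wt_le_one μ t
  calc wt μ t * (1 / μ - t) * B ≤ 1 * (1 / μ - 0) * B := by gcongr; exact ht.1
    _ = _ := by ring

lemma hasDerivAt_flux (hu : Continuous u) (t : ℝ) :
    HasDerivAt (flux μ u) (-(1 / 4 * wt μ t ^ 2 * Real.sin (4 * u t))) t :=
  intervalIntegral.integral_hasDerivAt_left ((continuous_fluxIntegrand hu).intervalIntegrable _ _)
    ((continuous_fluxIntegrand hu).stronglyMeasurableAtFilter _ _)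
    (continuous_fluxIntegrand hu).continuousAt

/-- At clamped points equal to 1/μ the quotient is 0/0, whose conventional value 0 is also the
limit: the flux is of order wt² (1/μ - t). -/
lemma continuous_fluxSlope (hμ : 0 < μ) (hu : Continuous u) : Continuous (fluxSlope μ u) := by
  rw [continuous_iff_continuousAt]
  intro t
  have hcf : Continuous fun t => flux μ u (clamp μ t) :=
    (continuous_iff_continuousAt.2 fun t => (hasDerivAt_flux hu t).continuousAt).comp
      (continuous_clamp μ)
  have hcw : Continuous fun t => wt μ (clamp μ t) := (continuous_wt μ).comp (continuous_clamp μ)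
  by_cases h : wt μ (clamp μ t) = 0
  · have h0 : fluxSlope μ u t = 0 := by rw [fluxSlope, h, div_zero]
    rw [ContinuousAt, h0]
    have hlim : Tendsto (fun t => 1 / 4 * wt μ (clamp μ t) * (1 / μ - clamp μ t)) (𝓝 t) (𝓝 0) := by
      have : Continuous (fun t => 1 / 4 * wt μ (clamp μ t) * (1 / μ - clamp μ t)) :=
        (continuous_const.mul hcw).mul (continuous_const.sub (continuous_clamp μ))
      simpa [h] using this.tendsto t
    exact squeeze_zero_norm (fun t => abs_fluxSlope_le hμ t) hlim
  · exact hcf.continuousAt.div hcw.continuousAt h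

lemma fluxSlope_neg (t : ℝ) : fluxSlope μ u (-t) = fluxSlope μ u t := by
  simp [fluxSlope, clamp]

end Flux

section Shooting

variable {μ : ℝ}

/-- The function encoded by `z`, after undoing the exponential weight. -/
noncomputable def unweight (hμ : 0 < μ) (z : C(Icc (0 : ℝ) (1 / μ), ℝ)) (y : ℝ) : ℝ :=
  Real.exp (2 / μ * (1 / μ - y)) * IccExtend (show (0 : ℝ) ≤ 1 / μ by positivity) z y

lemma continuous_unweight (hμ : 0 < μ) (z : C(Icc (0 : ℝ) (1 / μ), ℝ)) :
    Continuous (unweight hμ z) := by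
  unfold unweight
  exact (by fun_prop : Continuous fun y => Real.exp (2 / μ * (1 / μ - y))).mul
    z.continuous.Icc_extend'

lemma abs_unweight_sub_le (hμ : 0 < μ) (z z' : C(Icc (0 : ℝ) (1 / μ), ℝ)) (y : ℝ) :
    |unweight hμ z y - unweight hμ z' y| ≤ Real.exp (2 / μ * (1 / μ - y)) * dist z z' := by
  rw [unweight, unweight, ← mul_sub, abs_mul, abs_of_pos (Real.exp_pos _)]
  gcongr
  exact (Real.dist_eq _ _).symm.trans_le (ContinuousMap.dist_apply_le_dist _)

/-- The solution of the shooting problem with source `u`. -/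
noncomputable def shoot (μ s : ℝ) (u : ℝ → ℝ) (y : ℝ) : ℝ :=
  s - ∫ t in y..(1 / μ), fluxSlope μ u t

lemma hasDerivAt_shoot (hμ : 0 < μ) (s : ℝ) {u : ℝ → ℝ} (hu : Continuous u) (y : ℝ) :
    HasDerivAt (shoot μ s u) (fluxSlope μ u y) y := by
  have hc := continuous_fluxSlope hμ hu
  have := (intervalIntegral.integral_hasDerivAt_left (hc.intervalIntegrable y (1 / μ))
    (hc.stronglyMeasurableAtFilter _ _) hc.continuousAt).const_sub s
  rw [neg_neg] at this
  exact this

lemma continuous_shoot (hμ : 0 < μ) (s : ℝ) {u : ℝ → ℝ} (hu : Continuous u) :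
    Continuous (shoot μ s u) :=
  continuous_iff_continuousAt.2 fun y => (hasDerivAt_shoot hμ s hu y).continuousAt

/-- The weighted Picard operator of the shooting problem. -/
noncomputable def shootOp (hμ : 0 < μ) (s : ℝ) (z : C(Icc (0 : ℝ) (1 / μ), ℝ)) :
    C(Icc (0 : ℝ) (1 / μ), ℝ) where
  toFun y := Real.exp (-(2 / μ * (1 / μ - y))) * shoot μ s (unweight hμ z) y
  continuous_toFun := by
    have := continuous_shoot hμ s (continuous_unweight hμ z)
    fun_prop

/-- The slope map has Lipschitz constant 1/μ in the source. The exponential weight has rate 2/μ,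
twice that constant, so the contraction factor is 1/2 on the whole interval, with no restriction to
short intervals. -/
lemma dist_shootOp_le (hμ : 0 < μ) (s : ℝ) (z z' : C(Icc (0 : ℝ) (1 / μ), ℝ)) :
    dist (shootOp hμ s z) (shootOp hμ s z') ≤ 1 / 2 * dist z z' := by
  rw [ContinuousMap.dist_le (by positivity)]
  rintro ⟨y, hy⟩
  have hcu := continuous_unweight hμ z
  have hcu' := continuous_unweight hμ z'
  set D := dist z z'
  have hD : 0 ≤ D := dist_nonneg
  have hslope : ∀ t ∈ Icc y (1 / μ), ‖fluxSlope μ (unweight hμ z) t - fluxSlope μ (unweight hμ z') t‖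
      ≤ 1 / μ * (Real.exp (2 / μ * (1 / μ - t)) * D) := by
    intro t ht
    refine abs_fluxSlope_sub_le hμ hcu hcu' ⟨hy.1.trans ht.1, ht.2⟩ fun r hr => ?_
    refine (abs_unweight_sub_le hμ z z' r).trans ?_
    gcongr
    exact hr.1
  have hint : ∫ t in y..(1 / μ), 1 / μ * (Real.exp (2 / μ * (1 / μ - t)) * D)
      = 1 / 2 * D * (Real.exp (2 / μ * (1 / μ - y)) - 1) := by
    have hd : ∀ t ∈ uIcc y (1 / μ), HasDerivAt (fun t => -(1 / 2 * D * Real.exp (2 / μ * (1 / μ - t))))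
        (1 / μ * (Real.exp (2 / μ * (1 / μ - t)) * D)) t := by
      intro t _
      have := ((((((hasDerivAt_id t).const_sub (1 / μ)).const_mul (2 / μ)).exp).const_mul
        (1 / 2 * D)).neg)
      exact this.congr_deriv (by simp; ring)
    rw [intervalIntegral.integral_eq_sub_of_hasDerivAt hd
      (Continuous.intervalIntegrable (by fun_prop) _ _)]
    simp; ring
  have hdiff : |shoot μ s (unweight hμ z) y - shoot μ s (unweight hμ z') y|
      ≤ 1 / 2 * D * Real.exp (2 / μ * (1 / μ - y)) := by
    have h1 := (continuous_fluxSlope hμ hcu).intervalIntegrable y (1 / μ) (μ := volume)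
    have h2 := (continuous_fluxSlope hμ hcu').intervalIntegrable y (1 / μ) (μ := volume)
    rw [shoot, shoot, sub_sub_sub_cancel_left, ← intervalIntegral.integral_sub h2 h1]
    have h3 := intervalIntegral.norm_integral_le_of_norm_le (μ := volume) hy.2
      (f := fun t => fluxSlope μ (unweight hμ z') t - fluxSlope μ (unweight hμ z) t)
      (g := fun t => 1 / μ * (Real.exp (2 / μ * (1 / μ - t)) * D))
      (Eventually.of_forall fun t ht => by
        rw [norm_sub_rev]; exact hslope t ⟨ht.1.le, ht.2⟩)
      (Continuous.intervalIntegrable (by fun_prop) _ _)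
    rw [hint, Real.norm_eq_abs] at h3
    linarith
  rw [Real.dist_eq]
  change |Real.exp (-(2 / μ * (1 / μ - y))) * shoot μ s (unweight hμ z) y
    - Real.exp (-(2 / μ * (1 / μ - y))) * shoot μ s (unweight hμ z') y| ≤ _
  rw [← mul_sub, abs_mul, abs_of_pos (Real.exp_pos _), Real.exp_neg,
    inv_mul_le_iff₀ (Real.exp_pos _)]
  linarith

lemma dist_shootOp_shootOp_le (hμ : 0 < μ) (s s' : ℝ) (z : C(Icc (0 : ℝ) (1 / μ), ℝ)) :
    dist (shootOp hμ s z) (shootOp hμ s' z) ≤ |s - s'| := by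
  rw [ContinuousMap.dist_le (abs_nonneg _)]
  rintro ⟨y, hy⟩
  rw [Real.dist_eq]
  change |Real.exp (-(2 / μ * (1 / μ - y))) * shoot μ s (unweight hμ z) y
    - Real.exp (-(2 / μ * (1 / μ - y))) * shoot μ s' (unweight hμ z) y| ≤ _
  rw [← mul_sub, abs_mul, abs_of_pos (Real.exp_pos _), shoot, shoot, sub_sub_sub_cancel_right]
  have : 0 ≤ 1 / μ - y := by linarith [hy.2]
  refine mul_le_of_le_one_left (abs_nonneg _) (Real.exp_le_one_iff.2 ?_)
  simp only [Left.neg_nonpos_iff]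
  positivity

lemma contracting_shootOp (hμ : 0 < μ) (s : ℝ) : ContractingWith (1 / 2) (shootOp hμ s) :=
  ⟨by rw [← NNReal.coe_lt_coe]; norm_num, LipschitzWith.of_dist_le_mul fun z z' => by
    simpa using dist_shootOp_le hμ s z z'⟩

/-- The family of regular solutions, parametrized by the value at the singular end point. -/
theorem exists_shooting_family (hμ : 0 < μ) :
    ∃ v m : ℝ → ℝ → ℝ, (∀ s, IsProfile μ (v s) (m s)) ∧ (∀ s, Continuous (m s)) ∧
      (∀ s y, m s (-y) = m s y) ∧ (∀ s y, HasDerivAt (v s) (m s y) y) ∧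
      (∀ s, v s (1 / μ) = s) ∧ (∀ y ∈ Icc 0 (1 / μ), v (Real.pi / 4) y = Real.pi / 4) ∧
      ∃ C : NNReal, ∀ s s', ∀ y ∈ Icc 0 (1 / μ), |v s y - v s' y| ≤ C * |s - s'| := by
  have hR : 0 < 1 / μ := by positivity
  set Z : ℝ → C(Icc (0 : ℝ) (1 / μ), ℝ) :=
    fun s => ContractingWith.fixedPoint (shootOp hμ s) (contracting_shootOp hμ s) with hZ
  have hcu := fun s => continuous_unweight hμ (Z s)
  have hext : ∀ (z : C(Icc (0 : ℝ) (1 / μ), ℝ)) (y : ℝ) (hy : y ∈ Icc 0 (1 / μ)),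
      unweight hμ z y = Real.exp (2 / μ * (1 / μ - y)) * z ⟨y, hy⟩ := by
    intro z y hy
    rw [unweight, IccExtend_of_mem _ _ hy]
  have hfix : ∀ s, ∀ y ∈ Icc 0 (1 / μ), unweight hμ (Z s) y = shoot μ s (unweight hμ (Z s)) y := by
    intro s y hy
    have h1 : shootOp hμ s (Z s) = Z s := (contracting_shootOp hμ s).fixedPoint_isFixedPt
    have h2 : Z s ⟨y, hy⟩
        = Real.exp (-(2 / μ * (1 / μ - y))) * shoot μ s (unweight hμ (Z s)) y := by
      conv_lhs => rw [← h1]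
      rfl
    rw [hext _ _ hy, h2, ← mul_assoc, ← Real.exp_add, add_neg_cancel, Real.exp_zero, one_mul]
  refine ⟨fun s => shoot μ s (unweight hμ (Z s)), fun s => fluxSlope μ (unweight hμ (Z s)),
    ?_, fun s => continuous_fluxSlope hμ (hcu s), fun s y => fluxSlope_neg y,
    fun s y => hasDerivAt_shoot hμ s (hcu s) y, fun s => by simp [shoot], ?_, ?_⟩
  · intro s
    refine ⟨fun y _ => hasDerivAt_shoot hμ s (hcu s) y, ?_, (continuous_shoot hμ s (hcu s)).continuousOn,
      (continuous_fluxSlope hμ (hcu s)).continuousOn, ?_⟩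
    · intro y hy
      beta_reduce
      rw [← hfix s y (Ioo_subset_Icc_self hy)]
      refine (hasDerivAt_flux (hcu s) y).congr_of_eventuallyEq ?_
      filter_upwards [Ioo_mem_nhds hy.1 hy.2] with t ht
      rw [fluxSlope, clamp_of_mem (Ioo_subset_Icc_self ht), mul_div_cancel₀]
      exact (wt_pos hμ (Ico_subset_interv hμ (Ioo_subset_Ico_self ht))).ne'
    · intro y hy
      have := abs_fluxSlope_le (u := unweight hμ (Z s)) hμ y
      rwa [clamp_of_mem (Ico_subset_Icc_self hy)] at this
  -- The constant π/4 solves the problem with s = π/4, since sin π = 0; uniqueness of the fixed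
  -- point identifies it with the member of the family.
  · let z₀ : C(Icc (0 : ℝ) (1 / μ), ℝ) :=
      ⟨fun y => Real.exp (-(2 / μ * (1 / μ - y))) * (Real.pi / 4), by fun_prop⟩
    have hz₀ : ∀ y ∈ Icc 0 (1 / μ), unweight hμ z₀ y = Real.pi / 4 := by
      intro y hy
      rw [hext _ _ hy]
      change _ * (Real.exp (-(2 / μ * (1 / μ - y))) * (Real.pi / 4)) = _
      rw [← mul_assoc, ← Real.exp_add, add_neg_cancel, Real.exp_zero, one_mul]
    have hs₀ : ∀ t, fluxSlope μ (unweight hμ z₀) t = 0 := by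
      intro t
      have hc := clamp_mem hμ t
      rw [fluxSlope, flux, intervalIntegral.integral_congr (g := fun _ => 0)]
      · simp
      · intro r hr
        rw [uIcc_of_le hc.2] at hr
        simp only [hz₀ r ⟨hc.1.trans hr.1, hr.2⟩]
        rw [show 4 * (Real.pi / 4) = Real.pi by ring, Real.sin_pi, mul_zero]
    have hsh : ∀ y, shoot μ (Real.pi / 4) (unweight hμ z₀) y = Real.pi / 4 := by
      intro y; simp [shoot, hs₀]
    have hfp : shootOp hμ (Real.pi / 4) z₀ = z₀ := by
      ext y
      change _ * shoot μ (Real.pi / 4) (unweight hμ z₀) y = _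
      rw [hsh]; rfl
    have heq : Z (Real.pi / 4) = z₀ :=
      ((contracting_shootOp hμ (Real.pi / 4)).fixedPoint_unique hfp).symm
    intro y _
    simp only [heq, hsh]
  · refine ⟨⟨2 * Real.exp (2 / μ * (1 / μ)), by positivity⟩, fun s s' y hy => ?_⟩
    -- Fixed points of two 1/2-contractions at uniform distance |s - s'| are within twice that
    -- distance; undoing the weight costs its maximal value, at y = 0.
    have hd : dist (Z s) (Z s') ≤ |s - s'| / (1 - 1 / 2) := by
      have := (contracting_shootOp hμ s').fixedPoint_lipschitz_in_map
        (hf := contracting_shootOp hμ s) (C := |s - s'|) (dist_shootOp_shootOp_le hμ s s')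
      convert this using 1
      norm_num
    change _ ≤ 2 * Real.exp (2 / μ * (1 / μ)) * _
    beta_reduce
    rw [← hfix s y hy, ← hfix s' y hy]
    refine (abs_unweight_sub_le hμ _ _ y).trans ?_
    calc Real.exp (2 / μ * (1 / μ - y)) * dist (Z s) (Z s')
        ≤ Real.exp (2 / μ * (1 / μ)) * (|s - s'| / (1 - 1 / 2)) := by
          gcongr
          linarith [hy.1]
      _ = _ := by ring

/-- Either all shooting solutions with small positive value at `1/μ` stay positive, or one of them
vanishes exactly at the origin. -/
theorem shooting_dichotomy (hμ : 0 < μ) :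
    (∀ s ∈ Ioo 0 (Real.pi / 4), ∃ v m, IsProfile μ v m ∧ ∀ y ∈ Ioo 0 (1 / μ), v y ∈ Ioc 0 s) ∨
    ∃ v m, IsProfile μ v m ∧ Continuous m ∧ (∀ y, m (-y) = m y) ∧ (∀ y, HasDerivAt v (m y) y) ∧
      v 0 = 0 ∧ ∀ y ∈ Ioo 0 (1 / μ), v y ∈ Ioo 0 (Real.pi / 4) := by
  obtain ⟨v, m, hP, hmc, hme, hvd, hvR, hpi, C, hC⟩ := exists_shooting_family hμ
  have hR : 0 < 1 / μ := by positivity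
  have hvc : ∀ s, Continuous (v s) :=
    fun s => continuous_iff_continuousAt.2 fun y => (hvd s y).continuousAt
  -- The bound holds near 1/μ by continuity, and a regular solution cannot reach ±π/4 without being
  -- constant.
  have hlt : ∀ s, |s| < Real.pi / 4 → ∀ y ∈ Ico 0 (1 / μ), |v s y| < Real.pi / 4 := by
    intro s hs
    have hev : ∀ᶠ y in 𝓝[<] (1 / μ), |v s y| < Real.pi / 4 := by
      have h1 := ((hvc s).abs.tendsto (1 / μ)).mono_left
        (nhdsWithin_le_nhds (s := Iio (1 / μ)))
      rw [hvR] at h1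
      exact h1.eventually (gt_mem_nhds hs)
    obtain ⟨y₀, h1, h2⟩ := (hev.and (Ioo_mem_nhdsLT hR)).exists
    exact (hP s).abs_lt_pi_div_four_of_abs_lt hμ (Ioo_subset_Ico_self h2) h1
  set F : ℝ → ℝ := fun s => sInf (v s '' Icc 0 (1 / μ)) with hF
  have hne : (Icc 0 (1 / μ)).Nonempty := nonempty_Icc.2 hR.le
  have hbdd : ∀ s, BddBelow (v s '' Icc 0 (1 / μ)) :=
    fun s => (isCompact_Icc.image (hvc s)).bddBelow
  have hFle : ∀ s, ∀ y ∈ Icc 0 (1 / μ), F s ≤ v s y :=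
    fun s y hy => csInf_le (hbdd s) (mem_image_of_mem _ hy)
  have hFat : ∀ s, ∃ y ∈ Icc 0 (1 / μ), v s y = F s :=
    fun s => (isCompact_Icc.image (hvc s)).sInf_mem (hne.image _)
  -- A minimum of functions that are Lipschitz in s with a common constant is Lipschitz in s.
  have hFc : Continuous F := by
    refine (LipschitzWith.of_le_add_mul C fun s s' => ?_).continuous
    obtain ⟨y, hy, hyF⟩ := hFat s'
    have h1 := hFle s y hy
    have h2 := (abs_le.1 (hC s s' y hy)).2
    rw [Real.dist_eq]
    linarith
  have hFpi : F (Real.pi / 4) = Real.pi / 4 := by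
    obtain ⟨y, hy, hyF⟩ := hFat (Real.pi / 4)
    rw [← hyF, hpi y hy]
  by_cases hall : ∀ s ∈ Ioo 0 (Real.pi / 4), 0 < F s
  · left
    intro s hs
    have hvs : ∀ y ∈ Ioo 0 (1 / μ), v s y ∈ Ioo 0 (Real.pi / 4) := by
      intro y hy
      refine ⟨(hall s hs).trans_le (hFle s y (Ioo_subset_Icc_self hy)), ?_⟩
      exact (abs_lt.1 (hlt s (by rw [abs_of_pos hs.1]; exact hs.2) y (Ioo_subset_Ico_self hy))).2
    refine ⟨v s, m s, hP s, fun y hy => ⟨(hvs y hy).1, ?_⟩⟩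
    have hmono : MonotoneOn (v s) (Icc 0 (1 / μ)) := by
      apply monotoneOn_of_deriv_nonneg (convex_Icc _ _) (hvc s).continuousOn
      · exact fun y _ => (hvd s y).differentiableAt.differentiableWithinAt
      · rw [interior_Icc]; intro y hy
        rw [(hvd s y).deriv]
        exact ((hP s).slope_pos hμ hvs y (Ioo_subset_Ico_self hy)).le
    have := hmono (Ioo_subset_Icc_self hy) (right_mem_Icc.2 hR.le) hy.2.le
    rwa [hvR] at this
  · right
    push Not at hall
    obtain ⟨s₁, hs₁, hFs₁⟩ := hall
    obtain ⟨s, hs, hFs⟩ := intermediate_value_Icc hs₁.2.le hFc.continuousOn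
      (show (0 : ℝ) ∈ Icc (F s₁) (F (Real.pi / 4)) from ⟨hFs₁, by rw [hFpi]; positivity⟩)
    have hs0 : 0 < s := hs₁.1.trans_le hs.1
    have hsπ : s < Real.pi / 4 := by
      refine lt_of_le_of_ne hs.2 fun h => ?_
      rw [h, hFpi] at hFs
      have := Real.pi_pos
      linarith
    have habs := hlt s (by rw [abs_of_pos hs0]; exact hsπ)
    have hnn : ∀ y ∈ Icc 0 (1 / μ), 0 ≤ v s y := fun y hy => hFs ▸ hFle s y hy
    have hpos : ∀ y ∈ Ioc 0 (1 / μ), 0 < v s y := by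
      intro y hy
      refine lt_of_le_of_ne (hnn y (Ioc_subset_Icc_self hy)) fun h => ?_
      rcases eq_or_lt_of_le hy.2 with h' | h'
      · rw [h', hvR] at h; exact hs0.ne h
      -- An interior zero of a nonnegative solution is a minimum, so the slope vanishes there too;
      -- the solution is then zero up to 1/μ, against v(1/μ) = s > 0.
      · have hmin : IsLocalMin (v s) y := by
          filter_upwards [Ioo_mem_nhds hy.1 h'] with t ht
          rw [← h]; exact hnn t (Ioo_subset_Icc_self ht)
        have hm0 := hmin.hasDerivAt_eq_zero (hvd s y)
        have hz := (hP s).eq_zero_of_le hμ habs ⟨hy.1.le, h'⟩ h.symm hm0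
        have hev : ∀ᶠ t in 𝓝[<] (1 / μ), v s t = 0 := by
          filter_upwards [Ioo_mem_nhdsLT h'] with t ht using hz t ⟨ht.1.le, ht.2⟩
        have h1 := ((hvc s).tendsto (1 / μ)).mono_left (nhdsWithin_le_nhds (s := Iio (1 / μ)))
        have h2 := tendsto_nhds_unique (tendsto_const_nhds.congr'
          (hev.mono fun t ht => ht.symm)) h1
        rw [hvR] at h2
        exact hs0.ne h2
    have hv0 : v s 0 = 0 := by
      obtain ⟨y, hy, hyF⟩ := hFat s
      rw [hFs] at hyF
      rcases eq_or_lt_of_le hy.1 with h | h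
      · rw [← h] at hyF; exact hyF
      · exact absurd hyF (hpos y ⟨h, hy.2⟩).ne'
    exact ⟨v s, m s, hP s, hmc s, hme s, hvd s, hv0, fun y hy =>
      ⟨hpos y (Ioo_subset_Ioc_self hy), (abs_lt.1 (habs y (Ioo_subset_Ico_self hy))).2⟩⟩

end Shooting

end DomainWall

/-! ### Function spaces on the interval and reduction to the half interval. -/

namespace DomainWall

/-- Serves to make cos w and sin w absolutely continuous for the merely absolutely continuous phase
w. -/
lemma absolutelyContinuousOnInterval_lipschitz_comp {K : NNReal} {g f : ℝ → ℝ} {a b : ℝ}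
    (hg : LipschitzWith K g) (hf : AbsolutelyContinuousOnInterval f a b) :
    AbsolutelyContinuousOnInterval (fun x => g (f x)) a b := by
  have h := Tendsto.const_mul (K : ℝ) hf
  rw [mul_zero] at h
  refine squeeze_zero (fun E => Finset.sum_nonneg fun i _ => dist_nonneg) (fun E => ?_) h
  rw [Finset.mul_sum]
  exact Finset.sum_le_sum fun i _ => hg.dist_le_mul _ _

section Interval

variable {μ : ℝ}

lemma interv_eq (μ : ℝ) : interv μ = Ioo (-(1 / μ)) (1 / μ) := rfl

lemma isOpen_interv (μ : ℝ) : IsOpen (interv μ) := isOpen_Ioo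

lemma measurableSet_interv (μ : ℝ) : MeasurableSet (interv μ) := measurableSet_Ioo

lemma neg_mem_interv {y : ℝ} (hy : y ∈ interv μ) : -y ∈ interv μ :=
  ⟨by linarith [hy.2], by linarith [hy.1]⟩

lemma zero_mem_interv (hμ : 0 < μ) : (0 : ℝ) ∈ interv μ := by
  have : 0 < 1 / μ := by positivity
  exact ⟨by linarith, this⟩

lemma Ioo_subset_interv (hμ : 0 < μ) : Ioo 0 (1 / μ) ⊆ interv μ :=
  Ioo_subset_Ico_self.trans (Ico_subset_interv hμ)

lemma Icc_subset_interv {a b : ℝ} (ha : a ∈ interv μ) (hb : b ∈ interv μ) : Icc a b ⊆ interv μ :=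
  ordConnected_Ioo.out ha hb

lemma eta0_sq {y : ℝ} (hμ : 0 < μ) (hy : y ∈ interv μ) : eta0 (μ * y) ^ 2 = wt μ y := by
  have h1 := mul_lt_one_of_lt hμ hy.2
  have h2 := mul_lt_one_of_lt (y := -y) hμ (by linarith [hy.1])
  have habs : |μ * y| < 1 := abs_lt.2 ⟨by linarith, h1⟩
  rw [eta0, if_pos habs, Real.sq_sqrt]
  · rfl
  · exact (wt_pos hμ hy).le

lemma eta0_pow_four {y : ℝ} (hμ : 0 < μ) (hy : y ∈ interv μ) : eta0 (μ * y) ^ 4 = wt μ y ^ 2 := by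
  rw [← eta0_sq hμ hy]; ring

/-- A property holding almost everywhere on each symmetric compact subinterval holds almost
everywhere on the interval. -/
lemma ae_interv_of_ae_Icc {P : ℝ → Prop} (hμ : 0 < μ)
    (h : ∀ c ∈ Ioo 0 (1 / μ), ∀ᵐ y, y ∈ Icc (-c) c → P y) : ∀ᵐ y, y ∈ interv μ → P y := by
  have hR : 0 < 1 / μ := by positivity
  obtain ⟨u, -, hu, hlim⟩ := exists_seq_strictMono_tendsto' hR
  have h1 : ∀ᵐ y, ∀ n, y ∈ Icc (-(u n)) (u n) → P y := ae_all_iff.2 fun n => h (u n) (hu n)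
  filter_upwards [h1] with y hy hyI
  have habs : |y| < 1 / μ := abs_lt.2 hyI
  obtain ⟨n, hn⟩ := (hlim.eventually (lt_mem_nhds habs)).exists
  exact hy n (abs_le.1 hn.le)

lemma H1loc.ae_differentiableAt {f : ℝ → ℝ} (hμ : 0 < μ) (hf : H1loc μ f) :
    ∀ᵐ y, y ∈ interv μ → DifferentiableAt ℝ f y := by
  refine ae_interv_of_ae_Icc hμ fun c hc => ?_
  have hc' := Ioo_subset_interv hμ hc
  have h1 := (hf (-c) (neg_mem_interv hc') c hc' (by linarith [hc.1])).1.ae_differentiableAt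
  rwa [uIcc_of_le (by linarith [hc.1])] at h1

lemma H1loc.continuousOn {f : ℝ → ℝ} (hμ : 0 < μ) (hf : H1loc μ f) : ContinuousOn f (interv μ) := by
  intro y hy
  have habs : |y| < 1 / μ := abs_lt.2 hy
  obtain ⟨c, hc1, hc2⟩ := exists_between habs
  have hc0 : 0 < c := (abs_nonneg y).trans_lt hc1
  have hc' := Ioo_subset_interv hμ ⟨hc0, hc2⟩
  have h1 := (hf (-c) (neg_mem_interv hc') c hc' (by linarith)).1.continuousOn
  rw [uIcc_of_le (by linarith)] at h1
  have hy' := abs_lt.1 hc1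
  exact (h1.continuousAt (Icc_mem_nhds hy'.1 hy'.2)).continuousWithinAt

lemma H1loc_of_symm {f : ℝ → ℝ}
    (h : ∀ c ∈ Ioo 0 (1 / μ), AbsolutelyContinuousOnInterval f (-c) c ∧
      MemLp (deriv f) 2 (volume.restrict (Icc (-c) c))) : H1loc μ f := by
  intro a ha b hb hab
  have hmax : max |a| |b| < 1 / μ := max_lt (abs_lt.2 ha) (abs_lt.2 hb)
  obtain ⟨c, hc1, hc2⟩ := exists_between hmax
  have hc0 : 0 < c := ((abs_nonneg a).trans (le_max_left _ _)).trans_lt hc1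
  have hac := abs_lt.1 ((le_max_left _ _).trans_lt hc1)
  have hbc := abs_lt.1 ((le_max_right _ _).trans_lt hc1)
  have hsub : Icc a b ⊆ Icc (-c) c := Icc_subset_Icc hac.1.le hbc.2.le
  obtain ⟨h1, h2⟩ := h c ⟨hc0, hc2⟩
  refine ⟨h1.mono ?_, h2.mono_measure (Measure.restrict_mono_set _ hsub)⟩
  rwa [uIcc_of_le hab, uIcc_of_le (by linarith)]

lemma H1loc_of_contDiff {f : ℝ → ℝ} (hf : ContDiff ℝ 1 f) : H1loc μ f := by
  intro a _ b _ hab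
  refine ⟨hf.contDiffOn.absolutelyContinuousOnInterval, ?_⟩
  have hd : Continuous (deriv f) := hf.continuous_deriv le_rfl
  obtain ⟨C, hC⟩ := isCompact_Icc.exists_bound_of_continuousOn (hd.continuousOn (s := Icc a b))
  refine MemLp.of_bound hd.aestronglyMeasurable C ?_
  rw [ae_restrict_iff' measurableSet_Icc]
  exact Eventually.of_forall hC

lemma lintegral_interv_of_even {f : ℝ → ℝ≥0∞} (hμ : 0 < μ)
    (hf : ∀ y ∈ Ioo 0 (1 / μ), f (-y) = f y) :
    ∫⁻ y in interv μ, f y = 2 * ∫⁻ y in Ioo 0 (1 / μ), f y := by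
  have hR : 0 < 1 / μ := by positivity
  have hneg : ∫⁻ y in Ioo (-(1 / μ)) 0, f y = ∫⁻ y in Ioo 0 (1 / μ), f y := by
    have h1 := (Measure.measurePreserving_neg (volume : Measure ℝ)).setLIntegral_comp_preimage_emb
      (Homeomorph.neg ℝ).measurableEmbedding f (Ioo (-(1 / μ)) 0)
    rw [← h1]
    have h2 : (Neg.neg ⁻¹' Ioo (-(1 / μ)) 0 : Set ℝ) = Ioo 0 (1 / μ) := by
      ext y; simp only [mem_preimage, mem_Ioo]; constructor <;> rintro ⟨h3, h4⟩ <;>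
        constructor <;> linarith
    rw [h2]
    exact setLIntegral_congr_fun measurableSet_Ioo hf
  have hsplit : interv μ = Ioo (-(1 / μ)) 0 ∪ Ico 0 (1 / μ) := by
    rw [interv_eq, Ioo_union_Ico_eq_Ioo (by linarith) hR.le]
  rw [hsplit, lintegral_union measurableSet_Ico, hneg,
    setLIntegral_congr (Ioo_ae_eq_Ico (μ := volume)).symm, two_mul]
  exact disjoint_left.2 fun y h1 h2 => absurd h1.2 (not_lt.2 h2.1)

end Interval

/-! ### The phase of a circle-valued state. -/

/-- The energy density of the state with phase `w`. -/
noncomputable def phaseDensity (μ : ℝ) (w : ℝ → ℝ) (y : ℝ) : ℝ :=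
  wt μ y * deriv w y ^ 2 + 1 / 4 * wt μ y ^ 2 * Real.cos (2 * w y) ^ 2

/-- The energy on the half interval in terms of the phase. -/
noncomputable def halfEnergy (μ : ℝ) (w : ℝ → ℝ) : ℝ≥0∞ :=
  ∫⁻ y in Ioo 0 (1 / μ), ENNReal.ofReal (phaseDensity μ w y)

/-- `Θ = κ (cos w + sin w, cos w - sin w)` on `𝓘_μ`, with `κ = ±1/√2`. -/
structure HasPhase (μ κ : ℝ) (w : ℝ → ℝ) (Θ : State) : Prop where
  sq : κ ^ 2 = 1 / 2
  fst : ∀ y ∈ interv μ, Θ.1 y = κ * (Real.cos (w y) + Real.sin (w y))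
  snd : ∀ y ∈ interv μ, Θ.2 y = κ * (Real.cos (w y) - Real.sin (w y))

/-- The state with phase `w`. -/
noncomputable def phaseState (κ : ℝ) (w : ℝ → ℝ) : State :=
  (fun y => κ * (Real.cos (w y) + Real.sin (w y)), fun y => κ * (Real.cos (w y) - Real.sin (w y)))

section Phase

variable {μ κ : ℝ} {w : ℝ → ℝ} {Θ : State}

lemma hasPhase_phaseState (hκ : κ ^ 2 = 1 / 2) : HasPhase μ κ w (phaseState κ w) :=
  ⟨hκ, fun _ _ => rfl, fun _ _ => rfl⟩

lemma HasPhase.sq_add_sq (h : HasPhase μ κ w Θ) {y : ℝ} (hy : y ∈ interv μ) :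
    Θ.1 y ^ 2 + Θ.2 y ^ 2 = 1 := by
  rw [h.fst y hy, h.snd y hy]
  have := Real.sin_sq_add_cos_sq (w y)
  calc _ = 2 * κ ^ 2 * (Real.sin (w y) ^ 2 + Real.cos (w y) ^ 2) := by ring
    _ = 1 := by rw [this, h.sq]; norm_num

lemma HasPhase.hasDerivAt (h : HasPhase μ κ w Θ) {y : ℝ} (hy : y ∈ interv μ)
    (hw : DifferentiableAt ℝ w y) :
    HasDerivAt Θ.1 (κ * (Real.cos (w y) - Real.sin (w y)) * deriv w y) y ∧
    HasDerivAt Θ.2 (-(κ * (Real.cos (w y) + Real.sin (w y)) * deriv w y)) y := by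
  have hd := hw.hasDerivAt
  constructor
  · have h1 : HasDerivAt (fun y => κ * (Real.cos (w y) + Real.sin (w y)))
        (κ * (Real.cos (w y) - Real.sin (w y)) * deriv w y) y :=
      ((hd.cos.add hd.sin).const_mul κ).congr_deriv (by ring)
    refine h1.congr_of_eventuallyEq ?_
    filter_upwards [(isOpen_interv μ).mem_nhds hy] with t ht using h.fst t ht
  · have h1 : HasDerivAt (fun y => κ * (Real.cos (w y) - Real.sin (w y)))
        (-(κ * (Real.cos (w y) + Real.sin (w y)) * deriv w y)) y :=
      ((hd.cos.sub hd.sin).const_mul κ).congr_deriv (by ring)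
    refine h1.congr_of_eventuallyEq ?_
    filter_upwards [(isOpen_interv μ).mem_nhds hy] with t ht using h.snd t ht

lemma HasPhase.density_eq (hμ : 0 < μ) (h : HasPhase μ κ w Θ) {y : ℝ} (hy : y ∈ interv μ)
    (hw : DifferentiableAt ℝ w y) :
    eta0 (μ * y) ^ 2 * deriv Θ.1 y ^ 2 + eta0 (μ * y) ^ 2 * deriv Θ.2 y ^ 2
      + eta0 (μ * y) ^ 4 * (Θ.1 y ^ 2 * Θ.2 y ^ 2) = phaseDensity μ w y := by
  obtain ⟨h1, h2⟩ := h.hasDerivAt hy hw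
  rw [h1.deriv, h2.deriv, h.fst y hy, h.snd y hy, eta0_sq hμ hy, eta0_pow_four hμ hy, phaseDensity]
  have hs : Real.sin (w y) ^ 2 = 1 - Real.cos (w y) ^ 2 := Real.sin_sq _
  rw [Real.cos_two_mul]
  have e1 : (κ * (Real.cos (w y) - Real.sin (w y)) * deriv w y) ^ 2
      + (-(κ * (Real.cos (w y) + Real.sin (w y)) * deriv w y)) ^ 2 = deriv w y ^ 2 := by
    calc _ = 2 * κ ^ 2 * (Real.cos (w y) ^ 2 + Real.sin (w y) ^ 2) * deriv w y ^ 2 := by ring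
      _ = _ := by rw [Real.cos_sq_add_sin_sq, h.sq]; ring
  have e2 : (κ * (Real.cos (w y) + Real.sin (w y))) ^ 2 * (κ * (Real.cos (w y) - Real.sin (w y))) ^ 2
      = 1 / 4 * (2 * Real.cos (w y) ^ 2 - 1) ^ 2 := by
    calc _ = (κ ^ 2) ^ 2 * (Real.cos (w y) ^ 2 - Real.sin (w y) ^ 2) ^ 2 := by ring
      _ = _ := by rw [hs, h.sq]; ring
  rw [e2, ← e1]; ring

lemma HasPhase.energy_eq (hμ : 0 < μ) (h : HasPhase μ κ w Θ)
    (hw : ∀ᵐ y, y ∈ interv μ → DifferentiableAt ℝ w y) :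
    energy μ Θ = 1 / 2 * ∫⁻ y in interv μ, ENNReal.ofReal (phaseDensity μ w y) := by
  rw [energy, if_pos fun y hy => h.sq_add_sq hy]
  congr 1
  refine setLIntegral_congr_fun_ae (measurableSet_interv μ) ?_
  filter_upwards [hw] with y hy hyI
  rw [h.density_eq hμ hyI (hy hyI)]

lemma deriv_neg_of_odd (hodd : ∀ y ∈ interv μ, w (-y) = -w y) {y : ℝ} (hy : y ∈ interv μ) :
    deriv w (-y) = deriv w y := by
  have h1 : deriv (fun t => w (-t)) y = deriv (fun t => -w t) y := by
    refine EventuallyEq.deriv_eq ?_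
    filter_upwards [(isOpen_interv μ).mem_nhds hy] with t ht using hodd t ht
  rw [deriv_comp_neg, deriv.fun_neg] at h1
  linarith

lemma phaseDensity_neg (hodd : ∀ y ∈ interv μ, w (-y) = -w y) {y : ℝ} (hy : y ∈ interv μ) :
    phaseDensity μ w (-y) = phaseDensity μ w y := by
  rw [phaseDensity, phaseDensity, deriv_neg_of_odd hodd hy, hodd y hy, wt_neg, mul_neg, Real.cos_neg]

/-- For an odd phase the density is even, so the prefactor 1/2 of the energy cancels the doubling of
the half interval. -/
lemma HasPhase.energy_eq_halfEnergy (hμ : 0 < μ) (h : HasPhase μ κ w Θ)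
    (hw : ∀ᵐ y, y ∈ interv μ → DifferentiableAt ℝ w y) (hodd : ∀ y ∈ interv μ, w (-y) = -w y) :
    energy μ Θ = halfEnergy μ w := by
  rw [h.energy_eq hμ hw, lintegral_interv_of_even hμ fun y hy => by
    rw [phaseDensity_neg hodd (Ioo_subset_interv hμ hy)], ← mul_assoc, one_div,
    ENNReal.inv_mul_cancel (by norm_num) (by norm_num), one_mul, halfEnergy]

lemma phaseDensity_nonneg (hμ : 0 < μ) {y : ℝ} (hy : y ∈ interv μ) : 0 ≤ phaseDensity μ w y := by
  have := wt_pos hμ hy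
  unfold phaseDensity; positivity

lemma halfEnergy_lt_top (hμ : 0 < μ) {C : ℝ} (hC : ∀ y ∈ Ioo 0 (1 / μ), |deriv w y| ≤ C) :
    halfEnergy μ w < ⊤ := by
  refine (setLIntegral_mono_ae' (g := fun _ => ENNReal.ofReal (C ^ 2 + 1 / 4)) measurableSet_Ioo
    (Eventually.of_forall fun y hy => ?_)).trans_lt ?_
  · refine ENNReal.ofReal_le_ofReal ?_
    have hp := wt_pos hμ (Ioo_subset_interv hμ hy)
    have hp1 := wt_le_one μ y
    have h1 : deriv w y ^ 2 ≤ C ^ 2 := by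
      rw [← sq_abs]
      exact pow_le_pow_left₀ (abs_nonneg _) (hC y hy) 2
    have h2 : Real.cos (2 * w y) ^ 2 ≤ 1 := Real.cos_sq_le_one _
    have h3 : wt μ y ^ 2 ≤ 1 := by nlinarith
    calc phaseDensity μ w y ≤ 1 * C ^ 2 + 1 / 4 * 1 * 1 := by unfold phaseDensity; gcongr
      _ = _ := by ring
  · rw [setLIntegral_const, Real.volume_Ioo]
    exact ENNReal.mul_lt_top ENNReal.ofReal_lt_top ENNReal.ofReal_lt_top

lemma phaseState_mem_symmSpace (hμ : 0 < μ) (hκ : κ ^ 2 = 1 / 2) (hw : ContDiff ℝ 1 w)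
    (hodd : ∀ y, w (-y) = -w y) : phaseState κ w ∈ symmSpace μ := by
  have hc := Real.contDiff_cos (n := 1) |>.comp hw
  have hs := Real.contDiff_sin (n := 1) |>.comp hw
  refine ⟨H1loc_of_contDiff (contDiff_const.mul (hc.add hs)),
    H1loc_of_contDiff (contDiff_const.mul (hc.sub hs)), fun y _ => ?_, ?_⟩
  · simp only [phaseState, hodd, Real.cos_neg, Real.sin_neg]; ring
  · rw [(hasPhase_phaseState hκ).energy_eq_halfEnergy hμ
      (Eventually.of_forall fun y _ => hw.differentiable one_ne_zero y) fun y _ => hodd y]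
    obtain ⟨C, hC⟩ := isCompact_Icc.exists_bound_of_continuousOn
      ((hw.continuous_deriv le_rfl).continuousOn (s := Icc 0 (1 / μ)))
    exact halfEnergy_lt_top hμ fun y hy => hC y (Ioo_subset_Icc_self hy)

/-- Every state of the energy space has an odd phase of class `H¹_loc`. -/
theorem exists_phase (hμ : 0 < μ) (hΘ : Θ ∈ symmSpace μ) :
    ∃ κ w, HasPhase μ κ w Θ ∧ H1loc μ w ∧ ∀ y ∈ interv μ, w (-y) = -w y := by
  obtain ⟨hH1, hH2, hsymm, hfin⟩ := hΘ
  have hone : ∀ y ∈ interv μ, Θ.1 y ^ 2 + Θ.2 y ^ 2 = 1 := by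
    by_contra hcon
    rw [energy, if_neg hcon] at hfin
    exact lt_irrefl _ hfin
  have hsymm' : ∀ y ∈ interv μ, Θ.2 y = Θ.1 (-y) := fun y hy => by
    rw [hsymm _ (neg_mem_interv hy), neg_neg]
  have hd1 : ∀ y ∈ interv μ, deriv Θ.1 (-y) = -deriv Θ.2 y := by
    intro y hy
    have h1 : deriv Θ.2 y = deriv (fun t => Θ.1 (-t)) y := by
      refine EventuallyEq.deriv_eq ?_
      filter_upwards [(isOpen_interv μ).mem_nhds hy] with t ht using hsymm' t ht
    rw [h1, deriv_comp_neg, neg_neg]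
  have hd2 : ∀ y ∈ interv μ, deriv Θ.2 (-y) = -deriv Θ.1 y := by
    intro y hy
    rw [← neg_eq_iff_eq_neg, ← hd1 _ (neg_mem_interv hy), neg_neg]
  -- The angular velocity of the state. With w its primitive vanishing at 0, the symmetry makes ρ
  -- even and w odd.
  set ρ : ℝ → ℝ := fun y => deriv Θ.1 y * Θ.2 y - deriv Θ.2 y * Θ.1 y with hρ
  have hρeven : ∀ y ∈ interv μ, ρ (-y) = ρ y := by
    intro y hy
    simp only [hρ]
    rw [hd1 y hy, hd2 y hy, ← hsymm' y hy, ← hsymm y hy]; ring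
  set w : ℝ → ℝ := fun y => ∫ t in (0 : ℝ)..y, ρ t with hw
  have hle1 : ∀ y ∈ interv μ, |Θ.1 y| ≤ 1 ∧ |Θ.2 y| ≤ 1 := by
    intro y hy
    have := hone y hy
    constructor <;> rw [← sq_le_one_iff_abs_le_one] <;> nlinarith [sq_nonneg (Θ.1 y), sq_nonneg (Θ.2 y)]
  have hcompact : ∀ c ∈ Ioo 0 (1 / μ), IntervalIntegrable ρ volume (-c) c ∧
      MemLp ρ 2 (volume.restrict (Icc (-c) c)) := by
    intro c hc
    have hc' := Ioo_subset_interv hμ hc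
    have hcc : -c ≤ c := by linarith [hc.1]
    obtain ⟨ha1, hm1⟩ := hH1 _ (neg_mem_interv hc') _ hc' hcc
    obtain ⟨ha2, hm2⟩ := hH2 _ (neg_mem_interv hc') _ hc' hcc
    have hsub := Icc_subset_interv (neg_mem_interv hc') hc'
    have hL : ∀ f g : ℝ → ℝ, MemLp (deriv f) 2 (volume.restrict (Icc (-c) c)) →
        ContinuousOn g (Icc (-c) c) → (∀ y ∈ Icc (-c) c, |g y| ≤ 1) →
        MemLp (fun y => deriv f y * g y) 2 (volume.restrict (Icc (-c) c)) := by
      intro f g hf hg hg1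
      refine hf.of_le_mul (c := 1)
        (hf.aestronglyMeasurable.mul (hg.aestronglyMeasurable measurableSet_Icc)) ?_
      rw [ae_restrict_iff' measurableSet_Icc]
      refine Eventually.of_forall fun y hy => ?_
      rw [norm_mul, mul_comm]
      gcongr
      exact hg1 y hy
    have hcont1 := ha1.continuousOn
    have hcont2 := ha2.continuousOn
    rw [uIcc_of_le hcc] at hcont1 hcont2
    have hM : MemLp ρ 2 (volume.restrict (Icc (-c) c)) :=
      (hL _ _ hm1 hcont2 fun y hy => (hle1 y (hsub hy)).2).sub
        (hL _ _ hm2 hcont1 fun y hy => (hle1 y (hsub hy)).1)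
    refine ⟨?_, hM⟩
    rw [intervalIntegrable_iff_integrableOn_Icc_of_le hcc]
    exact hM.integrable (by norm_num)
  have hacw : ∀ c ∈ Ioo 0 (1 / μ), AbsolutelyContinuousOnInterval w (-c) c := fun c hc =>
    (hcompact c hc).1.absolutelyContinuousOnInterval_intervalIntegral
      (by rw [uIcc_of_le (by linarith [hc.1])]; exact ⟨by linarith [hc.1], hc.1.le⟩)
  have hdw : ∀ c ∈ Ioo 0 (1 / μ), ∀ᵐ y, y ∈ Icc (-c) c → HasDerivAt w (ρ y) y := by
    intro c hc
    have hcc : -c ≤ c := by linarith [hc.1]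
    filter_upwards [(hcompact c hc).1.ae_hasDerivAt_integral] with y hy hyc
    rw [uIcc_of_le hcc] at hy
    exact hy hyc 0 ⟨by linarith [hc.1], hc.1.le⟩
  have hH1w : H1loc μ w := by
    refine H1loc_of_symm fun c hc => ⟨hacw c hc, (hcompact c hc).2.ae_eq ?_⟩
    rw [Filter.EventuallyEq, ae_restrict_iff' measurableSet_Icc]
    filter_upwards [hdw c hc] with y hy hyc using (hy hyc).deriv.symm
  have hodd : ∀ y ∈ interv μ, w (-y) = -w y := by
    intro y hy
    simp only [hw]
    rw [← neg_zero, ← intervalIntegral.integral_comp_neg, neg_zero,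
      intervalIntegral.integral_symm, neg_inj]
    refine intervalIntegral.integral_congr fun t ht => ?_
    exact hρeven t ((ordConnected_Ioo (a := -(1 / μ)) (b := 1 / μ)).uIcc_subset
      (zero_mem_interv hμ) hy ht)
  have hw0 : w 0 = 0 := by simp [hw]
  have h00 : Θ.2 0 = Θ.1 0 := by simpa using hsymm' 0 (zero_mem_interv hμ)
  have hκ : Θ.1 0 ^ 2 = 1 / 2 := by
    have := hone 0 (zero_mem_interv hμ)
    rw [h00] at this; linarith
  have horth : ∀ y ∈ interv μ, DifferentiableAt ℝ Θ.1 y → DifferentiableAt ℝ Θ.2 y →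
      Θ.1 y * deriv Θ.1 y + Θ.2 y * deriv Θ.2 y = 0 := by
    intro y hy h1 h2
    have h3 := ((h1.hasDerivAt.pow 2).add (h2.hasDerivAt.pow 2))
    have h4 : HasDerivAt (Θ.1 ^ 2 + Θ.2 ^ 2) 0 y := by
      refine (hasDerivAt_const y (1 : ℝ)).congr_of_eventuallyEq ?_
      filter_upwards [(isOpen_interv μ).mem_nhds hy] with t ht using hone t ht
    have h5 := h3.unique h4
    simp at h5
    linarith
  -- Rotating the state back by the angle w gives an absolutely continuous curve with almost
  -- everywhere vanishing derivative. Hence it is constant, equal to the value at 0, where the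
  -- symmetry makes both components equal to κ.
  have hconst : ∀ y ∈ interv μ,
      Θ.1 y * Real.cos (w y) - Θ.2 y * Real.sin (w y) = Θ.1 0 ∧
      Θ.2 y * Real.cos (w y) + Θ.1 y * Real.sin (w y) = Θ.1 0 := by
    intro y hy
    have habs : |y| < 1 / μ := abs_lt.2 hy
    obtain ⟨c, hc1, hc2⟩ := exists_between habs
    have hc0 : 0 < c := (abs_nonneg y).trans_lt hc1
    have hc : c ∈ Ioo 0 (1 / μ) := ⟨hc0, hc2⟩
    have hc' := Ioo_subset_interv hμ hc
    have hcc : -c ≤ c := by linarith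
    have hsub := Icc_subset_interv (neg_mem_interv hc') hc'
    have ha1 := (hH1 _ (neg_mem_interv hc') _ hc' hcc).1
    have ha2 := (hH2 _ (neg_mem_interv hc') _ hc' hcc).1
    have hcos := absolutelyContinuousOnInterval_lipschitz_comp Real.lipschitzWith_cos (hacw c hc)
    have hsin := absolutelyContinuousOnInterval_lipschitz_comp Real.lipschitzWith_sin (hacw c hc)
    have hyc : y ∈ uIcc (-c) c := by
      rw [uIcc_of_le hcc]; exact ⟨(abs_lt.1 hc1).1.le, (abs_lt.1 hc1).2.le⟩
    have h0c : (0 : ℝ) ∈ uIcc (-c) c := by rw [uIcc_of_le hcc]; exact ⟨by linarith, hc0.le⟩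
    have hderiv : ∀ᵐ t, t ∈ uIcc (-c) c →
        HasDerivAt (fun t => Θ.1 t * Real.cos (w t) - Θ.2 t * Real.sin (w t)) 0 t ∧
        HasDerivAt (fun t => Θ.2 t * Real.cos (w t) + Θ.1 t * Real.sin (w t)) 0 t := by
      filter_upwards [ha1.ae_differentiableAt, ha2.ae_differentiableAt, hdw c hc] with t h1 h2 h3 ht
      have hd1 := (h1 ht).hasDerivAt
      have hd2 := (h2 ht).hasDerivAt
      rw [uIcc_of_le hcc] at ht
      have hd3 := h3 ht
      have ho := horth t (hsub ht) hd1.differentiableAt hd2.differentiableAt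
      have hn := hone t (hsub ht)
      -- Differentiating θ₁² + θ₂² = 1 shows that the velocity is orthogonal to the state, so it is
      -- recovered from ρ alone.
      have e1 : deriv Θ.1 t = Θ.2 t * ρ t := by
        simp only [hρ]; linear_combination Θ.1 t * ho - deriv Θ.1 t * hn
      have e2 : deriv Θ.2 t = -(Θ.1 t * ρ t) := by
        simp only [hρ]; linear_combination Θ.2 t * ho - deriv Θ.2 t * hn
      rw [e1] at hd1
      rw [e2] at hd2
      exact ⟨((hd1.mul hd3.cos).sub (hd2.mul hd3.sin)).congr_deriv (by ring),
        ((hd2.mul hd3.cos).add (hd1.mul hd3.sin)).congr_deriv (by ring)⟩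
    obtain ⟨A, hA⟩ := ((ha1.fun_mul hcos).fun_sub (ha2.fun_mul hsin)).const_of_ae_hasDerivAt_zero
      (hderiv.mono fun t ht htc => (ht htc).1)
    obtain ⟨B, hB⟩ := ((ha2.fun_mul hcos).fun_add (ha1.fun_mul hsin)).const_of_ae_hasDerivAt_zero
      (hderiv.mono fun t ht htc => (ht htc).2)
    refine ⟨(hA y hyc).trans ((hA 0 h0c).symm.trans ?_), (hB y hyc).trans ((hB 0 h0c).symm.trans ?_)⟩
    · simp [hw0]
    · simp [hw0, h00]
  refine ⟨Θ.1 0, w, ⟨hκ, fun y hy => ?_, fun y hy => ?_⟩, hH1w, hodd⟩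
  · obtain ⟨h1, h2⟩ := hconst y hy
    have := Real.sin_sq_add_cos_sq (w y)
    linear_combination Real.cos (w y) * h1 + Real.sin (w y) * h2 - Θ.1 y * this
  · obtain ⟨h1, h2⟩ := hconst y hy
    have := Real.sin_sq_add_cos_sq (w y)
    linear_combination Real.cos (w y) * h2 - Real.sin (w y) * h1 - Θ.2 y * this

end Phase

end DomainWall

/-! ### The first variation in terms of the phase. -/

namespace DomainWall

/-- The first variation of the energy at the phase `v` in the direction `φ`. -/
noncomputable def firstVariation (μ : ℝ) (v φ : ℝ → ℝ) : ℝ :=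
  ∫ y in interv μ, (wt μ y * deriv v y * deriv φ y - 1 / 4 * wt μ y ^ 2 * Real.sin (4 * v y) * φ y)

section FirstVariation

variable {μ κ : ℝ} {v φ : ℝ → ℝ} {Θ : State}

lemma HasPhase.rotate (h : HasPhase μ κ v Θ) (ψ : ℝ → ℝ) :
    HasPhase μ κ (fun y => v y + ψ y) (rotate ψ Θ) := by
  refine ⟨h.sq, fun y hy => ?_, fun y hy => ?_⟩
  · simp only [DomainWall.rotate, h.fst y hy, h.snd y hy, Real.cos_add, Real.sin_add]; ring
  · simp only [DomainWall.rotate, h.fst y hy, h.snd y hy, Real.cos_add, Real.sin_add]; ring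

lemma aestronglyMeasurable_phaseDensity (hv : ContinuousOn v (interv μ)) :
    AEStronglyMeasurable (phaseDensity μ v) (volume.restrict (interv μ)) := by
  have hw := (continuous_wt μ).aestronglyMeasurable (μ := volume.restrict (interv μ))
  have hd := (measurable_deriv v).aestronglyMeasurable (μ := volume.restrict (interv μ))
  have hc : AEStronglyMeasurable (fun y => Real.cos (2 * v y)) (volume.restrict (interv μ)) :=
    (Real.continuous_cos.comp_continuousOn (continuousOn_const.mul hv)).aestronglyMeasurable
      (measurableSet_interv μ)
  exact (hw.mul (hd.pow 2)).add (((hw.pow 2).const_mul (1 / 4)).mul (hc.pow 2))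

lemma phaseDensity_nonneg_ae (hμ : 0 < μ) (v : ℝ → ℝ) :
    0 ≤ᵐ[volume.restrict (interv μ)] phaseDensity μ v := by
  rw [Filter.EventuallyLE, ae_restrict_iff' (measurableSet_interv μ)]
  exact Eventually.of_forall fun y hy => phaseDensity_nonneg hμ hy

lemma HasPhase.toReal_energy (hμ : 0 < μ) (h : HasPhase μ κ v Θ) (hv : ContinuousOn v (interv μ))
    (hd : ∀ᵐ y, y ∈ interv μ → DifferentiableAt ℝ v y) :
    (energy μ Θ).toReal = 1 / 2 * ∫ y in interv μ, phaseDensity μ v y := by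
  rw [h.energy_eq hμ hd, integral_eq_lintegral_of_nonneg_ae (phaseDensity_nonneg_ae hμ v)
    (aestronglyMeasurable_phaseDensity hv), ENNReal.toReal_mul]
  simp

lemma HasPhase.integrableOn_phaseDensity (hμ : 0 < μ) (h : HasPhase μ κ v Θ)
    (hv : ContinuousOn v (interv μ)) (hd : ∀ᵐ y, y ∈ interv μ → DifferentiableAt ℝ v y)
    (hfin : energy μ Θ < ⊤) : IntegrableOn (phaseDensity μ v) (interv μ) := by
  refine ⟨aestronglyMeasurable_phaseDensity hv, ?_⟩
  rw [hasFiniteIntegral_iff_ofReal (phaseDensity_nonneg_ae hμ v)]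
  rw [h.energy_eq hμ hd] at hfin
  refine lt_top_iff_ne_top.2 fun htop => ?_
  rw [htop, ENNReal.mul_top (by simp)] at hfin
  exact lt_irrefl _ hfin

lemma integrableOn_wt_mul_deriv_sq (hμ : 0 < μ)
    (hi : IntegrableOn (phaseDensity μ v) (interv μ)) :
    IntegrableOn (fun y => wt μ y * deriv v y ^ 2) (interv μ) := by
  refine hi.mono' ?_ ?_
  · exact (continuous_wt μ).aestronglyMeasurable.mul
      ((measurable_deriv v).aestronglyMeasurable.pow 2)
  · rw [ae_restrict_iff' (measurableSet_interv μ)]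
    refine Eventually.of_forall fun y hy => ?_
    have := wt_pos hμ hy
    rw [Real.norm_of_nonneg (by positivity), phaseDensity]
    have : 0 ≤ 1 / 4 * wt μ y ^ 2 * Real.cos (2 * v y) ^ 2 := by positivity
    linarith

/-- A rotation by tφ shifts the phase by tφ, so the energy along the variation is an explicit
integral, differentiated under the integral sign. The prefactor 1/2 of the energy absorbs the factor
2 in F'. -/
lemma hasDerivAt_energy_rotate (hμ : 0 < μ) (h : HasPhase μ κ v Θ) (hv : H1loc μ v)
    (hfin : energy μ Θ < ⊤) (hφ : ContDiff ℝ ∞ φ) :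
    HasDerivAt (fun t : ℝ => (energy μ (rotate (fun y => t * φ y) Θ)).toReal)
      (firstVariation μ v φ) 0 := by
  have hvc := hv.continuousOn hμ
  have hvd := hv.ae_differentiableAt hμ
  have hφd : Differentiable ℝ φ := hφ.differentiable (by simp)
  have hφ1 : Continuous (deriv φ) := hφ.continuous_deriv (by simp)
  set F : ℝ → ℝ → ℝ := fun t y => wt μ y * (deriv v y + t * deriv φ y) ^ 2
    + 1 / 4 * wt μ y ^ 2 * Real.cos (2 * (v y + t * φ y)) ^ 2 with hF
  set F' : ℝ → ℝ → ℝ := fun t y => 2 * (wt μ y * (deriv v y + t * deriv φ y) * deriv φ y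
    - 1 / 4 * wt μ y ^ 2 * Real.sin (4 * (v y + t * φ y)) * φ y) with hF'
  have hFE : ∀ t, (energy μ (rotate (fun y => t * φ y) Θ)).toReal
      = 1 / 2 * ∫ y in interv μ, F t y := by
    intro t
    have hd' : ∀ᵐ y, y ∈ interv μ → DifferentiableAt ℝ (fun y => v y + t * φ y) y :=
      hvd.mono fun y hy hyI => (hy hyI).add ((hφd y).const_mul t)
    rw [(h.rotate fun y => t * φ y).toReal_energy hμ (hvc.add (continuousOn_const.mul hφ.continuous.continuousOn)) hd']
    congr 1
    refine setIntegral_congr_ae (measurableSet_interv μ) ?_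
    filter_upwards [hvd] with y hy hyI
    have : deriv (fun y => v y + t * φ y) y = deriv v y + t * deriv φ y :=
      ((hy hyI).hasDerivAt.add ((hφd y).hasDerivAt.const_mul t)).deriv
    rw [phaseDensity, this]
  have hmw := (continuous_wt μ).aestronglyMeasurable (μ := volume.restrict (interv μ))
  have hmd := (measurable_deriv v).aestronglyMeasurable (μ := volume.restrict (interv μ))
  have hmφ := hφ.continuous.aestronglyMeasurable (μ := volume.restrict (interv μ))
  have hmφ1 := hφ1.aestronglyMeasurable (μ := volume.restrict (interv μ))
  have hmv := hvc.aestronglyMeasurable (measurableSet_interv μ) (μ := volume)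
  have hmF : ∀ t, AEStronglyMeasurable (F t) (volume.restrict (interv μ)) := fun t =>
    (hmw.mul ((hmd.add (hmφ1.const_mul t)).pow 2)).add (((hmw.pow 2).const_mul (1 / 4)).mul
      ((Real.continuous_cos.comp_aestronglyMeasurable
        ((hmv.add (hmφ.const_mul t)).const_mul 2)).pow 2))
  have hmF' : AEStronglyMeasurable (F' 0) (volume.restrict (interv μ)) :=
    (((hmw.mul (hmd.add (hmφ1.const_mul 0))).mul hmφ1).sub ((((hmw.pow 2).const_mul (1 / 4)).mul
      (Real.continuous_sin.comp_aestronglyMeasurable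
        ((hmv.add (hmφ.const_mul 0)).const_mul 4))).mul hmφ)).const_mul 2
  have hdens := h.integrableOn_phaseDensity hμ hvc hvd hfin
  have hF0 : F 0 = phaseDensity μ v := by
    funext y; simp [hF, phaseDensity]
  obtain ⟨C₁, hC₁⟩ := isCompact_Icc.exists_bound_of_continuousOn
    (hφ1.continuousOn (s := Icc (-(1 / μ)) (1 / μ)))
  obtain ⟨C₂, hC₂⟩ := isCompact_Icc.exists_bound_of_continuousOn
    (hφ.continuous.continuousOn (s := Icc (-(1 / μ)) (1 / μ)))
  have hvol : volume (interv μ) ≠ ⊤ := by simp [interv_eq]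
  -- A majorant of |F'| for |t| < 1: the cross term 2|v'| C₁ is at most v'² + C₁², and v'² with the
  -- weight is integrable by finiteness of the energy. The constants C₁ and C₂ bound φ' and φ.
  have hbi : Integrable (fun y => wt μ y * deriv v y ^ 2 + (3 * C₁ ^ 2 + 1 / 2 * C₂))
      (volume.restrict (interv μ)) :=
    (integrableOn_wt_mul_deriv_sq hμ hdens).add (integrableOn_const hvol)
  have key := (hasDerivAt_integral_of_dominated_loc_of_deriv_le (μ := volume.restrict (interv μ))
    (F := F) (F' := F') (x₀ := 0) (s := Metric.ball 0 1) (Metric.ball_mem_nhds _ one_pos)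
    (Eventually.of_forall hmF) (by rw [hF0]; exact hdens) hmF' ?_ hbi ?_).2
  · simp_rw [hFE]
    refine (key.const_mul (1 / 2)).congr_deriv ?_
    rw [firstVariation, ← integral_const_mul]
    refine integral_congr_ae (Eventually.of_forall fun y => ?_)
    simp only [hF']
    ring_nf
  · rw [ae_restrict_iff' (measurableSet_interv μ)]
    refine Eventually.of_forall fun y hy t ht => ?_
    have ht1 : |t| < 1 := by simpa using ht
    have hp := wt_pos hμ hy
    have hp1 := wt_le_one μ y
    have hp2 : wt μ y ^ 2 ≤ 1 := by nlinarith
    have h1 : |deriv φ y| ≤ C₁ := hC₁ y (Ioo_subset_Icc_self hy)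
    have h2 : |φ y| ≤ C₂ := hC₂ y (Ioo_subset_Icc_self hy)
    have hC₁0 : 0 ≤ C₁ := (abs_nonneg _).trans h1
    have hC₂0 : 0 ≤ C₂ := (abs_nonneg _).trans h2
    have e1 : |(deriv v y + t * deriv φ y) * deriv φ y| ≤ (|deriv v y| + 1 * C₁) * C₁ := by
      rw [abs_mul]
      have : |deriv v y + t * deriv φ y| ≤ |deriv v y| + 1 * C₁ := by
        refine (abs_add_le _ _).trans ?_
        rw [abs_mul]
        gcongr
      gcongr
    have e2 : |1 / 4 * wt μ y ^ 2 * Real.sin (4 * (v y + t * φ y)) * φ y| ≤ 1 / 4 * 1 * 1 * C₂ := by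
      rw [abs_mul, abs_mul, abs_of_nonneg (by positivity : 0 ≤ 1 / 4 * wt μ y ^ 2)]
      have := Real.abs_sin_le_one (4 * (v y + t * φ y))
      gcongr
    have e3 : |wt μ y * (deriv v y + t * deriv φ y) * deriv φ y|
        ≤ wt μ y * ((|deriv v y| + 1 * C₁) * C₁) := by
      rw [mul_assoc, abs_mul, abs_of_pos hp]
      gcongr
    have e4 : 2 * ((|deriv v y| + 1 * C₁) * C₁) ≤ deriv v y ^ 2 + 3 * C₁ ^ 2 := by
      rw [← sq_abs (deriv v y)]
      nlinarith [sq_nonneg (|deriv v y| - C₁)]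
    simp only [hF', Real.norm_eq_abs]
    rw [abs_mul, abs_two]
    have e5 := abs_sub (wt μ y * (deriv v y + t * deriv φ y) * deriv φ y)
      (1 / 4 * wt μ y ^ 2 * Real.sin (4 * (v y + t * φ y)) * φ y)
    have e6 : wt μ y * (2 * ((|deriv v y| + 1 * C₁) * C₁))
        ≤ wt μ y * (deriv v y ^ 2 + 3 * C₁ ^ 2) := by gcongr
    have e7 : wt μ y * (3 * C₁ ^ 2) ≤ 1 * (3 * C₁ ^ 2) := by gcongr
    linarith
  · refine Eventually.of_forall fun y t _ => ?_
    have hA : HasDerivAt (fun t => deriv v y + t * deriv φ y) (1 * deriv φ y) t :=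
      ((hasDerivAt_id t).mul_const (deriv φ y)).const_add (deriv v y)
    have hB : HasDerivAt (fun t => 2 * (v y + t * φ y)) (2 * (1 * φ y)) t :=
      (((hasDerivAt_id t).mul_const (φ y)).const_add (v y)).const_mul 2
    refine (((hA.pow 2).const_mul (wt μ y)).add
      ((hB.cos.pow 2).const_mul (1 / 4 * wt μ y ^ 2))).congr_deriv ?_
    simp only [hF']
    have h4 := Real.sin_two_mul (2 * (v y + t * φ y))
    rw [← mul_assoc, show (2 : ℝ) * 2 = 4 by norm_num] at h4
    rw [h4]
    push_cast
    ring

theorem isCriticalPoint_iff (hμ : 0 < μ) (h : HasPhase μ κ v Θ) (hv : H1loc μ v)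
    (hΘ : Θ ∈ symmSpace μ) :
    IsCriticalPoint μ Θ ↔ ∀ φ, IsTestAngle μ φ → firstVariation μ v φ = 0 := by
  constructor
  · intro hc φ hφ
    exact (hasDerivAt_energy_rotate hμ h hv hΘ.2.2.2 hφ.1).unique (hc.2 φ hφ)
  · intro hw
    refine ⟨hΘ, fun φ hφ => ?_⟩
    have := hasDerivAt_energy_rotate hμ h hv hΘ.2.2.2 hφ.1
    rwa [hw φ hφ] at this

end FirstVariation

end DomainWall

/-! ### The weak equation and the du Bois-Reymond lemma in the odd class. -/

namespace DomainWall

variable {μ : ℝ} {v m φ : ℝ → ℝ}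

lemma exists_subset_Ioo_of_isCompact {K : Set ℝ} (hμ : 0 < μ) (hK : IsCompact K)
    (hsub : K ⊆ interv μ) : ∃ c ∈ Ioo 0 (1 / μ), K ⊆ Ioo (-c) c := by
  have hR : 0 < 1 / μ := by positivity
  rcases K.eq_empty_or_nonempty with rfl | hne
  · exact ⟨1 / μ / 2, ⟨by positivity, by linarith⟩, empty_subset _⟩
  · obtain ⟨x, hx, hmax⟩ := hK.exists_isMaxOn hne (continuous_abs.continuousOn)
    obtain ⟨c, hc1, hc2⟩ := exists_between (abs_lt.2 (hsub hx) : |x| < 1 / μ)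
    refine ⟨c, ⟨(abs_nonneg x).trans_lt hc1, hc2⟩, fun y hy => abs_lt.1 ?_⟩
    exact (hmax hy : |y| ≤ |x|).trans_lt hc1

lemma Icc_symm_subset_interv (hμ : 0 < μ) {c : ℝ} (hc : c ∈ Ioo 0 (1 / μ)) :
    Icc (-c) c ⊆ interv μ :=
  Icc_subset_interv (neg_mem_interv (Ioo_subset_interv hμ hc)) (Ioo_subset_interv hμ hc)

lemma setIntegral_interv_eq (hμ : 0 < μ) {f : ℝ → ℝ} {c : ℝ} (hc : c ∈ Ioo 0 (1 / μ))
    (hf : ∀ y ∉ Ioo (-c) c, f y = 0) : ∫ y in interv μ, f y = ∫ y in (-c)..c, f y := by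
  rw [intervalIntegral.integral_of_le (by linarith [hc.1])]
  refine setIntegral_eq_of_subset_of_forall_sdiff_eq_zero (measurableSet_interv μ)
    (Ioc_subset_Icc_self.trans (Icc_symm_subset_interv hμ hc)) fun y hy => hf y fun h => ?_
  exact hy.2 (Ioo_subset_Ioc_self h)

lemma eq_zero_of_tsupport_subset {S : Set ℝ} (hS : tsupport φ ⊆ S) :
    ∀ y ∉ S, φ y = 0 ∧ deriv φ y = 0 := by
  intro y hy
  have : y ∉ tsupport φ := fun h => hy (hS h)
  exact ⟨image_eq_zero_of_notMem_tsupport this, deriv_of_notMem_tsupport this⟩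

lemma deriv_neg_of_odd' (hodd : ∀ y, φ (-y) = -φ y) (y : ℝ) : deriv φ (-y) = deriv φ y := by
  have h1 : (fun t => φ (-t)) = fun t => -φ t := funext hodd
  have h2 : deriv (fun t => φ (-t)) y = deriv (fun t => -φ t) y := by rw [h1]
  rw [deriv_comp_neg, deriv.fun_neg] at h2
  linarith

/-- Odd regular solutions satisfy the weak equation. -/
lemma IsProfile.firstVariation_eq_zero (hμ : 0 < μ) (h : IsProfile μ v (deriv v))
    (hv : ContDiff ℝ 1 v) (hodd : ∀ y, v (-y) = -v y) (hφ : IsTestAngle μ φ) :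
    firstVariation μ v φ = 0 := by
  obtain ⟨hφs, hφc, hφsub, hφodd⟩ := hφ
  obtain ⟨c, hc, hcsub⟩ := exists_subset_Ioo_of_isCompact hμ hφc hφsub
  have hz := eq_zero_of_tsupport_subset hcsub
  set f : ℝ → ℝ := fun y =>
    wt μ y * deriv v y * deriv φ y - 1 / 4 * wt μ y ^ 2 * Real.sin (4 * v y) * φ y with hf
  have hcw := continuous_wt μ
  have hcv' : Continuous (deriv v) := hv.continuous_deriv le_rfl
  have hcφ' : Continuous (deriv φ) := hφs.continuous_deriv (by simp)
  have hcv := hv.continuous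
  have hcφ := hφs.continuous
  have hcf : Continuous f := by fun_prop
  have hfeven : ∀ y, f (-y) = f y := by
    intro y
    simp only [hf, wt_neg, deriv_neg_of_odd' hodd, deriv_neg_of_odd' hφodd, hodd, hφodd, mul_neg,
      Real.sin_neg]
    ring
  have hfz : ∀ y ∉ Ioo (-c) c, f y = 0 := by
    intro y hy
    obtain ⟨h1, h2⟩ := hz y hy
    simp only [hf, h1, h2]; ring
  rw [firstVariation, setIntegral_interv_eq hμ hc hfz,
    ← intervalIntegral.integral_add_adjacent_intervals (hcf.intervalIntegrable (-c) 0)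
      (hcf.intervalIntegrable 0 c)]
  have h1 : ∫ y in (-c)..0, f y = ∫ y in (0 : ℝ)..c, f y := by
    have := intervalIntegral.integral_comp_neg (a := 0) (b := c) f
    rw [neg_zero] at this
    rw [← this]
    simp_rw [hfeven]
  -- On the half interval the integrand is the exact derivative of η² v' φ; it vanishes at 0 because
  -- φ is odd and at c because of the support.
  have h2 : ∫ y in (0 : ℝ)..c, f y = 0 := by
    have := intervalIntegral.integral_eq_sub_of_hasDerivAt_of_le hc.1.le
      (f := fun y => wt μ y * deriv v y * φ y) (f' := f)
      (by fun_prop) (fun y hy => ((h.hasDerivAt_flux y ⟨hy.1, hy.2.trans hc.2⟩).mul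
        (hφs.differentiable (by simp) y).hasDerivAt).congr_deriv (by simp only [hf]; ring))
      (hcf.intervalIntegrable 0 c)
    have h0 : φ 0 = 0 := by have := hφodd 0; rw [neg_zero] at this; linarith
    rw [this, h0, (hz c (by simp)).1]; ring
  rw [h1, h2, add_zero]

/-- The lemma of du Bois-Reymond for even functions tested against derivatives of odd functions. -/
lemma ae_eq_const_of_even (hμ : 0 < μ) {g : ℝ → ℝ} (hg : LocallyIntegrableOn g (interv μ))
    (heven : ∀ y ∈ interv μ, g (-y) = g y)
    (h : ∀ φ, IsTestAngle μ φ → ∫ y in interv μ, g y * deriv φ y = 0) :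
    ∃ C, ∀ᵐ y, y ∈ interv μ → g y = C := by
  have hR : 0 < 1 / μ := by positivity
  let b : ContDiffBump (0 : ℝ) := ⟨1 / μ / 4, 1 / μ / 2, by positivity, by linarith⟩
  set ρ : ℝ → ℝ := b.normed volume with hρ
  have hρs : ContDiff ℝ ∞ ρ := b.contDiff_normed
  have hρeven : ∀ y, ρ (-y) = ρ y := b.normed_neg
  have hρsub : tsupport ρ ⊆ interv μ := by
    rw [hρ, b.tsupport_normed_eq, Real.closedBall_eq_Icc, interv_eq]
    intro y hy
    have h1 : -(1 / μ / 2) ≤ y := by simpa [b] using hy.1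
    have h2 : y ≤ 1 / μ / 2 := by simpa [b] using hy.2
    exact ⟨by linarith, by linarith⟩
  have hint : ∀ c ∈ Ioo 0 (1 / μ), ∀ ψ : ℝ → ℝ, Continuous ψ →
      IntervalIntegrable (fun y => g y * ψ y) volume (-c) c := by
    intro c hc ψ hψ
    rw [intervalIntegrable_iff_integrableOn_Icc_of_le (by linarith [hc.1])]
    exact (hg.integrableOn_compact_subset (Icc_symm_subset_interv hμ hc) isCompact_Icc).mul_continuousOn
      hψ.continuousOn isCompact_Icc
  refine ⟨∫ y in interv μ, g y * ρ y, ?_⟩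
  set C := ∫ y in interv μ, g y * ρ y with hC
  have hloc : LocallyIntegrableOn (fun y => g y - C) (interv μ) :=
    hg.sub (locallyIntegrableOn_const C)
  have key := (isOpen_interv μ).ae_eq_zero_of_integral_contDiff_smul_eq_zero hloc ?_
  · filter_upwards [key] with y hy hyI
    linarith [hy hyI]
  intro ψ hψ hψc hψsub
  obtain ⟨c, hc, hcsub⟩ := exists_subset_Ioo_of_isCompact hμ
    (hψc.isCompact.union (b.hasCompactSupport_normed (μ := volume)).isCompact)
    (union_subset hψsub hρsub)
  have hcc : -c ≤ c := by linarith [hc.1]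
  have hzψ := eq_zero_of_tsupport_subset (subset_union_left.trans hcsub)
  have hzρ : ∀ y ∉ Ioo (-c) c, ρ y = 0 ∧ deriv ρ y = 0 :=
    eq_zero_of_tsupport_subset (subset_union_right.trans hcsub)
  have hρ1 : ∫ y in (-c)..c, ρ y = 1 := by
    rw [intervalIntegral.integral_eq_integral_of_support_subset, hρ, b.integral_normed]
    intro y hy
    by_contra hcon
    exact hy (hzρ y fun h => hcon (Ioo_subset_Ioc_self h)).1
  set A := ∫ y in (-c)..c, ψ y with hA
  -- The even part of ψ, corrected by the even bump to have mean zero. Testing g with χ gives the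
  -- same as testing g - C with ψ, since g is even.
  set χ : ℝ → ℝ := fun y => (ψ y + ψ (-y)) / 2 - A * ρ y with hχ
  have hψneg : ContDiff ℝ ∞ fun y => ψ (-y) := hψ.comp contDiff_neg
  have hχs : ContDiff ℝ ∞ χ := ((hψ.add hψneg).div_const 2).sub (contDiff_const.mul hρs)
  have hχeven : ∀ y, χ (-y) = χ y := by
    intro y; simp only [hχ, hρeven, neg_neg]; ring
  have hzχ : ∀ y ∉ Ioo (-c) c, χ y = 0 := by
    intro y hy
    have hy' : -y ∉ Ioo (-c) c := fun h => hy ⟨by linarith [h.2], by linarith [h.1]⟩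
    simp only [hχ, (hzψ y hy).1, (hzψ _ hy').1, (hzρ y hy).1]; ring
  have hψn : ∫ y in (-c)..c, ψ (-y) = A := by
    rw [intervalIntegral.integral_comp_neg, neg_neg]
  have hχc := hχs.continuous
  have hψcont := hψ.continuous
  have hρcont := hρs.continuous
  have hχ0 : ∫ y in (-c)..c, χ y = 0 := by
    have h1 : Continuous fun y => (ψ y + ψ (-y)) / 2 := by fun_prop
    have h2 : Continuous fun y => A * ρ y := by fun_prop
    have h3 : Continuous fun y => ψ (-y) := by fun_prop
    simp only [hχ]
    rw [intervalIntegral.integral_sub (h1.intervalIntegrable _ _) (h2.intervalIntegrable _ _),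
      intervalIntegral.integral_div, intervalIntegral.integral_add (hψcont.intervalIntegrable _ _)
        (h3.intervalIntegrable _ _), hψn, intervalIntegral.integral_const_mul, hρ1]
    ring
  have hχhalf : ∫ y in (0 : ℝ)..c, χ y = 0 := by
    rw [← intervalIntegral.integral_add_adjacent_intervals (hχc.intervalIntegrable (-c) 0)
      (hχc.intervalIntegrable 0 c)] at hχ0
    have := intervalIntegral.integral_comp_neg (a := 0) (b := c) χ
    rw [neg_zero] at this
    simp_rw [hχeven] at this
    linarith
  -- The primitive from 0 of an even function is odd. It has compact support because evenness and
  -- mean zero make the integral over each half vanish.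
  set φ : ℝ → ℝ := fun y => ∫ t in (0 : ℝ)..y, χ t with hφ
  have hφd : ∀ y, HasDerivAt φ (χ y) y := fun y =>
    intervalIntegral.integral_hasDerivAt_right (hχc.intervalIntegrable _ _)
      (hχc.stronglyMeasurableAtFilter _ _) hχc.continuousAt
  have hφ' : deriv φ = χ := funext fun y => (hφd y).deriv
  have hφodd : ∀ y, φ (-y) = -φ y := by
    intro y
    have := intervalIntegral.integral_comp_neg (a := 0) (b := y) χ
    rw [neg_zero] at this
    simp_rw [hχeven] at this
    simp only [hφ]
    rw [this, intervalIntegral.integral_symm]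
  have hφz : ∀ y, c ≤ y → φ y = 0 := by
    intro y hy
    simp only [hφ]
    rw [← intervalIntegral.integral_add_adjacent_intervals (hχc.intervalIntegrable 0 c)
      (hχc.intervalIntegrable c y), hχhalf, zero_add]
    rw [intervalIntegral.integral_congr (g := fun _ => 0)]
    · simp
    · intro t ht
      rw [uIcc_of_le hy] at ht
      exact hzχ t fun h => absurd h.2 (not_lt.2 ht.1)
  have hφsupp : Function.support φ ⊆ Icc (-c) c := by
    intro y hy
    by_contra hcon
    rw [mem_Icc, not_and_or, not_le, not_le] at hcon
    rcases hcon with h1 | h1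
    · exact hy (by rw [← neg_neg y, hφodd, hφz _ (by linarith), neg_zero])
    · exact hy (hφz y h1.le)
  have hφt : tsupport φ ⊆ Icc (-c) c := closure_minimal hφsupp isClosed_Icc
  have hφtest : IsTestAngle μ φ := by
    refine ⟨contDiff_infty_iff_deriv.2 ⟨fun y => (hφd y).differentiableAt, hφ' ▸ hχs⟩,
      isCompact_Icc.of_isClosed_subset (isClosed_tsupport φ) hφt,
      hφt.trans (Icc_symm_subset_interv hμ hc), hφodd⟩
  have h1 := h φ hφtest
  rw [hφ', setIntegral_interv_eq hμ hc (fun y hy => by rw [hzχ y hy, mul_zero])] at h1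
  have hgψ := hint c hc ψ hψcont
  have hgψn := hint c hc (fun y => ψ (-y)) (by fun_prop)
  have hgρ := hint c hc ρ hρcont
  have hreflect : ∫ y in (-c)..c, g y * ψ (-y) = ∫ y in (-c)..c, g y * ψ y := by
    have h2 := intervalIntegral.integral_comp_neg (a := -c) (b := c) fun y => g y * ψ y
    rw [neg_neg] at h2
    rw [← h2]
    refine intervalIntegral.integral_congr fun y hy => ?_
    rw [uIcc_of_le hcc] at hy
    simp only [heven y (Icc_symm_subset_interv hμ hc hy)]
  have hCc : C = ∫ y in (-c)..c, g y * ρ y :=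
    setIntegral_interv_eq hμ hc fun y hy => by rw [(hzρ y hy).1, mul_zero]
  have h3 : ∫ y in (-c)..c, g y * χ y = (∫ y in (-c)..c, g y * ψ y) - A * C := by
    have : ∀ y, g y * χ y = (1 / 2) * (g y * ψ y) + (1 / 2) * (g y * ψ (-y)) - A * (g y * ρ y) := by
      intro y; simp only [hχ]; ring
    simp_rw [this]
    rw [intervalIntegral.integral_sub ((hgψ.const_mul _).add (hgψn.const_mul _)) (hgρ.const_mul _),
      intervalIntegral.integral_add (hgψ.const_mul _) (hgψn.const_mul _),
      intervalIntegral.integral_const_mul, intervalIntegral.integral_const_mul,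
      intervalIntegral.integral_const_mul, hreflect, hCc]
    ring
  rw [← intervalIntegral.integral_eq_integral_of_support_subset (a := -c) (b := c)]
  · have : ∀ y, ψ y • (g y - C) = g y * ψ y - C * ψ y := fun y => by rw [smul_eq_mul]; ring
    simp_rw [this]
    rw [intervalIntegral.integral_sub hgψ ((hψcont.intervalIntegrable _ _).const_mul _),
      intervalIntegral.integral_const_mul]
    linarith
  · intro y hy
    by_contra hcon
    apply hy
    change ψ y • (g y - C) = 0
    rw [(hzψ y fun h => hcon (Ioo_subset_Ioc_self h)).1, zero_smul]

end DomainWall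

/-! ### Regularity of critical phases up to the singular end point. -/

namespace DomainWall

variable {μ : ℝ} {v m φ : ℝ → ℝ}

/-- The weight vanishes to first order at 1/μ, so g dominates a multiple of 1/(1/μ - y), whose
integral diverges logarithmically. -/
lemma inv_wt_not_integrable (hμ : 0 < μ) {g : ℝ → ℝ} (hg : IntegrableOn g (Ioo 0 (1 / μ)))
    (hle : ∀ y ∈ Ioo 0 (1 / μ), 1 ≤ wt μ y * g y) : False := by
  have hR : 0 < 1 / μ := by positivity
  have hi : IntervalIntegrable (fun y => (y - 1 / μ)⁻¹) volume 0 (1 / μ) := by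
    rw [intervalIntegrable_iff_integrableOn_Ioo_of_le hR.le]
    refine Integrable.mono' (hg.const_mul (2 * μ)) ?_ ?_
    · exact (measurable_id.sub_const _).inv.aestronglyMeasurable
    · rw [ae_restrict_iff' measurableSet_Ioo]
      refine Eventually.of_forall fun y hy => ?_
      have hpos : 0 < 1 / μ - y := by linarith [hy.2]
      have h1 := hle y hy
      have hp := wt_pos hμ (Ioo_subset_interv hμ hy)
      have hgy : 0 < g y := pos_of_mul_pos_right (by linarith) hp.le
      have h2 : wt μ y ≤ 2 * μ * (1 / μ - y) := by
        have hmy := mul_lt_one_of_lt hμ hy.2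
        have h3 : μ * (1 / μ - y) = 1 - μ * y := by field_simp
        rw [mul_assoc, h3]; unfold wt
        nlinarith
      rw [norm_inv, Real.norm_eq_abs, abs_sub_comm, abs_of_pos hpos, inv_le_iff_one_le_mul₀ hpos]
      calc 1 ≤ wt μ y * g y := h1
        _ ≤ 2 * μ * (1 / μ - y) * g y := by gcongr
        _ = _ := by ring
  rw [intervalIntegrable_sub_inv_iff] at hi
  rcases hi with h | h
  · exact hR.ne h
  · exact h right_mem_uIcc

/-- A finite-energy odd phase satisfying the weak equation is a regular solution. -/
theorem exists_isProfile (hμ : 0 < μ) (hv : H1loc μ v) (hodd : ∀ y ∈ interv μ, v (-y) = -v y)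
    (hi : IntegrableOn (phaseDensity μ v) (interv μ))
    (hw : ∀ φ, IsTestAngle μ φ → firstVariation μ v φ = 0) : ∃ m, IsProfile μ v m := by
  have hR : 0 < 1 / μ := by positivity
  have h0I := zero_mem_interv hμ
  have hvc := hv.continuousOn hμ
  set s : ℝ → ℝ := fun y => 1 / 4 * wt μ y ^ 2 * Real.sin (4 * v y) with hs
  have hsc : ContinuousOn s (interv μ) :=
    (continuousOn_const.mul ((continuous_wt μ).continuousOn.pow 2)).mul
      (Real.continuous_sin.comp_continuousOn (continuousOn_const.mul hvc))
  have hsub0 : ∀ y ∈ interv μ, uIcc 0 y ⊆ interv μ := fun y hy => ordConnected_Ioo.uIcc_subset h0I hy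
  have hsint : ∀ y ∈ interv μ, IntervalIntegrable s volume 0 y := fun y hy =>
    (hsc.mono (hsub0 y hy)).intervalIntegrable
  set F : ℝ → ℝ := fun y => ∫ t in (0 : ℝ)..y, s t with hF
  have hFd : ∀ y ∈ interv μ, HasDerivAt F (s y) y := fun y hy =>
    intervalIntegral.integral_hasDerivAt_right (hsint y hy)
      (hsc.stronglyMeasurableAtFilter (isOpen_interv μ) y hy)
      (hsc.continuousAt ((isOpen_interv μ).mem_nhds hy))
  have hFc : ContinuousOn F (interv μ) := fun y hy => (hFd y hy).continuousAt.continuousWithinAt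
  have hsodd : ∀ y ∈ interv μ, s (-y) = -s y := by
    intro y hy
    simp only [hs, wt_neg, hodd y hy, mul_neg, Real.sin_neg]
  have hFeven : ∀ y ∈ interv μ, F (-y) = F y := by
    intro y hy
    have h1 := intervalIntegral.integral_comp_neg (a := 0) (b := y) s
    rw [neg_zero] at h1
    have h2 : ∫ t in (0 : ℝ)..y, s (-t) = ∫ t in (0 : ℝ)..y, -s t :=
      intervalIntegral.integral_congr fun t ht => hsodd t (hsub0 y hy ht)
    rw [h1, intervalIntegral.integral_neg, intervalIntegral.integral_symm] at h2
    simpa [hF] using h2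
  have hdint : ∀ c ∈ Ioo 0 (1 / μ), IntervalIntegrable (deriv v) volume (-c) c := fun c hc =>
    (hv _ (neg_mem_interv (Ioo_subset_interv hμ hc)) _ (Ioo_subset_interv hμ hc)
      (by linarith [hc.1])).1.intervalIntegrable_deriv
  -- After one integration by parts the weak equation says that g is orthogonal to derivatives of
  -- odd test functions, and g is even; hence it is almost everywhere a constant C.
  set g : ℝ → ℝ := fun y => wt μ y * deriv v y + F y with hg
  have hgloc : LocallyIntegrableOn g (interv μ) := by
    rw [locallyIntegrableOn_iff (isOpen_interv μ).isLocallyClosed]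
    intro K hK hKc
    obtain ⟨c, hc, hKsub⟩ := exists_subset_Ioo_of_isCompact hμ hKc hK
    have h1 : IntegrableOn (deriv v) (Icc (-c) c) :=
      (intervalIntegrable_iff_integrableOn_Icc_of_le (by linarith [hc.1])).1 (hdint c hc)
    have h2 : IntegrableOn F (Icc (-c) c) :=
      (hFc.mono (Icc_symm_subset_interv hμ hc)).integrableOn_compact isCompact_Icc
    exact ((h1.continuousOn_mul (continuous_wt μ).continuousOn isCompact_Icc).add h2).mono_set
      (hKsub.trans Ioo_subset_Icc_self)
  obtain ⟨C, hC⟩ := ae_eq_const_of_even hμ hgloc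
    (fun y hy => by simp only [hg, wt_neg, deriv_neg_of_odd hodd hy, hFeven y hy]) (by
    intro φ hφ
    have hz' := hw φ hφ
    obtain ⟨hφs, hφc, hφsub, hφodd⟩ := hφ
    obtain ⟨c, hc, hcsub⟩ := exists_subset_Ioo_of_isCompact hμ hφc hφsub
    have hcc : -c ≤ c := by linarith [hc.1]
    have hz := eq_zero_of_tsupport_subset hcsub
    have hIcc := Icc_symm_subset_interv hμ hc
    have hcφ' : Continuous (deriv φ) := hφs.continuous_deriv (by simp)
    have hcφ := hφs.continuous
    have i1 : IntervalIntegrable (fun y => wt μ y * deriv v y * deriv φ y) volume (-c) c :=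
      ((hdint c hc).continuousOn_mul (continuous_wt μ).continuousOn).mul_continuousOn hcφ'.continuousOn
    have i2 : IntervalIntegrable (fun y => s y * φ y) volume (-c) c :=
      ContinuousOn.intervalIntegrable_of_Icc hcc ((hsc.mono hIcc).mul hcφ.continuousOn)
    have i3 : IntervalIntegrable (fun y => F y * deriv φ y) volume (-c) c :=
      ContinuousOn.intervalIntegrable_of_Icc hcc ((hFc.mono hIcc).mul hcφ'.continuousOn)
    rw [firstVariation, setIntegral_interv_eq hμ hc (fun y hy => by
      rw [(hz y hy).1, (hz y hy).2]; ring), intervalIntegral.integral_sub i1 i2] at hz'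
    have hparts := intervalIntegral.integral_eq_sub_of_hasDerivAt (a := -c) (b := c)
      (f := fun y => F y * φ y) (f' := fun y => s y * φ y + F y * deriv φ y)
      (fun y hy => (hFd y (hIcc (by rwa [uIcc_of_le hcc] at hy))).mul
        (hφs.differentiable (by simp) y).hasDerivAt) (i2.add i3)
    rw [intervalIntegral.integral_add i2 i3, (hz c (by simp)).1, (hz (-c) (by simp)).1] at hparts
    rw [setIntegral_interv_eq hμ hc (fun y hy => by rw [(hz y hy).2]; ring)]
    have : ∀ y, g y * deriv φ y = wt μ y * deriv v y * deriv φ y + F y * deriv φ y := fun y => by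
      simp only [hg]; ring
    simp_rw [this]
    rw [intervalIntegral.integral_add i1 i3]
    linarith)
  -- Bootstrapping: v' agrees almost everywhere with this continuous function, so v, being the
  -- integral of its derivative, is C¹ with slope m.
  set m : ℝ → ℝ := fun y => (C - F y) / wt μ y with hm
  have hwne : ∀ y ∈ interv μ, wt μ y ≠ 0 := fun y hy => (wt_pos hμ hy).ne'
  have hmc : ContinuousOn m (interv μ) :=
    (continuousOn_const.sub hFc).div (continuous_wt μ).continuousOn hwne
  have hdm : ∀ᵐ y, y ∈ interv μ → deriv v y = m y := by
    filter_upwards [hC] with y hy hyI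
    simp only [hm]
    rw [eq_div_iff (hwne y hyI), ← hy hyI]; simp only [hg]; ring
  have hv0 : v 0 = 0 := by have := hodd 0 h0I; rw [neg_zero] at this; linarith
  have hvint : ∀ y ∈ interv μ, v y = ∫ t in (0 : ℝ)..y, m t := by
    intro y hy
    have hac : AbsolutelyContinuousOnInterval v 0 y := by
      rcases le_total 0 y with h | h
      · exact (hv 0 h0I y hy h).1
      · exact (hv y hy 0 h0I h).1.symm
    have h1 := hac.integral_deriv_eq_sub
    rw [hv0, sub_zero] at h1
    rw [← h1]
    refine intervalIntegral.integral_congr_ae ?_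
    filter_upwards [hdm] with t ht htI using ht (hsub0 y hy (uIoc_subset_uIcc htI))
  have hvd : ∀ y ∈ interv μ, HasDerivAt v (m y) y := by
    intro y hy
    have h1 := intervalIntegral.integral_hasDerivAt_right
      (hmc.mono (hsub0 y hy)).intervalIntegrable
      (hmc.stronglyMeasurableAtFilter (isOpen_interv μ) y hy)
      (hmc.continuousAt ((isOpen_interv μ).mem_nhds hy))
    refine h1.congr_of_eventuallyEq ?_
    filter_upwards [(isOpen_interv μ).mem_nhds hy] with t ht using hvint t ht
  have hwm : ∀ y ∈ interv μ, wt μ y * m y = C - F y := fun y hy => mul_div_cancel₀ _ (hwne y hy)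
  have hsR : IntervalIntegrable s volume 0 (1 / μ) := by
    rw [intervalIntegrable_iff_integrableOn_Ioo_of_le hR.le]
    refine Integrable.mono' (g := fun _ => (1 / 4 : ℝ)) (integrableOn_const (by simp))
      ((hsc.mono (Ioo_subset_interv hμ)).aestronglyMeasurable measurableSet_Ioo) ?_
    rw [ae_restrict_iff' measurableSet_Ioo]
    refine Eventually.of_forall fun y hy => ?_
    have hp := wt_pos hμ (Ioo_subset_interv hμ hy)
    have hp1 := wt_le_one μ y
    have hp2 : wt μ y ^ 2 ≤ 1 := by nlinarith
    simp only [hs]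
    rw [norm_mul, Real.norm_eq_abs, Real.norm_eq_abs,
      abs_of_nonneg (by positivity : 0 ≤ 1 / 4 * wt μ y ^ 2)]
    have := Real.abs_sin_le_one (4 * v y)
    calc 1 / 4 * wt μ y ^ 2 * |Real.sin (4 * v y)| ≤ 1 / 4 * 1 * 1 := by gcongr
      _ = _ := by ring
  have hflux : ∀ y ∈ Ico 0 (1 / μ), flux μ v y = F (1 / μ) - F y := by
    intro y hy
    have h1 := intervalIntegral.integral_interval_sub_left hsR (hsint y (Ico_subset_interv hμ hy))
    exact h1.symm
  -- The difference d is the limit of the flux at 1/μ. If d ≠ 0, then from d = η² v' - `flux` one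
  -- gets d² ≤ η² (2 η² v'² + 1/μ²), so 1/η² would be dominated by an integrable function,
  -- contradicting its logarithmic divergence.
  have hCF : C = F (1 / μ) := by
    by_contra hne
    have hd : 0 < (C - F (1 / μ)) ^ 2 := by
      have : C - F (1 / μ) ≠ 0 := sub_ne_zero.2 hne
      positivity
    set d := C - F (1 / μ) with hdd
    have hgi : IntegrableOn (fun y => (2 * (wt μ y * deriv v y ^ 2) + (1 / μ) ^ 2) / d ^ 2)
        (Ioo 0 (1 / μ)) := by
      have := ((integrableOn_wt_mul_deriv_sq hμ hi).mono_set (Ioo_subset_interv hμ)).const_mul 2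
      exact (this.add (integrableOn_const (by simp))).div_const _
    refine inv_wt_not_integrable hμ hgi fun y hy => ?_
    have hyI := Ioo_subset_interv hμ hy
    have hp := wt_pos hμ hyI
    have hp1 := wt_le_one μ y
    have h1 := abs_flux_le (u := v) hμ (Ioo_subset_Icc_self hy)
    have hy0 : 0 ≤ 1 / μ - y := by linarith [hy.2]
    have h2 : flux μ v y ^ 2 ≤ 1 / 2 * wt μ y * (1 / μ) ^ 2 := by
      rw [← sq_abs]
      calc |flux μ v y| ^ 2 ≤ (1 / 4 * wt μ y ^ 2 * (1 / μ - y)) ^ 2 := by gcongr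
        _ = 1 / 16 * wt μ y ^ 3 * wt μ y * (1 / μ - y) ^ 2 := by ring
        _ ≤ 1 / 16 * 1 ^ 3 * wt μ y * (1 / μ - 0) ^ 2 := by gcongr; exact hy.1.le
        _ ≤ 1 / 2 * wt μ y * (1 / μ) ^ 2 := by
          rw [sub_zero]
          have : 0 < wt μ y * (1 / μ) ^ 2 := by positivity
          nlinarith
    have h3 : d = wt μ y * m y - flux μ v y := by
      rw [hwm y hyI, hflux y (Ioo_subset_Ico_self hy)]; ring
    rw [(hvd y hyI).deriv, mul_div_assoc', le_div_iff₀ hd, one_mul]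
    have h4 : d ^ 2 ≤ 2 * (wt μ y * m y) ^ 2 + 2 * flux μ v y ^ 2 := by
      rw [h3]; nlinarith [sq_nonneg (wt μ y * m y + flux μ v y)]
    nlinarith
  refine ⟨m, ⟨fun y hy => hvd y (Ioo_subset_interv hμ hy), fun y hy => ?_,
    hvc.mono (Ico_subset_interv hμ), hmc.mono (Ico_subset_interv hμ), fun y hy => ?_⟩⟩
  · have hyI := Ioo_subset_interv hμ hy
    refine ((hFd y hyI).const_sub C).congr_of_eventuallyEq ?_
    filter_upwards [(isOpen_interv μ).mem_nhds hyI] with t ht using hwm t ht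
  · have hyI := Ico_subset_interv hμ hy
    have hp := wt_pos hμ hyI
    have h1 := abs_flux_le (u := v) hμ (Ico_subset_Icc_self hy)
    rw [hflux y hy, ← hCF, ← hwm y hyI, abs_mul, abs_of_pos hp] at h1
    refine le_of_mul_le_mul_left (h1.trans (le_of_eq ?_)) hp
    ring

end DomainWall

/-! ### Minimality of positive regular solutions. -/

namespace DomainWall

variable {μ : ℝ} {v m w : ℝ → ℝ}

/-- Monotone convergence. It lets the energy comparisons run on compact subintervals, where
everything is integrable. -/
lemma setLIntegral_Ioo_le_of_forall {f : ℝ → ℝ≥0∞} {R : ℝ} {E : ℝ≥0∞} (hR : 0 < R)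
    (h : ∀ b ∈ Ioo 0 R, ∫⁻ y in Ioc 0 b, f y ≤ E) : ∫⁻ y in Ioo 0 R, f y ≤ E := by
  obtain ⟨u, hmono, hu, hlim⟩ := exists_seq_strictMono_tendsto' hR
  have hU : Ioo 0 R = ⋃ n, Ioc 0 (u n) := by
    ext y
    simp only [mem_iUnion]
    constructor
    · intro hy
      obtain ⟨n, hn⟩ := (hlim.eventually (lt_mem_nhds hy.2)).exists
      exact ⟨n, hy.1, hn.le⟩
    · rintro ⟨n, hn⟩
      exact ⟨hn.1, hn.2.trans_lt (hu n).2⟩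
  rw [hU, setLIntegral_iUnion_of_directed]
  · exact iSup_le fun n => h _ (hu n)
  · exact (Monotone.directed_le fun a b hab => Ioc_subset_Ioc_right (hmono.monotone hab))

lemma Icc_zero_subset_interv (hμ : 0 < μ) {b : ℝ} (hb : b ∈ Ioo 0 (1 / μ)) : Icc 0 b ⊆ interv μ :=
  Icc_subset_interv (zero_mem_interv hμ) (Ioo_subset_interv hμ hb)

lemma H1loc.absolutelyContinuous (hμ : 0 < μ) (hw : H1loc μ w) {b : ℝ} (hb : b ∈ Ioo 0 (1 / μ)) :
    AbsolutelyContinuousOnInterval w 0 b :=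
  (hw 0 (zero_mem_interv hμ) b (Ioo_subset_interv hμ hb) hb.1.le).1

lemma H1loc.intervalIntegrable_sq (hμ : 0 < μ) (hw : H1loc μ w) {b : ℝ}
    (hb : b ∈ Ioo 0 (1 / μ)) : IntervalIntegrable (fun t => deriv w t ^ 2) volume 0 b :=
  intervalIntegrable_deriv_sq hb.1.le
    (hw 0 (zero_mem_interv hμ) b (Ioo_subset_interv hμ hb) hb.1.le).2

lemma intervalIntegrable_cos_sq {b : ℝ} (hb : b ∈ Ioo 0 (1 / μ))
    (hw : ContinuousOn w (Icc 0 b)) :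
    IntervalIntegrable (fun y => 1 / 4 * wt μ y ^ 2 * Real.cos (2 * w y) ^ 2) volume 0 b := by
  have hcw : ContinuousOn (wt μ) (Icc 0 b) := (continuous_wt μ).continuousOn
  exact ContinuousOn.intervalIntegrable_of_Icc hb.1.le ((continuousOn_const.mul (hcw.pow 2)).mul
    ((Real.continuous_cos.comp_continuousOn (continuousOn_const.mul hw)).pow 2))

lemma H1loc.intervalIntegrable_phaseDensity (hμ : 0 < μ) (hw : H1loc μ w) {b : ℝ}
    (hb : b ∈ Ioo 0 (1 / μ)) : IntervalIntegrable (phaseDensity μ w) volume 0 b :=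
  ((hw.intervalIntegrable_sq hμ hb).continuousOn_mul (continuous_wt μ).continuousOn).add
    (intervalIntegrable_cos_sq hb ((hw.continuousOn hμ).mono (Icc_zero_subset_interv hμ hb)))

lemma setLIntegral_phaseDensity (hμ : 0 < μ) {b : ℝ} (hb : b ∈ Ioo 0 (1 / μ))
    (hi : IntervalIntegrable (phaseDensity μ w) volume 0 b) :
    ∫⁻ y in Ioc 0 b, ENNReal.ofReal (phaseDensity μ w y)
      = ENNReal.ofReal (∫ y in (0 : ℝ)..b, phaseDensity μ w y) := by
  rw [intervalIntegral.integral_of_le hb.1.le, ofReal_integral_eq_lintegral_ofReal]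
  · exact (intervalIntegrable_iff_integrableOn_Ioc_of_le hb.1.le).1 hi
  · rw [Filter.EventuallyLE, ae_restrict_iff' measurableSet_Ioc]
    exact Eventually.of_forall fun y hy =>
      phaseDensity_nonneg hμ (Icc_zero_subset_interv hμ hb (Ioc_subset_Icc_self hy))

lemma integral_phaseDensity_le (hμ : 0 < μ) (hw : H1loc μ w) {b : ℝ} (hb : b ∈ Ioo 0 (1 / μ))
    (hfin : halfEnergy μ w ≠ ⊤) :
    ∫ y in (0 : ℝ)..b, phaseDensity μ w y ≤ (halfEnergy μ w).toReal := by
  have h1 : ENNReal.ofReal (∫ y in (0 : ℝ)..b, phaseDensity μ w y) ≤ halfEnergy μ w := by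
    rw [← setLIntegral_phaseDensity hμ hb (hw.intervalIntegrable_phaseDensity hμ hb)]
    exact lintegral_mono_set (Ioc_subset_Ioo_right hb.2)
  exact (ENNReal.ofReal_le_iff_le_toReal hfin).1 h1

namespace IsProfile

lemma tendsto_flux_mul (hμ : 0 < μ) (h : IsProfile μ v m)
    (hv : ∀ y ∈ Ico 0 (1 / μ), |v y| < Real.pi / 4) :
    Tendsto (fun b => wt μ b * m b * v b) (𝓝[<] (1 / μ)) (𝓝 0) := by
  have hR : 0 < 1 / μ := by positivity
  have h1 := (h.tendsto_flux hμ).norm.mul_const (Real.pi / 4)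
  rw [norm_zero, zero_mul] at h1
  refine squeeze_zero_norm' ?_ h1
  filter_upwards [Ioo_mem_nhdsLT hR] with b hb
  rw [norm_mul]
  gcongr
  exact (hv b (Ioo_subset_Ico_self hb)).le

/-- Energy comparison on a subinterval with a positive solution. -/
lemma integral_phaseDensity_add_le (hμ : 0 < μ) (h : IsProfile μ v m) (h0 : v 0 = 0)
    (hv : ∀ y ∈ Ioo 0 (1 / μ), v y ∈ Ioo 0 (Real.pi / 4)) (hw : H1loc μ w) (hw0 : w 0 = 0) {b : ℝ}
    (hb : b ∈ Ioo 0 (1 / μ)) :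
    IntervalIntegrable (phaseDensity μ v) volume 0 b ∧
    IntervalIntegrable (fun y => 1 / 4 * wt μ y ^ 2 * convexityGap (v y) (w y)) volume 0 b ∧
    (∫ y in (0 : ℝ)..b, phaseDensity μ v y)
      + ∫ y in (0 : ℝ)..b, 1 / 4 * wt μ y ^ 2 * convexityGap (v y) (w y)
      ≤ (∫ y in (0 : ℝ)..b, phaseDensity μ w y) + wt μ b * m b * v b := by
  have hsub : Icc 0 b ⊆ Ico 0 (1 / μ) := Icc_subset_Ico_right hb.2
  have hcv := h.continuousOn.mono hsub
  have hcm := h.continuousOn_slope.mono hsub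
  have hcwt : ContinuousOn (wt μ) (Icc 0 b) := (continuous_wt μ).continuousOn
  have hcw := (hw.continuousOn hμ).mono (Icc_zero_subset_interv hμ hb)
  have hdv : ∀ y ∈ Ioc 0 b, deriv v y = m y := fun y hy =>
    (h.hasDerivAt y ⟨hy.1, hy.2.trans_lt hb.2⟩).deriv
  obtain ⟨iP, hP⟩ := h.picone hμ hv hb.1 hb.2 (hw.absolutelyContinuous hμ hb)
    (hw.intervalIntegrable_sq hμ hb) hw0
  have iW : IntervalIntegrable (fun y => wt μ y * deriv w y ^ 2) volume 0 b :=
    (hw.intervalIntegrable_sq hμ hb).continuousOn_mul (continuous_wt μ).continuousOn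
  have iM : IntervalIntegrable (fun y => wt μ y * m y ^ 2) volume 0 b :=
    ContinuousOn.intervalIntegrable_of_Icc hb.1.le (hcwt.mul (hcm.pow 2))
  have iS : IntervalIntegrable (fun y => 1 / 4 * wt μ y ^ 2 * Real.sin (4 * v y) * v y) volume 0 b :=
    ContinuousOn.intervalIntegrable_of_Icc hb.1.le (((continuousOn_const.mul (hcwt.pow 2)).mul
      (Real.continuous_sin.comp_continuousOn (continuousOn_const.mul hcv))).mul hcv)
  have iCv := intervalIntegrable_cos_sq hb hcv
  have iCw := intervalIntegrable_cos_sq hb hcw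
  have iV' : IntervalIntegrable (fun y => wt μ y * m y ^ 2
      + 1 / 4 * wt μ y ^ 2 * Real.cos (2 * v y) ^ 2) volume 0 b := iM.add iCv
  have hV : ∀ y ∈ Ioc 0 b, wt μ y * m y ^ 2 + 1 / 4 * wt μ y ^ 2 * Real.cos (2 * v y) ^ 2
      = phaseDensity μ v y := fun y hy => by rw [phaseDensity, hdv y hy]
  have hVeq : ∀ᵐ y, y ∈ uIoc 0 b → wt μ y * m y ^ 2 + 1 / 4 * wt μ y ^ 2 * Real.cos (2 * v y) ^ 2
      = phaseDensity μ v y := by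
    rw [uIoc_of_le hb.1.le]; exact Eventually.of_forall hV
  have iV : IntervalIntegrable (phaseDensity μ v) volume 0 b :=
    iV'.congr_ae ((ae_restrict_iff' measurableSet_uIoc).2 hVeq)
  have hgap : ∀ y ∈ Ioc 0 b, 1 / 4 * wt μ y ^ 2 * (Real.sin (4 * v y) / v y) * w y ^ 2
      - 1 / 4 * wt μ y ^ 2 * Real.sin (4 * v y) * v y
      + 1 / 4 * wt μ y ^ 2 * Real.cos (2 * w y) ^ 2 - 1 / 4 * wt μ y ^ 2 * Real.cos (2 * v y) ^ 2
      = 1 / 4 * wt μ y ^ 2 * convexityGap (v y) (w y) := by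
    intro y hy
    have := (hv y ⟨hy.1, hy.2.trans_lt hb.2⟩).1.ne'
    rw [convexityGap]; field_simp
  have hgapeq : ∀ᵐ y, y ∈ uIoc 0 b → 1 / 4 * wt μ y ^ 2 * (Real.sin (4 * v y) / v y) * w y ^ 2
      - 1 / 4 * wt μ y ^ 2 * Real.sin (4 * v y) * v y
      + 1 / 4 * wt μ y ^ 2 * Real.cos (2 * w y) ^ 2 - 1 / 4 * wt μ y ^ 2 * Real.cos (2 * v y) ^ 2
      = 1 / 4 * wt μ y ^ 2 * convexityGap (v y) (w y) := by
    rw [uIoc_of_le hb.1.le]; exact Eventually.of_forall hgap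
  have iG := (((iP.sub iS).add iCw).sub iCv).congr_ae
    ((ae_restrict_iff' measurableSet_uIoc).2 hgapeq)
  refine ⟨iV, iG, ?_⟩
  -- Testing the equation with v replaces ∫ η² v'² by ∫ (1/4) η⁴ v sin 4v plus the boundary term;
  -- Picone's inequality bounds ∫ η² w'² from below. The difference of the resulting integrands is
  -- exactly the convexity gap.
  rw [← intervalIntegral.integral_congr_ae hVeq, ← intervalIntegral.integral_congr_ae hgapeq,
    intervalIntegral.integral_add iM iCv,
    intervalIntegral.integral_sub ((iP.sub iS).add iCw) iCv,
    intervalIntegral.integral_add (iP.sub iS) iCw, intervalIntegral.integral_sub iP iS,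
    h.integral_wt_mul_slope_sq h0 hb]
  have : ∫ y in (0 : ℝ)..b, phaseDensity μ w y = (∫ y in (0 : ℝ)..b, wt μ y * deriv w y ^ 2)
      + ∫ y in (0 : ℝ)..b, 1 / 4 * wt μ y ^ 2 * Real.cos (2 * w y) ^ 2 := by
    rw [← intervalIntegral.integral_add iW iCw]; rfl
  rw [this]
  linarith

/-- A positive solution minimizes the energy, with a quantified gap. -/
lemma halfEnergy_le_sub (hμ : 0 < μ) (h : IsProfile μ v m) (h0 : v 0 = 0)
    (hv : ∀ y ∈ Ioo 0 (1 / μ), v y ∈ Ioo 0 (Real.pi / 4)) (hw : H1loc μ w) (hw0 : w 0 = 0)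
    (hfin : halfEnergy μ w ≠ ⊤) {c : ℝ} (hc : c ∈ Ioo 0 (1 / μ)) :
    halfEnergy μ v ≤ ENNReal.ofReal ((halfEnergy μ w).toReal
      - ∫ y in (0 : ℝ)..c, 1 / 4 * wt μ y ^ 2 * convexityGap (v y) (w y)) := by
  have hR : 0 < 1 / μ := by positivity
  refine setLIntegral_Ioo_le_of_forall hR fun b hb => ?_
  rw [setLIntegral_phaseDensity hμ hb (h.integral_phaseDensity_add_le hμ h0 hv hw hw0 hb).1]
  refine ENNReal.ofReal_le_ofReal ?_
  have hlim := (h.tendsto_flux_mul hμ (h.abs_lt_pi_div_four hμ h0)).const_add (halfEnergy μ w).toReal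
  rw [add_zero] at hlim
  rw [le_sub_iff_add_le]
  -- The comparison is made on a larger interval (0, d), and d → 1/μ removes the boundary term η² v'
  -- v. By nonnegativity the integrals over (0, b) and (0, c) are dominated by those over (0, d).
  refine ge_of_tendsto hlim ?_
  filter_upwards [Ioo_mem_nhdsLT hb.2, Ioo_mem_nhdsLT hc.2] with d hd1 hd2
  have hd : d ∈ Ioo 0 (1 / μ) := ⟨hb.1.trans hd1.1, hd1.2⟩
  obtain ⟨i1, i2, h3⟩ := h.integral_phaseDensity_add_le hμ h0 hv hw hw0 hd
  have h4 := integral_phaseDensity_le hμ hw hd hfin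
  have h5 : ∫ y in (0 : ℝ)..b, phaseDensity μ v y ≤ ∫ y in (0 : ℝ)..d, phaseDensity μ v y := by
    refine intervalIntegral.integral_mono_interval le_rfl hb.1.le hd1.1.le ?_ i1
    rw [Filter.EventuallyLE, ae_restrict_iff' measurableSet_Ioc]
    exact Eventually.of_forall fun y hy =>
      phaseDensity_nonneg hμ (Icc_zero_subset_interv hμ hd (Ioc_subset_Icc_self hy))
  have h6 : ∫ y in (0 : ℝ)..c, 1 / 4 * wt μ y ^ 2 * convexityGap (v y) (w y)
      ≤ ∫ y in (0 : ℝ)..d, 1 / 4 * wt μ y ^ 2 * convexityGap (v y) (w y) := by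
    refine intervalIntegral.integral_mono_interval le_rfl hc.1.le hd2.1.le ?_ i2
    rw [Filter.EventuallyLE, ae_restrict_iff' measurableSet_Ioc]
    refine Eventually.of_forall fun y hy => ?_
    have := convexityGap_nonneg (w := w y) (hv y ⟨hy.1, hy.2.trans_lt hd.2⟩)
    simp only [Pi.zero_apply]
    positivity
  linarith

theorem halfEnergy_le (hμ : 0 < μ) (h : IsProfile μ v m) (h0 : v 0 = 0)
    (hv : ∀ y ∈ Ioo 0 (1 / μ), v y ∈ Ioo 0 (Real.pi / 4)) (hw : H1loc μ w) (hw0 : w 0 = 0) :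
    halfEnergy μ v ≤ halfEnergy μ w := by
  by_cases hfin : halfEnergy μ w = ⊤
  · rw [hfin]; exact le_top
  have hR : 0 < 1 / μ := by positivity
  have hc : 1 / μ / 2 ∈ Ioo 0 (1 / μ) := ⟨by positivity, by linarith⟩
  refine (h.halfEnergy_le_sub hμ h0 hv hw hw0 hfin hc).trans ?_
  rw [ENNReal.ofReal_le_iff_le_toReal hfin]
  have : 0 ≤ ∫ y in (0 : ℝ)..1 / μ / 2, 1 / 4 * wt μ y ^ 2 * convexityGap (v y) (w y) := by
    rw [intervalIntegral.integral_of_le hc.1.le]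
    refine setIntegral_nonneg measurableSet_Ioc fun y hy => ?_
    have := convexityGap_nonneg (w := w y) (hv y ⟨hy.1, hy.2.trans_lt hc.2⟩)
    positivity
  linarith

/-- If the squares differed at one point, continuity would make the integrated gap strictly positive
on a compact subinterval, and v would have strictly less energy than w. -/
theorem sq_eq_of_halfEnergy_le (hμ : 0 < μ) (h : IsProfile μ v m) (h0 : v 0 = 0)
    (hv : ∀ y ∈ Ioo 0 (1 / μ), v y ∈ Ioo 0 (Real.pi / 4)) (hw : H1loc μ w) (hw0 : w 0 = 0)
    (hfin : halfEnergy μ w ≠ ⊤) (hle : halfEnergy μ w ≤ halfEnergy μ v) :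
    ∀ y ∈ Ioo 0 (1 / μ), w y ^ 2 = v y ^ 2 := by
  intro y hy
  by_contra hne
  obtain ⟨c, hc1, hc2⟩ := exists_between hy.2
  have hc : c ∈ Ioo 0 (1 / μ) := ⟨hy.1.trans hc1, hc2⟩
  set G : ℝ → ℝ := fun y => 1 / 4 * wt μ y ^ 2 * convexityGap (v y) (w y) with hG
  have hGnn : ∀ t ∈ Ioo 0 (1 / μ), 0 ≤ G t := fun t ht => by
    have := convexityGap_nonneg (w := w t) (hv t ht)
    simp only [hG]; positivity
  have hi := (h.integral_phaseDensity_add_le hμ h0 hv hw hw0 hc).2.1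
  have hpos : 0 < ∫ t in (0 : ℝ)..c, G t := by
    have hsub : Icc y c ⊆ Ioo 0 (1 / μ) := fun t ht => ⟨hy.1.trans_le ht.1, ht.2.trans_lt hc2⟩
    have hcv := h.continuousOn.mono (hsub.trans Ioo_subset_Ico_self)
    have hcw := (hw.continuousOn hμ).mono (hsub.trans (Ioo_subset_interv hμ))
    have hcwt : ContinuousOn (wt μ) (Icc y c) := (continuous_wt μ).continuousOn
    have h1 : 0 < ∫ t in y..c, G t := by
      refine intervalIntegral.integral_pos hc1 ?_ (fun t ht => hGnn t (hsub (Ioc_subset_Icc_self ht)))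
        ⟨y, ⟨le_rfl, hc1.le⟩, ?_⟩
      · refine (continuousOn_const.mul (hcwt.pow 2)).mul (ContinuousOn.sub (ContinuousOn.add
          (ContinuousOn.mul (ContinuousOn.div ?_ hcv fun t ht => (hv t (hsub ht)).1.ne')
            ((hcw.pow 2).sub (hcv.pow 2))) ?_) ?_)
        · exact Real.continuous_sin.comp_continuousOn (continuousOn_const.mul hcv)
        · exact (Real.continuous_cos.comp_continuousOn (continuousOn_const.mul hcw)).pow 2
        · exact (Real.continuous_cos.comp_continuousOn (continuousOn_const.mul hcv)).pow 2
      · have := convexityGap_pos (hv y hy) hne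
        have := wt_pos hμ (Ioo_subset_interv hμ hy)
        simp only [hG]; positivity
    refine h1.trans_le ?_
    refine intervalIntegral.integral_mono_interval hy.1.le hc1.le le_rfl ?_ hi
    rw [Filter.EventuallyLE, ae_restrict_iff' measurableSet_Ioc]
    exact Eventually.of_forall fun t ht => hGnn t ⟨ht.1, ht.2.trans_lt hc2⟩
  have h1 := hle.trans (h.halfEnergy_le_sub hμ h0 hv hw hw0 hfin hc)
  have h2 : (halfEnergy μ w).toReal ≤ max ((halfEnergy μ w).toReal - ∫ t in (0 : ℝ)..c, G t) 0 := by
    have := ENNReal.toReal_mono ENNReal.ofReal_ne_top h1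
    rwa [ENNReal.toReal_ofReal'] at this
  -- The truncation at 0 in `ENNReal.ofReal` would make the comparison void if w had zero energy.
  -- This is excluded because v has positive energy, cos 2v being positive, and no more energy than
  -- w.
  have hnn : 0 < (halfEnergy μ w).toReal := by
    have h3 := integral_phaseDensity_le hμ hw hc hfin
    have h4 := (h.integral_phaseDensity_add_le hμ h0 hv hw hw0 hc).1
    by_contra hcon
    have h5 : halfEnergy μ w = 0 := by
      rcases (ENNReal.toReal_eq_zero_iff _).1 (le_antisymm (not_lt.1 hcon) ENNReal.toReal_nonneg)
        with h6 | h6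
      · exact h6
      · exact absurd h6 hfin
    have h7 := h.halfEnergy_le hμ h0 hv hw hw0
    rw [h5] at h7
    have h8 : ENNReal.ofReal (∫ y in (0 : ℝ)..c, phaseDensity μ v y) ≤ 0 := by
      rw [← setLIntegral_phaseDensity hμ hc h4]
      exact (lintegral_mono_set (Ioc_subset_Ioo_right hc.2)).trans h7
    have h9 : 0 < ∫ y in (0 : ℝ)..c, phaseDensity μ v y := by
      refine intervalIntegral.intervalIntegral_pos_of_pos_on h4 (fun t ht => ?_) hc.1
      have ht' : t ∈ Ioo 0 (1 / μ) := ⟨ht.1, ht.2.trans hc2⟩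
      have hp := wt_pos hμ (Ioo_subset_interv hμ ht')
      have hcos : 0 < Real.cos (2 * v t) := Real.cos_pos_of_mem_Ioo
        ⟨by linarith [(hv t ht').1, Real.pi_pos], by linarith [(hv t ht').2]⟩
      unfold phaseDensity; positivity
    rw [nonpos_iff_eq_zero, ENNReal.ofReal_eq_zero] at h8
    linarith
  rcases le_max_iff.1 h2 with h3 | h3 <;> linarith

end IsProfile

/-! ### The weighted Poincaré inequality and its consequences. -/

section Subcritical

/-- Existence of small positive solutions on the whole half interval. -/
def HasSmallProfiles (μ : ℝ) : Prop :=
  ∀ s ∈ Ioo 0 (Real.pi / 4), ∃ v m, IsProfile μ v m ∧ ∀ y ∈ Ioo 0 (1 / μ), v y ∈ Ioc 0 s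

/-- Small positive solutions yield the weighted Poincaré inequality. -/
lemma HasSmallProfiles.poincare (hμ : 0 < μ) (hA : HasSmallProfiles μ) {b : ℝ}
    (hb : b ∈ Ioo 0 (1 / μ)) (hw : AbsolutelyContinuousOnInterval w 0 b)
    (hw2 : IntervalIntegrable (fun t => deriv w t ^ 2) volume 0 b) (hw0 : w 0 = 0) :
    ∫ y in (0 : ℝ)..b, wt μ y ^ 2 * w y ^ 2 ≤ ∫ y in (0 : ℝ)..b, wt μ y * deriv w y ^ 2 := by
  have hcw : ContinuousOn w (Icc 0 b) := by simpa [uIcc_of_le hb.1.le] using hw.continuousOn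
  have hcwt : ContinuousOn (wt μ) (Icc 0 b) := (continuous_wt μ).continuousOn
  set P := ∫ y in (0 : ℝ)..b, wt μ y ^ 2 * w y ^ 2 with hP
  have iP : IntervalIntegrable (fun y => wt μ y ^ 2 * w y ^ 2) volume 0 b :=
    ContinuousOn.intervalIntegrable_of_Icc hb.1.le ((hcwt.pow 2).mul (hcw.pow 2))
  have hlim : Tendsto (fun s : ℝ => (1 - 4 * s ^ 2) * P) (𝓝[>] 0) (𝓝 P) := by
    have : Tendsto (fun s : ℝ => (1 - 4 * s ^ 2) * P) (𝓝 0) (𝓝 ((1 - 4 * 0 ^ 2) * P)) :=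
      Continuous.tendsto (by fun_prop) _
    simp only [ne_eq, OfNat.ofNat_ne_zero, not_false_eq_true, zero_pow, mul_zero, sub_zero,
      one_mul] at this
    exact this.mono_left nhdsWithin_le_nhds
  refine le_of_tendsto hlim ?_
  filter_upwards [Ioo_mem_nhdsGT (show (0 : ℝ) < 1 / 4 by norm_num)] with s hs
  have hπ := Real.pi_gt_three
  have hs' : s ∈ Ioo 0 (Real.pi / 4) := ⟨hs.1, by linarith [hs.2]⟩
  obtain ⟨v, m, h, hv⟩ := hA s hs'
  have hv' : ∀ y ∈ Ioo 0 (1 / μ), v y ∈ Ioo 0 (Real.pi / 4) := fun y hy =>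
    ⟨(hv y hy).1, (hv y hy).2.trans_lt hs'.2⟩
  obtain ⟨i1, h1⟩ := h.picone hμ hv' hb.1 hb.2 hw hw2 hw0
  refine le_trans ?_ h1
  rw [hP, ← intervalIntegral.integral_const_mul]
  refine intervalIntegral.integral_mono_ae_restrict hb.1.le (iP.const_mul _) i1 ?_
  rw [Filter.EventuallyLE, ae_restrict_iff' measurableSet_Icc]
  have hne : ∀ᵐ y : ℝ, y ≠ 0 := by simp [ae_iff, measure_singleton]
  filter_upwards [hne] with y hy0 hy
  have hyI : y ∈ Ioo 0 (1 / μ) := ⟨lt_of_le_of_ne hy.1 hy0.symm, hy.2.trans_lt hb.2⟩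
  obtain ⟨hv1, hv2⟩ := hv y hyI
  -- Since v ≤ s, the coefficient sin 4v / v of Picone's inequality is at least sin 4s / s, which
  -- tends to 4 as s → 0; the factor 1/4 then leaves the constant 1.
  have hsin : Real.sin (4 * s) / s ≤ Real.sin (4 * v y) / v y := by
    rcases eq_or_lt_of_le hv2 with h2 | h2
    · rw [h2]
    · have := mul_sin_lt_mul_sin (x := 4 * v y) (y := 4 * s) (by linarith) (by linarith)
        (by linarith [hs'.2])
      rw [div_le_div_iff₀ hs.1 hv1]
      linarith
  have hlow : 4 * (1 - 4 * s ^ 2) ≤ Real.sin (4 * s) / s := by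
    rw [le_div_iff₀ hs.1]
    have := Real.sin_gt_sub_cube (x := 4 * s) (by linarith [hs.1])
    have := pow_pos hs.1 3
    nlinarith
  have hkey := hlow.trans hsin
  have hnn : 0 ≤ wt μ y ^ 2 * w y ^ 2 := by positivity
  nlinarith [mul_le_mul_of_nonneg_right hkey hnn]

lemma one_le_four_mul_sq_add_cos_sq (x : ℝ) : 1 ≤ 4 * x ^ 2 + Real.cos (2 * x) ^ 2 := by
  have h1 : Real.sin (2 * x) ^ 2 ≤ (2 * x) ^ 2 := sq_le_sq.2 Real.abs_sin_le_abs
  have := Real.sin_sq_add_cos_sq (2 * x)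
  nlinarith

/-- The loss of potential energy, (1/4) η⁴ sin² 2w, is at most η⁴ w², which the Poincaré inequality
pays for with the Dirichlet term. -/
lemma HasSmallProfiles.halfEnergy_zero_le (hμ : 0 < μ) (hA : HasSmallProfiles μ)
    (hw : H1loc μ w) (hw0 : w 0 = 0) : halfEnergy μ (fun _ => 0) ≤ halfEnergy μ w := by
  have hR : 0 < 1 / μ := by positivity
  by_cases hfin : halfEnergy μ w = ⊤
  · rw [hfin]; exact le_top
  refine setLIntegral_Ioo_le_of_forall hR fun b hb => ?_
  have hcw := (hw.continuousOn hμ).mono (Icc_zero_subset_interv hμ hb)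
  have hcwt : ContinuousOn (wt μ) (Icc 0 b) := (continuous_wt μ).continuousOn
  have hz : phaseDensity μ (fun _ => 0) = fun y => 1 / 4 * wt μ y ^ 2 := by
    funext y; simp [phaseDensity]
  have iz : IntervalIntegrable (fun y => 1 / 4 * wt μ y ^ 2) volume 0 b :=
    ContinuousOn.intervalIntegrable_of_Icc hb.1.le (continuousOn_const.mul (hcwt.pow 2))
  rw [setLIntegral_phaseDensity hμ hb (by rw [hz]; exact iz), hz,
    ENNReal.ofReal_le_iff_le_toReal hfin]
  refine le_trans ?_ (integral_phaseDensity_le hμ hw hb hfin)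
  have h1 := hA.poincare hμ hb (hw.absolutelyContinuous hμ hb) (hw.intervalIntegrable_sq hμ hb) hw0
  have iW : IntervalIntegrable (fun y => wt μ y * deriv w y ^ 2) volume 0 b :=
    (hw.intervalIntegrable_sq hμ hb).continuousOn_mul (continuous_wt μ).continuousOn
  have iC := intervalIntegrable_cos_sq hb hcw
  have iP : IntervalIntegrable (fun y => wt μ y ^ 2 * w y ^ 2) volume 0 b :=
    ContinuousOn.intervalIntegrable_of_Icc hb.1.le ((hcwt.pow 2).mul (hcw.pow 2))
  have h2 : ∫ y in (0 : ℝ)..b, phaseDensity μ w y = (∫ y in (0 : ℝ)..b, wt μ y * deriv w y ^ 2)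
      + ∫ y in (0 : ℝ)..b, 1 / 4 * wt μ y ^ 2 * Real.cos (2 * w y) ^ 2 := by
    rw [← intervalIntegral.integral_add iW iC]; rfl
  have h3 : ∫ y in (0 : ℝ)..b, 1 / 4 * wt μ y ^ 2
      ≤ (∫ y in (0 : ℝ)..b, wt μ y ^ 2 * w y ^ 2)
        + ∫ y in (0 : ℝ)..b, 1 / 4 * wt μ y ^ 2 * Real.cos (2 * w y) ^ 2 := by
    rw [← intervalIntegral.integral_add iP iC]
    refine intervalIntegral.integral_mono_on hb.1.le iz (iP.add iC) fun y _ => ?_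
    have := mul_le_mul_of_nonneg_left (one_le_four_mul_sq_add_cos_sq (w y)) (sq_nonneg (wt μ y))
    linarith
  linarith

/-- Testing the equation with v gives ∫ η² v'² = ∫ (1/4) η⁴ v sin 4v in the limit, strictly less
than ∫ η⁴ v² unless v = 0; the Poincaré inequality gives the opposite bound. -/
lemma HasSmallProfiles.eq_zero (hμ : 0 < μ) (hA : HasSmallProfiles μ) (h : IsProfile μ v m)
    (hv : H1loc μ v) (h0 : v 0 = 0) : ∀ y ∈ Ioo 0 (1 / μ), v y = 0 := by
  intro y hy
  by_contra hne
  set D : ℝ → ℝ := fun y => wt μ y ^ 2 * v y ^ 2 - 1 / 4 * wt μ y ^ 2 * Real.sin (4 * v y) * v y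
    with hD
  have hDnn : ∀ t, 0 ≤ D t := fun t => by
    have := mul_le_mul_of_nonneg_left (sin_four_mul_mul_self_le (v t)) (sq_nonneg (wt μ t))
    simp only [hD]; linarith
  have hDpos : 0 < D y := by
    have hp := wt_pos hμ (Ioo_subset_interv hμ hy)
    have := mul_lt_mul_of_pos_left (sin_four_mul_mul_self_lt hne) (pow_pos hp 2)
    simp only [hD]; linarith
  have hcont : ∀ b ∈ Ioo 0 (1 / μ), ContinuousOn D (Icc 0 b) := by
    intro b hb
    have hcv := h.continuousOn.mono (Icc_subset_Ico_right hb.2 : Icc 0 b ⊆ _)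
    have hcwt : ContinuousOn (wt μ) (Icc 0 b) := (continuous_wt μ).continuousOn
    exact ((hcwt.pow 2).mul (hcv.pow 2)).sub (((continuousOn_const.mul (hcwt.pow 2)).mul
      (Real.continuous_sin.comp_continuousOn (continuousOn_const.mul hcv))).mul hcv)
  have hpos : 0 < ∫ t in (0 : ℝ)..y, D t :=
    intervalIntegral.integral_pos hy.1 (hcont y hy) (fun t _ => hDnn t)
      ⟨y, ⟨hy.1.le, le_rfl⟩, hDpos⟩
  have hle : ∫ t in (0 : ℝ)..y, D t ≤ 0 := by
    refine ge_of_tendsto (h.tendsto_flux_mul hμ (h.abs_lt_pi_div_four hμ h0)) ?_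
    filter_upwards [Ioo_mem_nhdsLT hy.2] with b hb
    have hb' : b ∈ Ioo 0 (1 / μ) := ⟨hy.1.trans hb.1, hb.2⟩
    have hcv := h.continuousOn.mono (Icc_subset_Ico_right hb'.2 : Icc 0 b ⊆ _)
    have hcwt : ContinuousOn (wt μ) (Icc 0 b) := (continuous_wt μ).continuousOn
    have h1 := hA.poincare hμ hb' (hv.absolutelyContinuous hμ hb')
      (hv.intervalIntegrable_sq hμ hb') h0
    have h2 : ∫ t in (0 : ℝ)..b, wt μ t * deriv v t ^ 2 = ∫ t in (0 : ℝ)..b, wt μ t * m t ^ 2 := by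
      refine intervalIntegral.integral_congr_ae (Eventually.of_forall fun t ht => ?_)
      rw [uIoc_of_le hb'.1.le] at ht
      rw [(h.hasDerivAt t ⟨ht.1, ht.2.trans_lt hb'.2⟩).deriv]
    rw [h2, h.integral_wt_mul_slope_sq h0 hb'] at h1
    have h3 : ∫ t in (0 : ℝ)..y, D t ≤ ∫ t in (0 : ℝ)..b, D t :=
      intervalIntegral.integral_mono_interval le_rfl hy.1.le hb.1.le
        (Eventually.of_forall hDnn) ((hcont b hb').intervalIntegrable_of_Icc hb'.1.le)
    have h4 : ∫ t in (0 : ℝ)..b, D t = (∫ t in (0 : ℝ)..b, wt μ t ^ 2 * v t ^ 2)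
        - ∫ t in (0 : ℝ)..b, 1 / 4 * wt μ t ^ 2 * Real.sin (4 * v t) * v t := by
      rw [← intervalIntegral.integral_sub]
      · exact ContinuousOn.intervalIntegrable_of_Icc hb'.1.le ((hcwt.pow 2).mul (hcv.pow 2))
      · exact ContinuousOn.intervalIntegrable_of_Icc hb'.1.le (((continuousOn_const.mul
          (hcwt.pow 2)).mul (Real.continuous_sin.comp_continuousOn
            (continuousOn_const.mul hcv))).mul hcv)
    linarith
  linarith

end Subcritical

end DomainWall

/-! ### Instability of the symmetric state and the threshold. -/

namespace DomainWall

/-- The second variation of the energy at the symmetric state is negative in some odd direction,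
rescaled to the unit interval. -/
def IsUnstable (μ : ℝ) : Prop :=
  ∃ M : ℝ → ℝ, Continuous M ∧ μ ^ 2 * ∫ x in (0 : ℝ)..1, wt 1 x * M x ^ 2
    < ∫ x in (0 : ℝ)..1, wt 1 x ^ 2 * (∫ t in (0 : ℝ)..x, M t) ^ 2

section Threshold

variable {μ : ℝ} {v m M : ℝ → ℝ}

lemma wt_one_mul (μ y : ℝ) : wt 1 (μ * y) = wt μ y := by simp [wt]

lemma wt_div (hμ : μ ≠ 0) (x : ℝ) : wt μ (x / μ) = wt 1 x := by
  rw [← wt_one_mul, mul_div_cancel₀ _ hμ]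

lemma wt_one_nonneg {x : ℝ} (hx : x ∈ Icc 0 1) : 0 ≤ wt 1 x := by
  have h := hx.2
  have h0 := hx.1
  simp only [wt, one_mul]; nlinarith

lemma IsProfile.integral_wt_mul_slope_sq_radius (hμ : 0 < μ) (h : IsProfile μ v m)
    (hm : Continuous m) (hv : ∀ y, HasDerivAt v (m y) y) (h0 : v 0 = 0) :
    ∫ y in (0 : ℝ)..1 / μ, wt μ y * m y ^ 2
      = ∫ y in (0 : ℝ)..1 / μ, 1 / 4 * wt μ y ^ 2 * Real.sin (4 * v y) * v y := by
  have hR : 0 < 1 / μ := by positivity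
  have hvc : Continuous v := continuous_iff_continuousAt.2 fun y => (hv y).continuousAt
  have hw := continuous_wt μ
  have hi1 : IntervalIntegrable (fun t => wt μ t * m t ^ 2) volume 0 (1 / μ) :=
    Continuous.intervalIntegrable (by fun_prop) _ _
  have hi2 : IntervalIntegrable (fun t => 1 / 4 * wt μ t ^ 2 * Real.sin (4 * v t) * v t)
      volume 0 (1 / μ) := Continuous.intervalIntegrable (by fun_prop) _ _
  have key := intervalIntegral.integral_eq_sub_of_hasDerivAt_of_le hR.le
    (f := fun t => wt μ t * m t * v t)
    (f' := fun t => wt μ t * m t ^ 2 - 1 / 4 * wt μ t ^ 2 * Real.sin (4 * v t) * v t)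
    (Continuous.continuousOn (by fun_prop))
    (fun t ht => ((h.hasDerivAt_flux t ht).mul (hv t)).congr_deriv (by ring)) (hi1.sub hi2)
  rw [intervalIntegral.integral_sub hi1 hi2, h0, wt_radius hμ] at key
  linarith

/-- The wall is itself an unstable direction: by the energy identity its Dirichlet integral equals ∫
(1/4) η⁴ v sin 4v < ∫ η⁴ v². The scaling x = μ y, with M the slope, yields the factor μ². -/
lemma IsProfile.isUnstable (hμ : 0 < μ) (h : IsProfile μ v m) (hm : Continuous m)
    (hv : ∀ y, HasDerivAt v (m y) y) (h0 : v 0 = 0) (hne : ∀ y ∈ Ioo 0 (1 / μ), v y ≠ 0) :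
    IsUnstable μ := by
  have hR : 0 < 1 / μ := by positivity
  have hvc : Continuous v := continuous_iff_continuousAt.2 fun y => (hv y).continuousAt
  have hw := continuous_wt μ
  have hlt : ∫ y in (0 : ℝ)..1 / μ, wt μ y * m y ^ 2 < ∫ y in (0 : ℝ)..1 / μ, wt μ y ^ 2 * v y ^ 2 := by
    rw [h.integral_wt_mul_slope_sq_radius hμ hm hv h0]
    refine intervalIntegral.integral_lt_integral_of_continuousOn_of_le_of_exists_lt hR
      (Continuous.continuousOn (by fun_prop)) (Continuous.continuousOn (by fun_prop))
      (fun y _ => ?_) ⟨1 / μ / 2, ⟨by positivity, by linarith⟩, ?_⟩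
    · have := mul_le_mul_of_nonneg_left (sin_four_mul_mul_self_le (v y)) (sq_nonneg (wt μ y))
      linarith
    · have hmem : 1 / μ / 2 ∈ Ioo 0 (1 / μ) := ⟨by positivity, by linarith⟩
      have := mul_lt_mul_of_pos_left (sin_four_mul_mul_self_lt (hne _ hmem))
        (pow_pos (wt_pos hμ (Ioo_subset_interv hμ hmem)) 2)
      linarith
  refine ⟨fun x => m (x / μ), by fun_prop, ?_⟩
  have hint : ∀ x, ∫ t in (0 : ℝ)..x, m (t / μ) = μ * v (x / μ) := by
    intro x
    rw [intervalIntegral.integral_comp_div _ hμ.ne', smul_eq_mul,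
      intervalIntegral.integral_eq_sub_of_hasDerivAt (fun y _ => hv y) (hm.intervalIntegrable _ _),
      zero_div, h0, sub_zero]
  have hA : ∫ x in (0 : ℝ)..1, wt 1 x * m (x / μ) ^ 2
      = μ * ∫ y in (0 : ℝ)..1 / μ, wt μ y * m y ^ 2 := by
    have := intervalIntegral.integral_comp_div (a := 0) (b := 1) (fun y => wt μ y * m y ^ 2) hμ.ne'
    simpa only [wt_div hμ.ne', zero_div, smul_eq_mul] using this
  have hB : ∫ x in (0 : ℝ)..1, wt 1 x ^ 2 * (∫ t in (0 : ℝ)..x, m (t / μ)) ^ 2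
      = μ ^ 3 * ∫ y in (0 : ℝ)..1 / μ, wt μ y ^ 2 * v y ^ 2 := by
    have := intervalIntegral.integral_comp_div (a := 0) (b := 1)
      (fun y => wt μ y ^ 2 * v y ^ 2) hμ.ne'
    simp only [wt_div hμ.ne', zero_div, smul_eq_mul] at this
    rw [show μ ^ 3 * ∫ y in (0 : ℝ)..1 / μ, wt μ y ^ 2 * v y ^ 2
      = μ ^ 2 * (μ * ∫ y in (0 : ℝ)..1 / μ, wt μ y ^ 2 * v y ^ 2) by ring, ← this,
      ← intervalIntegral.integral_const_mul]
    refine intervalIntegral.integral_congr fun x _ => ?_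
    simp only [hint]; ring
  rw [hA, hB]
  have := mul_lt_mul_of_pos_left hlt (pow_pos hμ 3)
  calc _ = μ ^ 3 * ∫ y in (0 : ℝ)..1 / μ, wt μ y * m y ^ 2 := by ring
    _ < _ := this

/-- An unstable direction, scaled back to (0, 1/μ), would violate the Poincaré inequality, which
extends to the closed interval by continuity of the primitives. -/
lemma HasSmallProfiles.not_isUnstable (hμ : 0 < μ) (hA : HasSmallProfiles μ) : ¬ IsUnstable μ := by
  rintro ⟨M, hM, hlt⟩
  have hR : 0 < 1 / μ := by positivity
  have hw := continuous_wt μ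
  set w : ℝ → ℝ := fun y => ∫ t in (0 : ℝ)..μ * y, M t with hwdef
  have hwd : ∀ y, HasDerivAt w (M (μ * y) * μ) y := fun y =>
    (intervalIntegral.integral_hasDerivAt_right (hM.intervalIntegrable _ _)
      hM.aestronglyMeasurable.stronglyMeasurableAtFilter hM.continuousAt).comp y
      (((hasDerivAt_id y).const_mul μ).congr_deriv (by simp))
  have hd : deriv w = fun y => M (μ * y) * μ := funext fun y => (hwd y).deriv
  have hwC : ContDiff ℝ 1 w :=
    contDiff_one_iff_deriv.2 ⟨fun y => (hwd y).differentiableAt, by rw [hd]; fun_prop⟩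
  have hwc : Continuous w := hwC.continuous
  have hH := H1loc_of_contDiff (μ := μ) hwC
  have hle : ∫ y in (0 : ℝ)..1 / μ, wt μ y ^ 2 * w y ^ 2
      ≤ ∫ y in (0 : ℝ)..1 / μ, wt μ y * deriv w y ^ 2 := by
    have hc1 := intervalIntegral.continuous_primitive (μ := volume)
      (f := fun y => wt μ y ^ 2 * w y ^ 2)
      (fun a b => Continuous.intervalIntegrable (by fun_prop) a b) 0
    have hc2 := intervalIntegral.continuous_primitive (μ := volume)
      (f := fun y => wt μ y * deriv w y ^ 2)
      (fun a b => Continuous.intervalIntegrable (by rw [hd]; fun_prop) a b) 0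
    refine le_of_tendsto_of_tendsto ((hc1.tendsto (1 / μ)).mono_left
      (nhdsWithin_le_nhds (s := Iio (1 / μ)))) ((hc2.tendsto (1 / μ)).mono_left nhdsWithin_le_nhds) ?_
    filter_upwards [Ioo_mem_nhdsLT hR] with b hb
    exact hA.poincare hμ hb (hH.absolutelyContinuous hμ hb) (hH.intervalIntegrable_sq hμ hb)
      (by simp [hwdef])
  have h1 := intervalIntegral.integral_comp_mul_left (a := 0) (b := 1 / μ)
    (fun x => wt 1 x ^ 2 * (∫ t in (0 : ℝ)..x, M t) ^ 2) hμ.ne'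
  have h2 := intervalIntegral.integral_comp_mul_left (a := 0) (b := 1 / μ)
    (fun x => μ ^ 2 * (wt 1 x * M x ^ 2)) hμ.ne'
  have h3 : ∫ y in (0 : ℝ)..1 / μ, wt μ y * deriv w y ^ 2
      = ∫ y in (0 : ℝ)..1 / μ, μ ^ 2 * (wt 1 (μ * y) * M (μ * y) ^ 2) := by
    refine intervalIntegral.integral_congr fun y _ => ?_
    simp only [hd, wt_one_mul]; ring
  simp only [wt_one_mul, mul_zero, smul_eq_mul, mul_one_div_cancel hμ.ne'] at h1
  rw [h3, h2, mul_zero, smul_eq_mul, mul_one_div_cancel hμ.ne',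
    intervalIntegral.integral_const_mul, h1] at hle
  exact absurd (le_of_mul_le_mul_left hle (inv_pos.2 hμ)) (not_le.2 hlt)

lemma integral_wt_one_nonneg (M : ℝ → ℝ) : 0 ≤ ∫ x in (0 : ℝ)..1, wt 1 x * M x ^ 2 := by
  refine intervalIntegral.integral_nonneg zero_le_one fun x hx => ?_
  have := wt_one_nonneg hx
  positivity

lemma integral_wt_one_primitive_le (hM : Continuous M) :
    ∫ x in (0 : ℝ)..1, wt 1 x ^ 2 * (∫ t in (0 : ℝ)..x, M t) ^ 2
      ≤ ∫ x in (0 : ℝ)..1, wt 1 x * M x ^ 2 := by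
  have hw := continuous_wt 1
  set w : ℝ → ℝ := fun x => ∫ t in (0 : ℝ)..x, M t with hwdef
  have hwd : ∀ y, HasDerivAt w (M y) y := fun y =>
    intervalIntegral.integral_hasDerivAt_right (hM.intervalIntegrable _ _)
      hM.aestronglyMeasurable.stronglyMeasurableAtFilter hM.continuousAt
  have hd : deriv w = M := funext fun y => (hwd y).deriv
  have hwC : ContDiff ℝ 1 w :=
    contDiff_one_iff_deriv.2 ⟨fun y => (hwd y).differentiableAt, by rw [hd]; exact hM⟩
  have hwc : Continuous w := hwC.continuous
  set A := ∫ x in (0 : ℝ)..1, wt 1 x * M x ^ 2 with hAdef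
  have hA0 : 0 ≤ A := integral_wt_one_nonneg M
  -- Cauchy–Schwarz gives w(x)² ≤ x ∫₀ˣ M². The decreasing weight can be moved inside that integral,
  -- and the remaining factor wt(x) · x is at most 1.
  have hpt : ∀ x ∈ Icc (0 : ℝ) 1, wt 1 x ^ 2 * w x ^ 2 ≤ A := by
    intro x hx
    have hp := wt_one_nonneg hx
    have hp1 := wt_le_one 1 x
    rcases eq_or_lt_of_le hx.1 with h0 | h0
    · rw [← h0, show w 0 = 0 by simp [hwdef]]; simpa using hA0
    · have h1 := sq_le_mul_integral_deriv_sq h0 hwC.contDiffOn.absolutelyContinuousOnInterval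
        (by rw [hd]; exact (hM.pow 2).intervalIntegrable _ _) (by simp [hwdef])
      rw [hd] at h1
      have hI0 : 0 ≤ ∫ t in (0 : ℝ)..x, M t ^ 2 :=
        intervalIntegral.integral_nonneg h0.le fun t _ => sq_nonneg _
      have h2 : wt 1 x * ∫ t in (0 : ℝ)..x, M t ^ 2 ≤ ∫ t in (0 : ℝ)..x, wt 1 t * M t ^ 2 := by
        rw [← intervalIntegral.integral_const_mul]
        refine intervalIntegral.integral_mono_on h0.le
          (Continuous.intervalIntegrable (by fun_prop) _ _)
          (Continuous.intervalIntegrable (by fun_prop) _ _) fun t ht => ?_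
        refine mul_le_mul_of_nonneg_right ?_ (sq_nonneg _)
        have h3 := ht.1
        have h4 := ht.2
        simp only [wt, one_mul]; nlinarith
      have h3 : ∫ t in (0 : ℝ)..x, wt 1 t * M t ^ 2 ≤ A := by
        refine intervalIntegral.integral_mono_interval le_rfl h0.le hx.2 ?_
          (Continuous.intervalIntegrable (by fun_prop) _ _)
        rw [Filter.EventuallyLE, ae_restrict_iff' measurableSet_Ioc]
        refine Eventually.of_forall fun t ht => ?_
        have := wt_one_nonneg (Ioc_subset_Icc_self ht)
        simp only [Pi.zero_apply]; positivity
      calc wt 1 x ^ 2 * w x ^ 2 ≤ wt 1 x ^ 2 * (x * ∫ t in (0 : ℝ)..x, M t ^ 2) := by gcongr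
        _ = (wt 1 x * x) * (wt 1 x * ∫ t in (0 : ℝ)..x, M t ^ 2) := by ring
        _ ≤ 1 * A := by
          gcongr
          · exact mul_le_one₀ hp1 hx.1 hx.2
          · exact h2.trans h3
        _ = A := one_mul A
  calc _ ≤ ∫ _ in (0 : ℝ)..1, A := intervalIntegral.integral_mono_on zero_le_one
        (Continuous.intervalIntegrable (by fun_prop) _ _) (by simp) hpt
    _ = A := by simp

lemma IsUnstable.lt_one (h : IsUnstable μ) : μ < 1 := by
  obtain ⟨M, hM, hlt⟩ := h
  have h1 := integral_wt_one_primitive_le hM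
  have h2 := integral_wt_one_nonneg M
  by_contra! hcon
  have := mul_le_mul_of_nonneg_right (one_le_pow₀ hcon : 1 ≤ μ ^ 2) h2
  linarith

lemma IsUnstable.mono (hμ : 0 < μ) {μ' : ℝ} (hle : μ ≤ μ') (h : IsUnstable μ') : IsUnstable μ := by
  obtain ⟨M, hM, hlt⟩ := h
  refine ⟨M, hM, lt_of_le_of_lt ?_ hlt⟩
  have h2 := integral_wt_one_nonneg M
  gcongr

/-- The defining inequality is strict and, for fixed M, continuous in μ. Hence the supremum of the
unstable parameters is not itself unstable. -/
lemma IsUnstable.exists_gt (h : IsUnstable μ) : ∃ μ' > μ, IsUnstable μ' := by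
  obtain ⟨M, hM, hlt⟩ := h
  have hc : Continuous fun s : ℝ => s ^ 2 * ∫ x in (0 : ℝ)..1, wt 1 x * M x ^ 2 := by fun_prop
  have h1 : ∀ᶠ s in 𝓝[>] μ, IsUnstable s :=
    (((hc.tendsto μ).eventually (gt_mem_nhds hlt)).filter_mono nhdsWithin_le_nhds).mono
      fun s hs => ⟨M, hM, hs⟩
  obtain ⟨s, hs1, hs2⟩ := (h1.and self_mem_nhdsWithin).exists
  exact ⟨s, hs2, hs1⟩

lemma isUnstable_one_div_four : IsUnstable (1 / 4) := by
  -- The linear phase w(x) = x suffices: (1/16)(2/3) < 8/105.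
  refine ⟨fun _ => 1, continuous_const, ?_⟩
  have h1 : ∫ x in (0 : ℝ)..1, wt 1 x * 1 ^ 2 = 2 / 3 := by
    simp only [wt, one_mul, one_pow, mul_one]
    rw [intervalIntegral.integral_sub (by simp) (Continuous.intervalIntegrable (by fun_prop) _ _)]
    norm_num
  have h2 : ∫ x in (0 : ℝ)..1, wt 1 x ^ 2 * (∫ _ in (0 : ℝ)..x, (1 : ℝ)) ^ 2 = 8 / 105 := by
    have : ∀ x : ℝ, wt 1 x ^ 2 * (∫ _ in (0 : ℝ)..x, (1 : ℝ)) ^ 2 = x ^ 2 - 2 * x ^ 4 + x ^ 6 := by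
      intro x; simp [wt]; ring
    simp only [this]
    rw [intervalIntegral.integral_add (Continuous.intervalIntegrable (by fun_prop) _ _)
      (Continuous.intervalIntegrable (by fun_prop) _ _),
      intervalIntegral.integral_sub (Continuous.intervalIntegrable (by fun_prop) _ _)
      (Continuous.intervalIntegrable (by fun_prop) _ _), intervalIntegral.integral_const_mul]
    norm_num
  rw [h1, h2]; norm_num

theorem exists_threshold : ∃ μ₀ : ℝ, 0 < μ₀ ∧ (∀ μ, μ₀ ≤ μ → ¬ IsUnstable μ) ∧
    ∀ μ, 0 < μ → μ < μ₀ → IsUnstable μ := by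
  set S : Set ℝ := {μ | 0 < μ ∧ IsUnstable μ} with hS
  have hmem : (1 / 4 : ℝ) ∈ S := ⟨by norm_num, isUnstable_one_div_four⟩
  have hbdd : BddAbove S := ⟨1, fun μ h => (h.2.lt_one).le⟩
  have hpos : 0 < sSup S := lt_of_lt_of_le (by norm_num) (le_csSup hbdd hmem)
  refine ⟨sSup S, hpos, fun μ hμ hU => ?_, fun μ hμ hlt => ?_⟩
  · obtain ⟨μ', hgt, hU'⟩ := hU.exists_gt
    exact absurd (le_csSup hbdd ⟨(hpos.trans_le hμ).trans hgt, hU'⟩)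
      (not_le.2 (hμ.trans_lt hgt))
  · obtain ⟨μ', hμ', hlt'⟩ := exists_lt_of_lt_csSup ⟨_, hmem⟩ hlt
    exact hμ'.2.mono hμ hlt'.le

end Threshold

end DomainWall

/-! ### From phases back to states. -/

namespace DomainWall

/-- Globally `C¹` odd phases of positive domain walls. -/
structure IsWallPhase (μ : ℝ) (v : ℝ → ℝ) : Prop where
  contDiff : ContDiff ℝ 1 v
  odd : ∀ y, v (-y) = -v y
  isProfile : IsProfile μ v (deriv v)
  mem : ∀ y ∈ Ioo 0 (1 / μ), v y ∈ Ioo 0 (Real.pi / 4)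

section States

variable {μ κ : ℝ} {v w f : ℝ → ℝ} {Θ : State}

lemma eq_zero_of_odd (hμ : 0 < μ) (hodd : ∀ y ∈ interv μ, w (-y) = -w y) : w 0 = 0 := by
  have := hodd 0 (zero_mem_interv hμ)
  rw [neg_zero] at this
  linarith

lemma sq_one_div_sqrt_two : (1 / √2 : ℝ) ^ 2 = 1 / 2 := by
  rw [div_pow, Real.sq_sqrt zero_le_two, one_pow]

lemma symmetricState_eq_phaseState : symmetricState = phaseState (1 / √2) fun _ => 0 := by
  simp [symmetricState, phaseState]

lemma energy_phaseState (hμ : 0 < μ) (hw : ContDiff ℝ 1 w) (hodd : ∀ y, w (-y) = -w y) :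
    energy μ (phaseState (1 / √2) w) = halfEnergy μ w :=
  (hasPhase_phaseState sq_one_div_sqrt_two).energy_eq_halfEnergy hμ
    (Eventually.of_forall fun y _ => hw.differentiable one_ne_zero y) fun y _ => hodd y

lemma energy_symmetricState (hμ : 0 < μ) : energy μ symmetricState = halfEnergy μ fun _ => 0 := by
  rw [symmetricState_eq_phaseState, energy_phaseState hμ contDiff_const (by simp)]

lemma symmetricState_mem_symmSpace (hμ : 0 < μ) : symmetricState ∈ symmSpace μ := by
  rw [symmetricState_eq_phaseState]
  exact phaseState_mem_symmSpace hμ sq_one_div_sqrt_two contDiff_const (by simp)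

lemma HasPhase.fst_sub_snd (h : HasPhase μ κ w Θ) {y : ℝ} (hy : y ∈ interv μ) :
    Θ.1 y - Θ.2 y = 2 * κ * Real.sin (w y) := by
  rw [h.fst y hy, h.snd y hy]; ring

lemma HasPhase.ne_zero (h : HasPhase μ κ w Θ) : κ ≠ 0 := by
  rintro rfl
  have := h.sq
  norm_num at this

/-- The phase of a critical point is a regular solution of the Euler–Lagrange equation. -/
lemma IsCriticalPoint.exists_isProfile (hμ : 0 < μ) (hc : IsCriticalPoint μ Θ) :
    ∃ κ w m, HasPhase μ κ w Θ ∧ H1loc μ w ∧ (∀ y ∈ interv μ, w (-y) = -w y) ∧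
      IsProfile μ w m := by
  obtain ⟨κ, w, h, hw, hodd⟩ := exists_phase hμ hc.1
  obtain ⟨m, hm⟩ := DomainWall.exists_isProfile hμ hw hodd
    (h.integrableOn_phaseDensity hμ (hw.continuousOn hμ) (hw.ae_differentiableAt hμ) hc.1.2.2.2)
    ((isCriticalPoint_iff hμ h hw hc.1).1 hc)
  exact ⟨κ, w, m, h, hw, hodd, hm⟩

lemma isGlobalMinimizer_of_halfEnergy_le (hμ : 0 < μ) (hΘ : Θ ∈ symmSpace μ)
    (h : ∀ w, H1loc μ w → w 0 = 0 → energy μ Θ ≤ halfEnergy μ w) : IsGlobalMinimizer μ Θ := by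
  refine ⟨hΘ, fun Ξ hΞ => ?_⟩
  obtain ⟨κ, w, hp, hw, hodd⟩ := exists_phase hμ hΞ
  rw [hp.energy_eq_halfEnergy hμ (hw.ae_differentiableAt hμ) hodd]
  exact h w hw (eq_zero_of_odd hμ hodd)

theorem HasSmallProfiles.isGlobalMinimizer (hμ : 0 < μ) (hA : HasSmallProfiles μ) :
    IsGlobalMinimizer μ symmetricState :=
  isGlobalMinimizer_of_halfEnergy_le hμ (symmetricState_mem_symmSpace hμ) fun w hw hw0 => by
    rw [energy_symmetricState hμ]; exact hA.halfEnergy_zero_le hμ hw hw0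

theorem HasSmallProfiles.not_isDomainWallState (hμ : 0 < μ) (hA : HasSmallProfiles μ) :
    ¬ IsDomainWallState μ Θ := by
  rintro ⟨hc, y, hy, hne⟩
  obtain ⟨κ, w, m, hp, hw, hodd, hprof⟩ := hc.exists_isProfile hμ
  have h0 := eq_zero_of_odd hμ hodd
  have hz := hA.eq_zero hμ hprof hw h0
  have hwy : w y = 0 := by
    rcases lt_trichotomy y 0 with h | rfl | h
    · have h1 := hz (-y) ⟨by linarith, (neg_mem_interv hy).2⟩
      rw [hodd y hy] at h1
      linarith
    · exact h0
    · exact hz y ⟨h, hy.2⟩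
  have := hp.fst_sub_snd hy
  rw [hwy, Real.sin_zero, mul_zero] at this
  exact hne (by linarith)

lemma hasSmallProfiles_or_exists_isWallPhase (hμ : 0 < μ) :
    HasSmallProfiles μ ∨ ∃ v, IsWallPhase μ v := by
  refine (shooting_dichotomy hμ).imp id ?_
  rintro ⟨v, m, hP, hm, heven, hd, h0, hmem⟩
  have hdv : deriv v = m := funext fun y => (hd y).deriv
  have hdiff : Differentiable ℝ v := fun y => (hd y).differentiableAt
  refine ⟨v, contDiff_one_iff_deriv.2 ⟨hdiff, by rwa [hdv]⟩, fun y => ?_, by rwa [hdv], hmem⟩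
  -- The slope is even, so v(-y) + v(y) is constant, and v(0) = 0 makes the constant zero.
  have hsum : ∀ y, HasDerivAt (fun y => v (-y) + v y) 0 y := fun y =>
    (((hd (-y)).comp y (hasDerivAt_neg y)).add (hd y)).congr_deriv (by rw [heven]; ring)
  have := is_const_of_deriv_eq_zero (fun y => (hsum y).differentiableAt) (fun y => (hsum y).deriv) y 0
  simp only [neg_zero, h0, add_zero] at this
  linarith

lemma IsWallPhase.zero (h : IsWallPhase μ v) : v 0 = 0 := by
  have := h.odd 0
  rw [neg_zero] at this
  linarith

lemma IsWallPhase.hasDerivAt (h : IsWallPhase μ v) (y : ℝ) : HasDerivAt v (deriv v y) y :=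
  (h.contDiff.differentiable one_ne_zero y).hasDerivAt

lemma IsWallPhase.isUnstable (hμ : 0 < μ) (h : IsWallPhase μ v) : IsUnstable μ :=
  h.isProfile.isUnstable hμ (h.contDiff.continuous_deriv le_rfl) h.hasDerivAt h.zero
    fun y hy => (h.mem y hy).1.ne'

/-- The instability excludes the small-solution branch of the shooting dichotomy, so existence of a
wall needs no compactness of minimizing sequences. -/
lemma IsUnstable.exists_isWallPhase (hμ : 0 < μ) (h : IsUnstable μ) : ∃ v, IsWallPhase μ v :=
  (hasSmallProfiles_or_exists_isWallPhase hμ).resolve_left fun hA => hA.not_isUnstable hμ h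

lemma hasSmallProfiles_of_not_isUnstable (hμ : 0 < μ) (h : ¬ IsUnstable μ) : HasSmallProfiles μ :=
  (hasSmallProfiles_or_exists_isWallPhase hμ).resolve_right fun ⟨_, hv⟩ => h (hv.isUnstable hμ)

lemma continuous_phaseDensity (hw : ContDiff ℝ 1 w) : Continuous (phaseDensity μ w) := by
  have h1 := hw.continuous_deriv le_rfl
  have h2 := hw.continuous
  have h3 := continuous_wt μ
  unfold phaseDensity
  fun_prop

lemma halfEnergy_eq_ofReal (hμ : 0 < μ) (hw : ContDiff ℝ 1 w) :
    halfEnergy μ w = ENNReal.ofReal (∫ y in (0 : ℝ)..1 / μ, phaseDensity μ w y) := by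
  have hR : 0 < 1 / μ := by positivity
  rw [intervalIntegral.integral_of_le hR.le, integral_Ioc_eq_integral_Ioo, halfEnergy,
    ofReal_integral_eq_lintegral_ofReal]
  · exact ((continuous_phaseDensity hw).integrableOn_Icc).mono_set Ioo_subset_Icc_self
  · rw [Filter.EventuallyLE, ae_restrict_iff' measurableSet_Ioo]
    exact Eventually.of_forall fun y hy => phaseDensity_nonneg hμ (Ioo_subset_interv hμ hy)

lemma halfEnergy_lt (hμ : 0 < μ) (hw : ContDiff ℝ 1 w) (hf : ContDiff ℝ 1 f)
    (hlt : ∫ y in (0 : ℝ)..1 / μ, phaseDensity μ w y < ∫ y in (0 : ℝ)..1 / μ, phaseDensity μ f y) :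
    halfEnergy μ w < halfEnergy μ f := by
  rw [halfEnergy_eq_ofReal hμ hw, halfEnergy_eq_ofReal hμ hf]
  refine (ENNReal.ofReal_lt_ofReal_iff (lt_of_le_of_lt ?_ hlt)).2 hlt
  have hR : 0 < 1 / μ := by positivity
  rw [intervalIntegral.integral_of_le hR.le, integral_Ioc_eq_integral_Ioo]
  exact setIntegral_nonneg measurableSet_Ioo fun y hy =>
    phaseDensity_nonneg hμ (Ioo_subset_interv hμ hy)

/-- Both |cos w - 1| and |sin w| are at most |w|, whence 2η; the weighted derivative term equals η₀²
w'² ≤ η², integrated over an interval of length 2/μ. -/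
lemma isClose_phaseState (hμ : 0 < μ) (hw : ContDiff ℝ 1 w) {η δ : ℝ}
    (h0 : ∀ y ∈ interv μ, |w y| ≤ η) (h1 : ∀ y ∈ interv μ, |deriv w y| ≤ η) (hη : 2 * η ≤ δ)
    (hη2 : η ^ 2 * (2 * (1 / μ)) ≤ δ ^ 2) :
    IsClose μ δ symmetricState (phaseState (1 / √2) w) := by
  have hκ := sq_one_div_sqrt_two
  set κ : ℝ := 1 / √2 with hκdef
  have hκ0 : 0 ≤ κ := by positivity
  have hκ1 : κ ≤ 1 := by nlinarith
  have hp : HasPhase μ κ w (phaseState κ w) := hasPhase_phaseState hκ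
  have hbound : ∀ y ∈ interv μ, ∀ s : ℝ, |s| = |Real.sin (w y)| →
      |κ * (Real.cos (w y) + s) - κ| ≤ δ := by
    intro y hy s hs
    have hc := Real.abs_cos_sub_cos_le (w y) 0
    rw [Real.cos_zero, sub_zero] at hc
    have hsin := Real.abs_sin_le_abs (x := w y)
    calc |κ * (Real.cos (w y) + s) - κ| = κ * |(Real.cos (w y) - 1) + s| := by
          rw [← abs_of_nonneg hκ0, ← abs_mul, abs_of_nonneg hκ0]; ring_nf
      _ ≤ 1 * (|Real.cos (w y) - 1| + |s|) := by gcongr; exact abs_add_le _ _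
      _ ≤ δ := by rw [hs]; linarith [h0 y hy]
  refine ⟨fun y hy => ⟨?_, ?_⟩, ?_⟩
  · exact hbound y hy _ rfl
  · exact hbound y hy (-Real.sin (w y)) (abs_neg _)
  · refine (setLIntegral_mono' (g := fun _ => ENNReal.ofReal (η ^ 2)) (measurableSet_interv μ)
      fun y hy => ENNReal.ofReal_le_ofReal ?_).trans ?_
    · obtain ⟨d1, d2⟩ := hp.hasDerivAt hy (hw.differentiable one_ne_zero y)
      have hd : ∀ c : ℝ, deriv (fun _ : ℝ => c) y = 0 := fun c => by simp
      rw [d1.deriv, d2.deriv, symmetricState, hd, sub_zero, sub_zero, eta0_sq hμ hy]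
      have hwp := (wt_pos hμ hy).le
      have hw1 := wt_le_one μ y
      have hdw : deriv w y ^ 2 ≤ η ^ 2 := by
        rw [← sq_abs]
        exact pow_le_pow_left₀ (abs_nonneg _) (h1 y hy) 2
      have hsc := Real.sin_sq_add_cos_sq (w y)
      calc _ = wt μ y * (2 * κ ^ 2 * (Real.sin (w y) ^ 2 + Real.cos (w y) ^ 2) * deriv w y ^ 2) := by
            ring
        _ = wt μ y * deriv w y ^ 2 := by rw [hsc, hκ]; ring
        _ ≤ 1 * η ^ 2 := by gcongr
        _ = η ^ 2 := one_mul _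
    · rw [setLIntegral_const, interv_eq, Real.volume_Ioo, ← ENNReal.ofReal_mul (sq_nonneg η)]
      refine ENNReal.ofReal_le_ofReal (le_trans (le_of_eq ?_) hη2)
      ring

/-- Small multiples of a `C¹` odd phase give states close to the symmetric one. -/
lemma exists_isClose_phaseState (hμ : 0 < μ) (hf : ContDiff ℝ 1 f) {δ : ℝ} (hδ : 0 < δ) :
    ∃ ε ∈ Ioo (0 : ℝ) 1, IsClose μ δ symmetricState (phaseState (1 / √2) fun y => ε * f y) := by
  obtain ⟨C₀, hC₀⟩ := isCompact_Icc.exists_bound_of_continuousOn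
    (hf.continuous.continuousOn (s := Icc (-(1 / μ)) (1 / μ)))
  obtain ⟨C₁, hC₁⟩ := isCompact_Icc.exists_bound_of_continuousOn
    ((hf.continuous_deriv le_rfl).continuousOn (s := Icc (-(1 / μ)) (1 / μ)))
  set C := max C₀ C₁ with hC
  have hc1 : Continuous fun ε : ℝ => 2 * (ε * C) := by fun_prop
  have hc2 : Continuous fun ε : ℝ => (ε * C) ^ 2 * (2 * (1 / μ)) := by fun_prop
  have e1 : ∀ᶠ ε : ℝ in 𝓝[>] 0, 2 * (ε * C) < δ :=
    ((hc1.tendsto 0).eventually (gt_mem_nhds (by simpa using hδ))).filter_mono nhdsWithin_le_nhds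
  have e2 : ∀ᶠ ε : ℝ in 𝓝[>] 0, (ε * C) ^ 2 * (2 * (1 / μ)) < δ ^ 2 :=
    ((hc2.tendsto 0).eventually (gt_mem_nhds (by simpa using pow_pos hδ 2))).filter_mono
      nhdsWithin_le_nhds
  obtain ⟨ε, h1, h2, hε⟩ := (e1.and (e2.and (Ioo_mem_nhdsGT zero_lt_one))).exists
  refine ⟨ε, hε, isClose_phaseState hμ (contDiff_const.mul hf) (η := ε * C) (fun y hy => ?_)
    (fun y hy => ?_) h1.le h2.le⟩
  · rw [abs_mul, abs_of_pos hε.1]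
    exact mul_le_mul_of_nonneg_left ((hC₀ y (Ioo_subset_Icc_self hy)).trans (le_max_left _ _)) hε.1.le
  · rw [deriv_const_mul_field, abs_mul, abs_of_pos hε.1]
    exact mul_le_mul_of_nonneg_left ((hC₁ y (Ioo_subset_Icc_self hy)).trans (le_max_right _ _)) hε.1.le

lemma phaseDensity_zero (μ : ℝ) : phaseDensity μ (fun _ => 0) = fun y => 1 / 4 * wt μ y ^ 2 := by
  funext y; simp [phaseDensity]

lemma phaseDensity_const_mul (μ ε : ℝ) (f : ℝ → ℝ) (y : ℝ) : phaseDensity μ (fun y => ε * f y) y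
    = ε ^ 2 * (wt μ y * deriv f y ^ 2)
      + (1 / 4 * wt μ y ^ 2 - 1 / 4 * wt μ y ^ 2 * Real.sin (2 * (ε * f y)) ^ 2) := by
  rw [phaseDensity, deriv_const_mul_field, Real.cos_sq']; ring

/-- Two comparisons: sin(4x) x = sin(2x) · 2x cos(2x) < sin²(2x) because tan exceeds its argument,
and ε sin(2x) < sin(2εx) by concavity. -/
lemma sq_mul_sin_four_mul_lt {ε x : ℝ} (hε : ε ∈ Ioo (0 : ℝ) 1) (hx : x ∈ Ioo 0 (Real.pi / 4)) :
    ε ^ 2 * (Real.sin (4 * x) * x) < Real.sin (2 * (ε * x)) ^ 2 := by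
  have hx0 := hx.1
  have hxπ := hx.2
  have hε0 := hε.1
  have h1 := mul_sin_lt_mul_sin (x := 2 * (ε * x)) (y := 2 * x) (by positivity)
    (by nlinarith [hε.2]) (by linarith [Real.pi_pos])
  have h2 : ε * Real.sin (2 * x) < Real.sin (2 * (ε * x)) := by
    refine lt_of_mul_lt_mul_left (a := 2 * x) ?_ (by positivity)
    linarith
  have hcos : 0 < Real.cos (2 * x) := Real.cos_pos_of_mem_Ioo ⟨by linarith, by linarith⟩
  have hsin : 0 < Real.sin (2 * x) := Real.sin_pos_of_pos_of_lt_pi (by linarith) (by linarith)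
  have h3 : 2 * x * Real.cos (2 * x) < Real.sin (2 * x) := by
    have := Real.lt_tan (x := 2 * x) (by linarith) (by linarith)
    rwa [Real.tan_eq_sin_div_cos, lt_div_iff₀ hcos] at this
  have h4 : Real.sin (4 * x) = 2 * Real.sin (2 * x) * Real.cos (2 * x) := by
    rw [← Real.sin_two_mul]; ring_nf
  calc ε ^ 2 * (Real.sin (4 * x) * x)
      = ε ^ 2 * Real.sin (2 * x) * (2 * x * Real.cos (2 * x)) := by rw [h4]; ring
    _ < ε ^ 2 * Real.sin (2 * x) * Real.sin (2 * x) := by gcongr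
    _ = (ε * Real.sin (2 * x)) ^ 2 := by ring
    _ < Real.sin (2 * (ε * x)) ^ 2 := by gcongr

/-- The Dirichlet energy of εv is ε² ∫ (1/4) η⁴ v sin 4v by the equation, and it is outweighed by
the gain ∫ (1/4) η⁴ sin²(2εv). No expansion for small ε is involved: every ε in (0, 1) works. -/
lemma IsWallPhase.halfEnergy_lt_zero (hμ : 0 < μ) (h : IsWallPhase μ v) {ε : ℝ}
    (hε : ε ∈ Ioo (0 : ℝ) 1) : halfEnergy μ (fun y => ε * v y) < halfEnergy μ fun _ => 0 := by
  have hR : 0 < 1 / μ := by positivity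
  refine halfEnergy_lt hμ (contDiff_const.mul h.contDiff) contDiff_const ?_
  have hc := h.contDiff.continuous
  have hdc := h.contDiff.continuous_deriv le_rfl
  have hwt := continuous_wt μ
  have i1 : IntervalIntegrable (fun y => wt μ y * deriv v y ^ 2) volume 0 (1 / μ) :=
    Continuous.intervalIntegrable (by fun_prop) _ _
  have i2 : IntervalIntegrable (fun y => 1 / 4 * wt μ y ^ 2) volume 0 (1 / μ) :=
    Continuous.intervalIntegrable (by fun_prop) _ _
  have i3 : IntervalIntegrable (fun y => 1 / 4 * wt μ y ^ 2 * Real.sin (2 * (ε * v y)) ^ 2)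
      volume 0 (1 / μ) := Continuous.intervalIntegrable (by fun_prop) _ _
  simp only [phaseDensity_const_mul]
  rw [phaseDensity_zero, intervalIntegral.integral_add (i1.const_mul _) (i2.sub i3),
    intervalIntegral.integral_sub i2 i3, intervalIntegral.integral_const_mul,
    h.isProfile.integral_wt_mul_slope_sq_radius hμ hdc h.hasDerivAt h.zero,
    ← intervalIntegral.integral_const_mul]
  have hpt : ∀ y ∈ Ioo 0 (1 / μ), ε ^ 2 * (1 / 4 * wt μ y ^ 2 * Real.sin (4 * v y) * v y)
      < 1 / 4 * wt μ y ^ 2 * Real.sin (2 * (ε * v y)) ^ 2 := by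
    intro y hy
    have hwp := wt_pos hμ (Ioo_subset_interv hμ hy)
    calc _ = 1 / 4 * wt μ y ^ 2 * (ε ^ 2 * (Real.sin (4 * v y) * v y)) := by ring
      _ < _ := by gcongr; exact sq_mul_sin_four_mul_lt hε (h.mem y hy)
  have : ∫ y in (0 : ℝ)..1 / μ, ε ^ 2 * (1 / 4 * wt μ y ^ 2 * Real.sin (4 * v y) * v y)
      < ∫ y in (0 : ℝ)..1 / μ, 1 / 4 * wt μ y ^ 2 * Real.sin (2 * (ε * v y)) ^ 2 := by
    refine intervalIntegral.integral_lt_integral_of_continuousOn_of_le_of_exists_lt hR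
      (Continuous.continuousOn (by fun_prop)) (Continuous.continuousOn (by fun_prop))
      (fun y hy => ?_) ⟨1 / μ / 2, ⟨by positivity, by linarith⟩,
        hpt _ ⟨by positivity, by linarith⟩⟩
    rcases eq_or_lt_of_le hy.2 with h' | h'
    · rw [h', wt_radius hμ]; simp
    · exact (hpt y ⟨hy.1, h'⟩).le
  linarith

/-- A steep power costs more Dirichlet energy than it gains, already pointwise: the comparison
reduces to y² < n², which holds since y < 1/μ < n. -/
lemma halfEnergy_zero_lt_pow (hμ : 0 < μ) {n : ℕ} (hn : 1 / μ < n) {ε : ℝ} (hε : 0 < ε) :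
    halfEnergy μ (fun _ => 0) < halfEnergy μ fun y => ε * y ^ n := by
  have hR : 0 < 1 / μ := by positivity
  have hf : ContDiff ℝ 1 fun y : ℝ => y ^ n := contDiff_id.pow n
  obtain ⟨k, rfl⟩ : ∃ k, n = k + 1 :=
    Nat.exists_eq_succ_of_ne_zero (by rintro rfl; simp at hn; linarith)
  refine halfEnergy_lt hμ contDiff_const (contDiff_const.mul hf) ?_
  have hpt : ∀ y ∈ Ioo 0 (1 / μ), phaseDensity μ (fun _ => 0) y
      < phaseDensity μ (fun y => ε * y ^ (k + 1)) y := by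
    intro y hy
    have hwp := wt_pos hμ (Ioo_subset_interv hμ hy)
    have hw1 := wt_le_one μ y
    have hy0 := hy.1
    have hd : deriv (fun y : ℝ => y ^ (k + 1)) y = (k + 1 : ℕ) * y ^ k := by simp
    rw [phaseDensity_zero, phaseDensity_const_mul, hd]
    have hsin : Real.sin (2 * (ε * y ^ (k + 1))) ^ 2 ≤ (2 * (ε * y ^ (k + 1))) ^ 2 :=
      sq_le_sq.2 Real.abs_sin_le_abs
    have hyn : y ^ 2 < ((k + 1 : ℕ) : ℝ) ^ 2 := by
      have := hy.2.trans hn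
      gcongr
    have hkey : 1 / 4 * wt μ y ^ 2 * Real.sin (2 * (ε * y ^ (k + 1))) ^ 2
        < ε ^ 2 * (wt μ y * (((k + 1 : ℕ) : ℝ) * y ^ k) ^ 2) :=
      calc _ ≤ 1 / 4 * wt μ y ^ 2 * (2 * (ε * y ^ (k + 1))) ^ 2 := by gcongr
        _ = ε ^ 2 * (wt μ y * (y ^ k) ^ 2 * (wt μ y * y ^ 2)) := by ring
        _ ≤ ε ^ 2 * (wt μ y * (y ^ k) ^ 2 * (1 * y ^ 2)) := by gcongr
        _ < ε ^ 2 * (wt μ y * (y ^ k) ^ 2 * (1 * ((k + 1 : ℕ) : ℝ) ^ 2)) := by gcongr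
        _ = _ := by ring
    linarith
  refine intervalIntegral.integral_lt_integral_of_continuousOn_of_le_of_exists_lt hR
    (continuous_phaseDensity contDiff_const).continuousOn
    (continuous_phaseDensity (contDiff_const.mul hf)).continuousOn
    (fun y hy => ?_) ⟨1 / μ / 2, ⟨by positivity, by linarith⟩, hpt _ ⟨by positivity, by linarith⟩⟩
  rcases eq_or_lt_of_le hy.2 with h' | h'
  · rw [h', phaseDensity, phaseDensity, wt_radius hμ]; simp
  · exact (hpt y ⟨hy.1, h'⟩).le

lemma isCriticalPoint_symmetricState (hμ : 0 < μ) : IsCriticalPoint μ symmetricState := by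
  have hmem := symmetricState_mem_symmSpace hμ
  rw [symmetricState_eq_phaseState] at hmem ⊢
  refine (isCriticalPoint_iff hμ (hasPhase_phaseState sq_one_div_sqrt_two)
    (H1loc_of_contDiff contDiff_const) hmem).2 fun φ _ => ?_
  simp [firstVariation]

theorem IsWallPhase.isSaddlePoint (hμ : 0 < μ) (h : IsWallPhase μ v) :
    IsSaddlePoint μ symmetricState := by
  refine ⟨isCriticalPoint_symmetricState hμ, fun δ hδ => ⟨?_, ?_⟩⟩
  · obtain ⟨ε, hε, hclose⟩ := exists_isClose_phaseState hμ h.contDiff hδ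
    have hC : ContDiff ℝ 1 fun y => ε * v y := contDiff_const.mul h.contDiff
    have hodd : ∀ y, ε * v (-y) = -(ε * v y) := fun y => by rw [h.odd]; ring
    refine ⟨_, phaseState_mem_symmSpace hμ sq_one_div_sqrt_two hC hodd, hclose, ?_⟩
    rw [energy_symmetricState hμ, energy_phaseState hμ hC hodd]
    exact h.halfEnergy_lt_zero hμ hε
  -- The odd exponent 2n + 1 keeps the phase odd and still exceeds 1/μ.
  · obtain ⟨n, hn⟩ := exists_nat_gt (1 / μ)
    have hn' : 1 / μ < ((2 * n + 1 : ℕ) : ℝ) := by push_cast; linarith [(Nat.cast_nonneg n : (0 : ℝ) ≤ n)]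
    have hf : ContDiff ℝ 1 fun y : ℝ => y ^ (2 * n + 1) := contDiff_id.pow _
    obtain ⟨ε, hε, hclose⟩ := exists_isClose_phaseState hμ hf hδ
    have hC : ContDiff ℝ 1 fun y => ε * y ^ (2 * n + 1) := contDiff_const.mul hf
    have hodd : ∀ y : ℝ, ε * (-y) ^ (2 * n + 1) = -(ε * y ^ (2 * n + 1)) := fun y => by
      rw [Odd.neg_pow ⟨n, rfl⟩]; ring
    refine ⟨_, phaseState_mem_symmSpace hμ sq_one_div_sqrt_two hC hodd, hclose, ?_⟩
    rw [energy_symmetricState hμ, energy_phaseState hμ hC hodd]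
    exact halfEnergy_zero_lt_pow hμ hn' hε.1

lemma firstVariation_congr (heq : EqOn v w (interv μ)) (φ : ℝ → ℝ) :
    firstVariation μ v φ = firstVariation μ w φ := by
  refine setIntegral_congr_fun (measurableSet_interv μ) fun y hy => ?_
  have hd : deriv v y = deriv w y :=
    (heq.eventuallyEq_of_mem ((isOpen_interv μ).mem_nhds hy)).deriv_eq
  simp only [hd, heq hy]

lemma firstVariation_neg (μ : ℝ) (v φ : ℝ → ℝ) :
    firstVariation μ (fun y => -v y) φ = -firstVariation μ v φ := by
  rw [firstVariation, firstVariation, ← integral_neg]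
  congr 1
  funext y
  rw [deriv.fun_neg, mul_neg 4, Real.sin_neg]
  ring

lemma halfEnergy_neg (μ : ℝ) (w : ℝ → ℝ) : halfEnergy μ (fun y => -w y) = halfEnergy μ w := by
  have : phaseDensity μ (fun y => -w y) = phaseDensity μ w := by
    funext y
    rw [phaseDensity, phaseDensity, deriv.fun_neg, mul_neg, Real.cos_neg, neg_sq]
  rw [halfEnergy, this, halfEnergy]

lemma eqOn_interv_of_odd (hμ : 0 < μ) (hv : ∀ y ∈ interv μ, v (-y) = -v y)
    (hw : ∀ y ∈ interv μ, w (-y) = -w y) (h : EqOn v w (Ioo 0 (1 / μ))) : EqOn v w (interv μ) := by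
  intro y hy
  rcases lt_trichotomy y 0 with h' | rfl | h'
  · have h1 := h (x := -y) ⟨by linarith, (neg_mem_interv hy).2⟩
    rw [hv y hy, hw y hy] at h1
    exact neg_injective h1
  · rw [eq_zero_of_odd hμ hv, eq_zero_of_odd hμ hw]
  · exact h ⟨h', hy.2⟩

theorem IsWallPhase.isDomainWallState (hμ : 0 < μ) (h : IsWallPhase μ v) :
    IsDomainWallState μ (phaseState (1 / √2) v) ∧
      ∀ y ∈ Ioo 0 (1 / μ), 0 < (phaseState (1 / √2) v).2 y ∧
        (phaseState (1 / √2) v).2 y < (phaseState (1 / √2) v).1 y := by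
  have hR : 0 < 1 / μ := by positivity
  have hineq : ∀ y ∈ Ioo 0 (1 / μ), 0 < (phaseState (1 / √2) v).2 y ∧
        (phaseState (1 / √2) v).2 y < (phaseState (1 / √2) v).1 y := by
    intro y hy
    obtain ⟨h1, h2⟩ := h.mem y hy
    have hs : 0 < Real.sin (v y) := Real.sin_pos_of_pos_of_lt_pi h1 (by linarith)
    have hsc : Real.sin (v y) < Real.cos (v y) := by
      rw [← Real.sin_pi_div_two_sub]
      exact Real.sin_lt_sin_of_lt_of_le_pi_div_two (by linarith) (by linarith) (by linarith)
    have hκ : (0 : ℝ) < 1 / √2 := by positivity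
    refine ⟨mul_pos hκ (by linarith), mul_lt_mul_of_pos_left (by linarith) hκ⟩
  have hmid : 1 / μ / 2 ∈ Ioo 0 (1 / μ) := ⟨by positivity, by linarith⟩
  refine ⟨⟨?_, 1 / μ / 2, Ioo_subset_interv hμ hmid, (hineq _ hmid).2.ne'⟩, hineq⟩
  exact (isCriticalPoint_iff hμ (hasPhase_phaseState sq_one_div_sqrt_two)
    (H1loc_of_contDiff h.contDiff)
    (phaseState_mem_symmSpace hμ sq_one_div_sqrt_two h.contDiff h.odd)).2
    fun φ hφ => h.isProfile.firstVariation_eq_zero hμ h.contDiff h.odd hφ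

theorem IsWallPhase.isDomainWallState_of_isGlobalMinimizer (hμ : 0 < μ) (h : IsWallPhase μ v)
    (hΘ : IsGlobalMinimizer μ Θ) :
    IsDomainWallState μ Θ ∧ ∀ y ∈ Ioo 0 (1 / μ), Θ.1 y ≠ Θ.2 y := by
  have hR : 0 < 1 / μ := by positivity
  obtain ⟨κ, w, hp, hw, hodd⟩ := exists_phase hμ hΘ.1
  have hE := hp.energy_eq_halfEnergy hμ (hw.ae_differentiableAt hμ) hodd
  have hle : halfEnergy μ w ≤ halfEnergy μ v := by
    rw [← hE, ← energy_phaseState hμ h.contDiff h.odd]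
    exact hΘ.2 _ (phaseState_mem_symmSpace hμ sq_one_div_sqrt_two h.contDiff h.odd)
  have hsq := h.isProfile.sq_eq_of_halfEnergy_le hμ h.zero h.mem hw (eq_zero_of_odd hμ hodd)
    (hE ▸ hΘ.1.2.2.2.ne) hle
  -- Equal squares leave a sign at each point; v has no zero on the connected interval (0, 1/μ), so
  -- the sign is constant.
  have hcase : EqOn w v (Ioo 0 (1 / μ)) ∨ EqOn w (-v) (Ioo 0 (1 / μ)) :=
    isPreconnected_Ioo.eq_or_eq_neg_of_sq_eq ((hw.continuousOn hμ).mono (Ioo_subset_interv hμ))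
      h.contDiff.continuous.continuousOn (fun y hy => hsq y hy) fun hy => (h.mem _ hy).1.ne'
  have hne : ∀ y ∈ Ioo 0 (1 / μ), Θ.1 y ≠ Θ.2 y := by
    intro y hy heq
    have h1 := hp.fst_sub_snd (Ioo_subset_interv hμ hy)
    rw [heq, sub_self] at h1
    obtain ⟨hv1, hv2⟩ := h.mem y hy
    have hs : 0 < Real.sin (v y) := Real.sin_pos_of_pos_of_lt_pi hv1 (by linarith)
    have hs2 : Real.sin (w y) ≠ 0 := by
      rcases hcase with hc | hc
      · rw [hc hy]; exact hs.ne'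
      · rw [hc hy, Pi.neg_apply, Real.sin_neg]; exact (neg_lt_zero.2 hs).ne
    exact mul_ne_zero (mul_ne_zero two_ne_zero hp.ne_zero) hs2 h1.symm
  have hmid : 1 / μ / 2 ∈ Ioo 0 (1 / μ) := ⟨by positivity, by linarith⟩
  refine ⟨⟨(isCriticalPoint_iff hμ hp hw hΘ.1).2 fun φ hφ => ?_, _, Ioo_subset_interv hμ hmid,
    hne _ hmid⟩, hne⟩
  have hz := h.isProfile.firstVariation_eq_zero hμ h.contDiff h.odd hφ
  rcases hcase with hc | hc
  · rw [firstVariation_congr (eqOn_interv_of_odd hμ hodd (fun y _ => h.odd y) hc), hz]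
  · rw [firstVariation_congr (w := fun y => -v y)
      (eqOn_interv_of_odd hμ hodd (fun y _ => by rw [h.odd]) hc), firstVariation_neg, hz, neg_zero]

/-- Unequal components mean a phase without zeros on (0, 1/μ), hence of one sign by connectedness,
and the comparison with π/4 bounds it. Up to a sign, which leaves the energy unchanged, it is a
positive regular solution, and those minimize. -/
theorem IsCriticalPoint.isGlobalMinimizer (hμ : 0 < μ) (hc : IsCriticalPoint μ Θ)
    (hne : ∀ y ∈ Ioo 0 (1 / μ), Θ.1 y ≠ Θ.2 y) : IsGlobalMinimizer μ Θ := by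
  obtain ⟨κ, v, m, hp, hv, hodd, hprof⟩ := hc.exists_isProfile hμ
  have hE := hp.energy_eq_halfEnergy hμ (hv.ae_differentiableAt hμ) hodd
  have h0 := eq_zero_of_odd hμ hodd
  have hlt := hprof.abs_lt_pi_div_four hμ h0
  have hv0 : ∀ y ∈ Ioo 0 (1 / μ), v y ≠ 0 := by
    intro y hy hz
    have h1 := hp.fst_sub_snd (Ioo_subset_interv hμ hy)
    rw [hz, Real.sin_zero, mul_zero] at h1
    exact hne y hy (by linarith)
  have hcv := (hv.continuousOn hμ).mono (Ioo_subset_interv hμ)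
  have hcase : EqOn v (fun y => |v y|) (Ioo 0 (1 / μ)) ∨ EqOn v (-fun y => |v y|) (Ioo 0 (1 / μ)) :=
    isPreconnected_Ioo.eq_or_eq_neg_of_sq_eq hcv hcv.abs (fun y _ => (sq_abs (v y)).symm)
      fun hy => abs_ne_zero.2 (hv0 _ hy)
  refine isGlobalMinimizer_of_halfEnergy_le hμ hc.1 fun w hw hw0 => ?_
  rw [hE]
  rcases hcase with hs | hs
  · refine hprof.halfEnergy_le hμ h0 (fun y hy => ?_) hw hw0
    rw [hs hy]
    exact ⟨abs_pos.2 (hv0 y hy), hlt y (Ioo_subset_Ico_self hy)⟩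
  · rw [← halfEnergy_neg]
    refine hprof.neg.halfEnergy_le hμ (by simp [h0]) (fun y hy => ?_) hw hw0
    rw [hs hy, Pi.neg_apply, neg_neg]
    exact ⟨abs_pos.2 (hv0 y hy), hlt y (Ioo_subset_Ico_self hy)⟩

end States

end DomainWall

theorem theorem1p6 :
    ∃ μ₀ : ℝ, 0 < μ₀ ∧
      (∀ μ : ℝ, μ₀ ≤ μ →
        DomainWall.IsGlobalMinimizer μ DomainWall.symmetricState ∧
        ∀ Θ : DomainWall.State, ¬ DomainWall.IsDomainWallState μ Θ) ∧
      (∀ μ : ℝ, 0 < μ → μ < μ₀ →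
        DomainWall.IsSaddlePoint μ DomainWall.symmetricState ∧
        (∃ Θ : DomainWall.State, DomainWall.IsDomainWallState μ Θ ∧
          ∀ y ∈ Set.Ioo 0 (1 / μ), 0 < Θ.2 y ∧ Θ.2 y < Θ.1 y) ∧
        ∀ Θ : DomainWall.State, DomainWall.IsGlobalMinimizer μ Θ ↔
          DomainWall.IsDomainWallState μ Θ ∧ ∀ y ∈ Set.Ioo 0 (1 / μ), Θ.1 y ≠ Θ.2 y) := by
  obtain ⟨μ₀, hpos, hhigh, hlow⟩ := DomainWall.exists_threshold
  refine ⟨μ₀, hpos, fun μ hle => ?_, fun μ hμ hlt => ?_⟩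
  · have hμ := hpos.trans_le hle
    have hA := DomainWall.hasSmallProfiles_of_not_isUnstable hμ (hhigh μ hle)
    exact ⟨hA.isGlobalMinimizer hμ, fun Θ => hA.not_isDomainWallState hμ⟩
  · obtain ⟨v, hv⟩ := (hlow μ hμ hlt).exists_isWallPhase hμ
    exact ⟨hv.isSaddlePoint hμ, ⟨_, hv.isDomainWallState hμ⟩, fun Θ =>
      ⟨hv.isDomainWallState_of_isGlobalMinimizer hμ, fun h => h.1.1.isGlobalMinimizer hμ h.2⟩⟩
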